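/- **Theorem 1.2 (Heinz's type lemma).** Let $\alpha>-1$ and let $\mathbb D$ be the open unit disk. A function $u\in C^2(\mathbb D)$ is called a complex-valued kernel $\alpha$-harmonic mapping if $$\frac{\partial}{\partial z}\Big((1-|z|^2)^{-\alpha}\,\frac{\partial u}{\partial \bar z}\Big)=0\quad\text{in }\mathbb D .$$ We say that $u$ has coefficients $(c_k)_{k\in\mathbb Z}$ if $\limsup_{|k|\to\infty}|c_k|^{1/|k|}\le 1$ and $$u(z)=\sum_{k=0}^{\infty}c_kz^k+\sum_{k=1}^{\infty}c_{-k}P_{\alpha,k}(|z|^2)\,\bar z^{\,k},\qquad P_{\alpha,k}(x)=\int_0^1t^{k-1}(1-tx)^{\alpha}\,dt,\qquad z\in\mathbb D .$$ (1) If a complex-valued kernel $\alpha$-harmonic mapping $u$ with coefficients $(c_k)$ maps $\mathbb D$ univalently (injectively) onto $\mathbb D$, then $$|c_1|^2+\frac{3\sqrt3}{\pi}|c_0|^2+\frac{1}{(\alpha+1)^2}|c_{-1}|^2\ \ge\ \frac{27}{4\pi^2}.\qquad(*)$$ (2) For $\theta:\mathbb R\to\mathbb R$ nondecreasing with $\theta(\varphi+2\pi)=\theta(\varphi)+2\pi$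 put $$u_\theta(z)=\frac1{2\pi}\int_0^{2\pi}\mathcal P_\alpha(ze^{-i\varphi})\,e^{i\theta(\varphi)}\,d\varphi,\qquad \mathcal P_\alpha(z)=\frac{(1-|z|^2)^{\alpha+1}}{(1-z)(1-\bar z)^{\alpha+1}},\qquad z\in\mathbb D.$$ Then $(*)$ also holds for the coefficients of $u_\theta$. In this class the bound is sharp, and it is attained: if $\theta$ is the step function equal to $0,\ \frac{2\pi}3,\ \frac{4\pi}3,\ 2\pi$ on $[0,\frac\pi3),\ [\frac\pi3,\pi),\ [\pi,\frac{5\pi}3),\ [\frac{5\pi}3,2\pi)$ respectively, extended by $\theta(\varphi+2\pi)=\theta(\varphi)+2\pi$ (so that $e^{i\theta}$ takes three values), then $U=u_\theta$ is a complex-valued kernel $\alpha$-harmonic mapping, has an expansion as above, and satisfies $(*)$ with equality. (It is not claimed that $U$ maps $\mathbb D$ onto itself.) -/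

import Mathlib

open scoped ENNReal ComplexConjugate

noncomputable section

namespace KernelHarmonic

/-- The open unit disk of the complex plane. -/
def disk : Set ℂ := Metric.ball (0 : ℂ) 1

/-- The Wirtinger derivative `∂u/∂z = (u_x - i u_y) / 2`. -/
def dz (u : ℂ → ℂ) (z : ℂ) : ℂ :=
  (fderiv ℝ u z 1 - Complex.I * fderiv ℝ u z Complex.I) / 2

/-- The Wirtinger derivative `∂u/∂z̄ = (u_x + i u_y) / 2`. -/
def dzbar (u : ℂ → ℂ) (z : ℂ) : ℂ :=
  (fderiv ℝ u z 1 + Complex.I * fderiv ℝ u z Complex.I) / 2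

/-- The weighted Laplacian `Δ_α = ∂_z (1 - |z|²)^(-α) ∂_z̄`. -/
def weightedLaplacian (α : ℝ) (u : ℂ → ℂ) (z : ℂ) : ℂ :=
  dz (fun w => (((1 - ‖w‖ ^ 2) ^ (-α) : ℝ) : ℂ) * dzbar u w) z

/-- Complex-valued kernel `α`-harmonic mappings of the unit disk: `C²` solutions of
`Δ_α u = 0`. Only the values of `u` in the disk matter. -/
def IsKernelHarmonic (α : ℝ) (u : ℂ → ℂ) : Prop :=
  ContDiffOn ℝ 2 u disk ∧ ∀ z ∈ disk, weightedLaplacian α u z = 0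

/-- `P_{α,k}(x) = ∫₀¹ t^(k-1) (1 - t x)^α dt`, for `k ≥ 1` and `-1 < x < 1`. -/
def radialFactor (α : ℝ) (k : ℕ) (x : ℝ) : ℝ :=
  ∫ t in (0 : ℝ)..1, t ^ (k - 1) * (1 - t * x) ^ α

/-- `u` has in the unit disk the series expansion
`u(z) = ∑_{k ≥ 0} c_k z^k + ∑_{k ≥ 1} c_{-k} P_{α,k}(|z|²) z̄^k`,
with coefficients such that `limsup |c_k|^(1/|k|) ≤ 1` as `|k| → ∞`.
The second sum is indexed by `n = k - 1`. -/
def HasExpansion (α : ℝ) (c : ℤ → ℂ) (u : ℂ → ℂ) : Prop :=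
  Filter.limsup (fun k : ℤ => ‖c k‖ₑ ^ (1 / |(k : ℝ)|)) Filter.cofinite ≤ 1 ∧
  ∀ z ∈ disk, ∃ a b : ℂ,
    HasSum (fun k : ℕ => c (k : ℤ) * z ^ k) a ∧
    HasSum (fun n : ℕ => c (-((n : ℤ) + 1)) *
      ((radialFactor α (n + 1) (‖z‖ ^ 2) : ℝ) : ℂ) * (conj z) ^ (n + 1)) b ∧
    u z = a + b

/-- The kernel `(1 - |z|²)^(α+1) / ((1 - z) (1 - z̄)^(α+1))` on the unit disk, with the
principal branch of the power (`1 - z̄` has positive real part there). -/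
def poissonKernel (α : ℝ) (z : ℂ) : ℂ :=
  (((1 - ‖z‖ ^ 2) ^ (α + 1) : ℝ) : ℂ) /
    ((1 - z) * (1 - conj z) ^ ((α + 1 : ℝ) : ℂ))

/-- The Poisson type integral of the boundary function `e^{iφ} ↦ e^{iθ(φ)}`. -/
def poissonIntegral (α : ℝ) (θ : ℝ → ℝ) (z : ℂ) : ℂ :=
  (1 / (2 * Real.pi) : ℂ) * ∫ φ in (0 : ℝ)..(2 * Real.pi),
    poissonKernel α (z * Complex.exp (-((φ : ℂ) * Complex.I))) *
      Complex.exp ((θ φ : ℂ) * Complex.I)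

/-- `θ` is nondecreasing and `θ(φ + 2π) = θ(φ) + 2π`. -/
def IsMonotoneCircleLift (θ : ℝ → ℝ) : Prop :=
  Monotone θ ∧ ∀ φ, θ (φ + 2 * Real.pi) = θ φ + 2 * Real.pi

/-- The step function equal to `0`, `2π/3`, `4π/3`, `2π` on `[0, π/3)`, `[π/3, π)`, `[π, 5π/3)`,
`[5π/3, 2π)` respectively, continued by `θ(φ + 2π) = θ(φ) + 2π`. -/
def stepLift (φ : ℝ) : ℝ :=
  2 * Real.pi / 3 * (⌊(3 * φ + Real.pi) / (2 * Real.pi)⌋ : ℝ)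

/-- The left-hand side `|c₁|² + (3√3/π) |c₀|² + |c₋₁|² / (α + 1)²` of the inequality. -/
def heinzSum (α : ℝ) (c : ℤ → ℂ) : ℝ :=
  ‖c 1‖ ^ 2 + 3 * Real.sqrt 3 / Real.pi * ‖c 0‖ ^ 2 + 1 / (α + 1) ^ 2 * ‖c (-1)‖ ^ 2

end KernelHarmonic

end

noncomputable section
namespace KernelHarmonic

/-! ### Fourier coefficients and sums of gaps on the circle -/

open MeasureTheory Set

/-! Everything reduces to the Fourier coefficients `a n` of a boundary function `e^{iθ}` with `θ`
monotone of degree one. The kernel expands so that the extension of `F` has `c k = a k` for `k ≥ 0`,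
while `c (-k)` is `a (-k)` times a factor that equals `α + 1` for `k = 1`. The weight in `heinzSum`
cancels this factor, and the claim becomes an inequality free of `α`, `heinz_fourier`.

For that inequality let `G s` be the mean over `t` of `1 - cos (θ (t + s) - θ t)`. Parseval gives `G
s = ∑ |a n|² (1 - cos (n s))`. Nonnegative gaps of total `2π` satisfy `∑ (1 - cos) ≤ 9/2`, because
gaps can be merged until three are left (`sum_one_sub_cos_le`). Applied to `2m` arcs of alternating
lengths this gives `G y + G (2π/m - y) ≤ 9/(2m)`, so that `H s = G s - 9s/(4π)` satisfies `H s + H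
(2π/m - s) ≤ 0`. Repeated folding then shows `∫ sin (2π/3 - s) H s ≤ 0` over `[0, 2π/3]`
(`sineWeighted_nonpos`). On the Fourier side this weight has a multiplier that is at least `3/2` for
`|n| ≥ 2`; subtracting `3/2 ∑ |a n|² = 3/2` leaves only `n = -1, 0, 1`.

For a bijection `u` of the disk the boundary function has to be found. Since `|u| ≤ 1`, the Fourier
coefficients of `u` on circles tend to a square summable sequence; Riesz–Fischer yields `F` whose
extension is `u`, and a Fatou theorem gives the radial limit `F t` for almost every `t`
(`HasExpansion.exists_boundary`). Winding numbers give invariance of domain, hence properness of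
`u`. The images of distinct radii are disjoint off the centre, so a planar crossing lemma forces
those that converge to land in cyclic order; thus `F` or its conjugate is `e^{iθ}` almost everywhere
(`exists_isMonotoneCircleLift_of_bijOn`).

For equality, the three-valued step function has `a 0 = a (-1) = 0` by its threefold symmetry, and
`a 1 = 3√3/(2π)`. Its extension is kernel harmonic because the `z̄`-derivative of the kernel is `(1
- |z|²)^α` times an antiholomorphic function. -/

/-- The `n`-th Fourier coefficient of `f` over the period interval `[0, 2π]`. -/
def circleCoeff (f : ℝ → ℂ) (n : ℤ) : ℂ :=
  (1 / (2 * Real.pi) : ℂ) * ∫ t in (0 : ℝ)..(2 * Real.pi),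
    Complex.exp (-((n : ℂ) * t * Complex.I)) * f t

lemma circleCoeff_eq_fourierCoeffOn (f : ℝ → ℂ) (n : ℤ) :
    circleCoeff f n = fourierCoeffOn Real.two_pi_pos f n := by
  rw [fourierCoeffOn_eq_integral, circleCoeff, sub_zero, Complex.real_smul]
  push_cast
  congr 1
  refine intervalIntegral.integral_congr fun t _ => ?_
  have : (Real.pi : ℂ) ≠ 0 := by exact_mod_cast Real.pi_ne_zero
  rw [fourier_coe_apply, smul_eq_mul]
  congr 2
  push_cast
  field_simp

lemma hasSum_norm_circleCoeff_sq {f : ℝ → ℂ}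
    (hf : MemLp f 2 (volume.restrict (Ioc 0 (2 * Real.pi)))) :
    HasSum (fun n => ‖circleCoeff f n‖ ^ 2)
      ((1 / (2 * Real.pi)) * ∫ t in (0 : ℝ)..(2 * Real.pi), ‖f t‖ ^ 2) := by
  have h := hasSum_sq_fourierCoeffOn Real.two_pi_pos hf
  simp only [circleCoeff_eq_fourierCoeffOn]
  simpa using h

/-- Expanding `|1 + e^{ix} + e^{-iy}|² ≥ 0` gives `cos x + cos y + cos (x + y) ≥ -3/2`. Equality
holds for three gaps `2π/3`. -/
lemma three_gaps (x y z : ℝ) (h : x + y + z = 2 * Real.pi) :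
    (1 - Real.cos x) + (1 - Real.cos y) + (1 - Real.cos z) ≤ 9 / 2 := by
  have hz : Real.cos z = Real.cos (x + y) := by
    rw [show z = 2 * Real.pi - (x + y) by linarith, Real.cos_two_pi_sub]
  rw [hz, Real.cos_add]
  have hx := Real.sin_sq_add_cos_sq x
  have hy := Real.sin_sq_add_cos_sq y
  nlinarith [sq_nonneg (Real.cos x + Real.cos y + 1), sq_nonneg (Real.sin x - Real.sin y)]

/-- The difference of the two sides is `4 sin (x/2) sin (y/2) cos ((x+y)/2)`, each factor being
nonnegative. -/
lemma merge_gaps {x y : ℝ} (hx : 0 ≤ x) (hy : 0 ≤ y) (h : x + y ≤ Real.pi) :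
    (1 - Real.cos x) + (1 - Real.cos y) ≤ 1 - Real.cos (x + y) := by
  have h1 := Real.sin_nonneg_of_nonneg_of_le_pi (x := x / 2) (by linarith) (by linarith)
  have h2 := Real.sin_nonneg_of_nonneg_of_le_pi (x := y / 2) (by linarith) (by linarith)
  have h3 := Real.cos_nonneg_of_neg_pi_div_two_le_of_le (x := (x + y) / 2)
    (by linarith) (by linarith)
  have e : 1 - Real.cos (x + y) - ((1 - Real.cos x) + (1 - Real.cos y)) =
      4 * Real.sin (x / 2) * Real.sin (y / 2) * Real.cos ((x + y) / 2) := by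
    have ex : x = 2 * (x / 2) := by ring
    have ey : y = 2 * (y / 2) := by ring
    have exy : (x + y) / 2 = x / 2 + y / 2 := by ring
    rw [exy]
    conv_lhs => rw [ex, ey]
    rw [Real.cos_add (2 * _), Real.cos_two_mul, Real.cos_two_mul, Real.sin_two_mul,
      Real.sin_two_mul, Real.cos_add]
    have hx := Real.sin_sq_add_cos_sq (x / 2)
    have hy := Real.sin_sq_add_cos_sq (y / 2)
    set a := Real.sin (x / 2)
    set b := Real.sin (y / 2)
    have ha : Real.cos (x / 2) ^ 2 = 1 - a ^ 2 := by linarith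
    have hb : Real.cos (y / 2) ^ 2 = 1 - b ^ 2 := by linarith
    rw [ha, hb]; ring
  have := mul_nonneg (mul_nonneg h1 h2) h3
  nlinarith

/-- Among four gaps `a, b, c, d`, one of `a + b`, `c + d` is at most `π`, and merging that pair does
not lower the sum. Induction ends at three gaps. -/
lemma sum_one_sub_cos_le : ∀ (n : ℕ) (l : List ℝ), l.length = n → (∀ x ∈ l, 0 ≤ x) →
    l.sum = 2 * Real.pi → (l.map fun x => 1 - Real.cos x).sum ≤ 9 / 2 := by
  intro n
  induction n using Nat.strong_induction_on with
  | _ n ih =>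
    intro l hn hl hs
    match l, hn, hl, hs with
    | [], _, _, hs => simp at hs ⊢
    | [a], _, _, hs =>
      simp at hs ⊢; rw [hs]; norm_num
    | [a, b], _, _, hs =>
      simp at hs ⊢
      have := three_gaps a b 0 (by linarith)
      simp at this; linarith
    | [a, b, c], _, _, hs =>
      simp at hs ⊢
      have := three_gaps a b c (by linarith)
      linarith
    | a :: b :: c :: d :: l, hn, hl, hs =>
      simp only [List.length_cons] at hn
      simp only [List.mem_cons, forall_eq_or_imp] at hl
      obtain ⟨ha, hb, hc, hd, hl⟩ := hl
      simp only [List.sum_cons, List.map_cons] at hs ⊢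
      have hls : 0 ≤ l.sum := List.sum_nonneg hl
      rcases le_total (a + b) Real.pi with h | h
      · have := ih (n - 1) (by omega) ((a + b) :: c :: d :: l) (by simp; omega)
          (by simp only [List.mem_cons, forall_eq_or_imp]; exact ⟨by linarith, hc, hd, hl⟩)
          (by simp only [List.sum_cons]; linarith)
        simp only [List.sum_cons, List.map_cons] at this
        linarith [merge_gaps ha hb h]
      · have h' : c + d ≤ Real.pi := by linarith
        have := ih (n - 1) (by omega) (a :: b :: (c + d) :: l) (by simp; omega)
          (by simp only [List.mem_cons, forall_eq_or_imp]; exact ⟨ha, hb, by linarith, hl⟩)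
          (by simp only [List.sum_cons]; linarith)
        simp only [List.sum_cons, List.map_cons] at this
        linarith [merge_gaps hc hd h']

lemma sum_range_one_sub_cos_le {N : ℕ} {x : ℕ → ℝ} (hx : ∀ i < N, 0 ≤ x i)
    (hs : ∑ i ∈ Finset.range N, x i = 2 * Real.pi) :
    ∑ i ∈ Finset.range N, (1 - Real.cos (x i)) ≤ 9 / 2 := by
  have := sum_one_sub_cos_le N ((List.range N).map x) (by simp) (by simpa using hx)
    (by rw [← hs, Finset.sum_range, ← List.sum_ofFn, List.ofFn_eq_map, ← List.map_coe_finRange_eq_range, List.map_map]; rfl)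
  rw [List.map_map, Function.comp_def] at this
  convert this using 1
  rw [Finset.sum_range, ← List.sum_ofFn, List.ofFn_eq_map, ← List.map_coe_finRange_eq_range, List.map_map]; rfl

/-- The mean of `1 - cos` of the increments of `θ` over steps of length `s`. -/
def meanIncrement (θ : ℝ → ℝ) (s : ℝ) : ℝ :=
  (1 / (2 * Real.pi)) * ∫ t in (0 : ℝ)..(2 * Real.pi), (1 - Real.cos (θ (t + s) - θ t))

variable {θ : ℝ → ℝ}

lemma IsMonotoneCircleLift.measurable (hθ : IsMonotoneCircleLift θ) : Measurable θ :=
  hθ.1.measurable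

lemma intervalIntegrable_increment (hθ : Measurable θ) (s s' a b : ℝ) :
    IntervalIntegrable (fun t => 1 - Real.cos (θ (t + s) - θ (t + s'))) volume a b := by
  refine (intervalIntegrable_const (c := (2 : ℝ))).mono_fun ?_ ?_
  · have : Measurable (fun t => 1 - Real.cos (θ (t + s) - θ (t + s'))) := by fun_prop
    exact this.aestronglyMeasurable
  · refine Filter.Eventually.of_forall fun t => ?_
    simp only [Real.norm_eq_abs]
    rw [abs_of_nonneg (by linarith [Real.cos_le_one (θ (t + s) - θ (t + s'))])]
    rw [abs_of_pos two_pos]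
    linarith [Real.neg_one_le_cos (θ (t + s) - θ (t + s'))]

lemma meanIncrement_shift (hθ : IsMonotoneCircleLift θ) (s a : ℝ) :
    (1 / (2 * Real.pi)) * ∫ t in (0 : ℝ)..(2 * Real.pi),
      (1 - Real.cos (θ (t + (a + s)) - θ (t + a))) = meanIncrement θ s := by
  have hp : Function.Periodic (fun t => 1 - Real.cos (θ (t + s) - θ t)) (2 * Real.pi) := by
    intro t
    simp only
    rw [show t + 2 * Real.pi + s = t + s + 2 * Real.pi by ring, hθ.2, hθ.2]
    congr 2; ring
  have h1 := intervalIntegral.integral_comp_add_right (a := 0) (b := 2 * Real.pi)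
    (fun t => 1 - Real.cos (θ (t + s) - θ t)) a
  rw [meanIncrement]
  congr 1
  rw [zero_add, add_comm (2 * Real.pi) a, hp.intervalIntegral_add_eq a 0, zero_add] at h1
  rw [← h1]
  congr 1; ext t; ring_nf

/-- Cut the period starting at `t` into `2m` arcs of alternating lengths `y` and `L - y`. The
increments of `θ` over them are nonnegative with sum `2π`, so the gap bound holds for every `t`; on
averaging over `t`, each arc contributes a value of `meanIncrement` by periodicity. -/
lemma meanIncrement_add_le (hθ : IsMonotoneCircleLift θ) {m : ℕ} (hm : 0 < m) {y : ℝ}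
    (hy : 0 ≤ y) (hyL : y ≤ 2 * Real.pi / m) :
    meanIncrement θ y + meanIncrement θ (2 * Real.pi / m - y) ≤ 9 / (2 * m) := by
  set L := 2 * Real.pi / m with hL
  have hm' : (0 : ℝ) < m := by exact_mod_cast hm
  have hmL : m * L = 2 * Real.pi := by rw [hL]; field_simp
  have key : ∀ t, ∑ j ∈ Finset.range m, ((1 - Real.cos (θ (t + (j * L + y)) - θ (t + j * L))) +
      (1 - Real.cos (θ (t + (j * L + y + (L - y))) - θ (t + (j * L + y))))) ≤ 9 / 2 := by
    intro t
    -- Even indices carry the arcs of length `y`, odd ones those of length `L - y`.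
    let x : ℕ → ℝ := fun i => if i % 2 = 0 then θ (t + ((i / 2 : ℕ) * L + y)) - θ (t + (i / 2 : ℕ) * L)
      else θ (t + ((i / 2 : ℕ) * L + y + (L - y))) - θ (t + ((i / 2 : ℕ) * L + y))
    have pair : ∀ f : ℕ → ℝ, ∑ i ∈ Finset.range (2 * m), f i =
        ∑ j ∈ Finset.range m, (f (2 * j) + f (2 * j + 1)) := by
      intro f
      clear hL hyL hm' hmL hm
      clear_value L
      induction m with
      | zero => simp
      | succ k ih => rw [show 2 * (k + 1) = 2 * k + 1 + 1 by ring, Finset.sum_range_succ,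
          Finset.sum_range_succ, ih, Finset.sum_range_succ]; ring
    have e0 : ∀ j, x (2 * j) = θ (t + (j * L + y)) - θ (t + j * L) := by intro j; simp [x]
    have e1 : ∀ j, x (2 * j + 1) = θ (t + (j * L + y + (L - y))) - θ (t + (j * L + y)) := by
      intro j
      have h1 : (2 * j + 1) / 2 = j := by omega
      have h2 : (2 * j + 1) % 2 = 1 := by omega
      simp [x, h1, h2]
    have hx : ∀ i < 2 * m, 0 ≤ x i := by
      intro i _
      simp only [x]
      split_ifs
      · exact sub_nonneg.2 (hθ.1 (by linarith))
      · exact sub_nonneg.2 (hθ.1 (by linarith))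
    have hs : ∑ i ∈ Finset.range (2 * m), x i = 2 * Real.pi := by
      rw [pair]
      have : ∀ j : ℕ, x (2 * j) + x (2 * j + 1) = θ (t + ((j + 1 : ℕ) : ℝ) * L) - θ (t + j * L) := by
        intro j
        rw [e0, e1]
        have : t + (j * L + y + (L - y)) = t + ((j + 1 : ℕ) : ℝ) * L := by push_cast; ring
        rw [this]; ring
      simp only [this]
      rw [Finset.sum_range_sub (fun j : ℕ => θ (t + j * L)), hmL, hθ.2]
      simp
    have := sum_range_one_sub_cos_le hx hs
    rw [pair] at this
    simpa only [e0, e1] using this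
  have int1 : ∀ j : ℕ, IntervalIntegrable (fun t => (1 - Real.cos (θ (t + (j * L + y)) - θ (t + j * L))))
    volume 0 (2 * Real.pi) := fun j => intervalIntegrable_increment hθ.measurable _ _ _ _
  have int2 : ∀ j : ℕ, IntervalIntegrable (fun t => (1 - Real.cos (θ (t + (j * L + y + (L - y))) - θ (t + (j * L + y)))))
    volume 0 (2 * Real.pi) := fun j => intervalIntegrable_increment hθ.measurable _ _ _ _
  have hint := intervalIntegral.integral_mono (a := 0) (b := 2 * Real.pi) Real.two_pi_pos.le
    (f := fun t => ∑ j ∈ Finset.range m, ((1 - Real.cos (θ (t + (j * L + y)) - θ (t + j * L))) +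
      (1 - Real.cos (θ (t + (j * L + y + (L - y))) - θ (t + (j * L + y))))))
    (g := fun _ => 9 / 2) (μ := volume)
    (by
      have := IntervalIntegrable.sum (μ := volume) (a := 0) (b := 2 * Real.pi) (Finset.range m)
        (fun j _ => (int1 j).add (int2 j))
      rw [Finset.sum_fn] at this
      exact this) intervalIntegrable_const key
  rw [intervalIntegral.integral_finsetSum (fun j _ => (int1 j).add (int2 j))] at hint
  have e : ∀ j : ℕ, (∫ t in (0 : ℝ)..(2 * Real.pi), ((1 - Real.cos (θ (t + (j * L + y)) - θ (t + j * L))) +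
      (1 - Real.cos (θ (t + (j * L + y + (L - y))) - θ (t + (j * L + y)))))) =
      2 * Real.pi * (meanIncrement θ y + meanIncrement θ (L - y)) := by
    intro j
    rw [intervalIntegral.integral_add (int1 j) (int2 j), ← meanIncrement_shift hθ y (j * L),
      ← meanIncrement_shift hθ (L - y) (j * L + y)]
    field_simp
  simp only [e, Finset.sum_const, Finset.card_range, nsmul_eq_mul, intervalIntegral.integral_const,
    smul_eq_mul, sub_zero] at hint
  rw [le_div_iff₀ (by positivity)]
  have := Real.pi_pos
  have h2 : 0 < 2 * Real.pi := by positivity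
  have : 2 * Real.pi * ((meanIncrement θ y + meanIncrement θ (L - y)) * (2 * m)) ≤ 2 * Real.pi * 9 := by
    linarith
  exact le_of_mul_le_mul_left this h2

end KernelHarmonic
end

noncomputable section
namespace KernelHarmonic

/-! ### The Fourier coefficients of monotone circle maps -/

open MeasureTheory Set

/-- Dominated convergence with a majorant in product form, the shape shared by all the termwise
integrations that follow. -/
lemma hasSum_intervalIntegral_of_norm_le {ι E : Type*} [Countable ι] [NormedAddCommGroup E]
    [NormedSpace ℝ E] {f : ι → ℝ → E} {F : ℝ → E} {B : ι → ℝ} {g : ℝ → ℝ} {a b : ℝ}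
    (hf : ∀ i, AEStronglyMeasurable (f i) (volume.restrict (uIoc a b)))
    (hle : ∀ i, ∀ t ∈ uIoc a b, ‖f i t‖ ≤ B i * g t) (hB : Summable B)
    (hg : IntervalIntegrable g volume a b)
    (hF : ∀ t ∈ uIoc a b, HasSum (fun i => f i t) (F t)) :
    HasSum (fun i => ∫ t in a..b, f i t) (∫ t in a..b, F t) := by
  refine intervalIntegral.hasSum_integral_of_dominated_convergence (fun i t => B i * g t) hf
    (fun i => Filter.Eventually.of_forall (hle i))
    (Filter.Eventually.of_forall fun t _ => hB.mul_right _) ?_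
    (Filter.Eventually.of_forall hF)
  simp only [tsum_mul_right]
  exact hg.const_mul _

lemma exp_periodic (n : ℤ) :
    Function.Periodic (fun t : ℝ => Complex.exp (-((n : ℂ) * t * Complex.I))) (2 * Real.pi) := by
  intro t
  simp only
  rw [show -((n : ℂ) * ((t + 2 * Real.pi : ℝ) : ℂ) * Complex.I) =
    -((n : ℂ) * t * Complex.I) + ((-n : ℤ) : ℂ) * (2 * Real.pi * Complex.I) by push_cast; ring,
    Complex.exp_add, Complex.exp_int_mul_two_pi_mul_I, mul_one]

lemma circleCoeff_shift {f : ℝ → ℂ} (hf : Function.Periodic f (2 * Real.pi)) (s : ℝ) (n : ℤ) :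
    circleCoeff (fun t => f (t + s)) n = Complex.exp ((n : ℂ) * s * Complex.I) * circleCoeff f n := by
  unfold circleCoeff
  have h1 := intervalIntegral.integral_comp_add_right (a := 0) (b := 2 * Real.pi)
    (fun t => Complex.exp (-((n : ℂ) * t * Complex.I)) * f t) s
  have h2 := ((exp_periodic n).mul hf).intervalIntegral_add_eq s 0
  simp only [Pi.mul_apply] at h2
  rw [zero_add, add_comm (2 * Real.pi) s, h2, zero_add] at h1
  rw [← h1, mul_left_comm, ← intervalIntegral.integral_const_mul (Complex.exp _)]
  congr 1
  refine intervalIntegral.integral_congr fun t _ => ?_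
  simp only
  rw [← mul_assoc, ← Complex.exp_add]
  congr 2
  push_cast; ring

lemma circleCoeff_sub {f g : ℝ → ℂ} (hf : IntervalIntegrable f volume 0 (2 * Real.pi))
    (hg : IntervalIntegrable g volume 0 (2 * Real.pi)) (n : ℤ) :
    circleCoeff (fun t => f t - g t) n = circleCoeff f n - circleCoeff g n := by
  have hc : ContinuousOn (fun t : ℝ => Complex.exp (-((n : ℂ) * t * Complex.I)))
    (uIcc 0 (2 * Real.pi)) := by fun_prop
  simp only [circleCoeff, mul_sub]
  rw [intervalIntegral.integral_sub (hf.continuousOn_mul hc) (hg.continuousOn_mul hc), mul_sub]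

/-- The unimodular function `t ↦ e^{iθ(t)}`. -/
def unimodular (θ : ℝ → ℝ) (t : ℝ) : ℂ := Complex.exp ((θ t : ℂ) * Complex.I)

variable {θ : ℝ → ℝ}

lemma norm_unimodular (t : ℝ) : ‖unimodular θ t‖ = 1 := Complex.norm_exp_ofReal_mul_I _

lemma measurable_unimodular (hθ : Measurable θ) : Measurable (unimodular θ) := by
  unfold unimodular; fun_prop

lemma IsMonotoneCircleLift.periodic_unimodular (hθ : IsMonotoneCircleLift θ) :
    Function.Periodic (unimodular θ) (2 * Real.pi) := by
  intro t
  simp only [unimodular]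
  rw [hθ.2, show ((θ t + 2 * Real.pi : ℝ) : ℂ) * Complex.I = θ t * Complex.I + 2 * Real.pi * Complex.I
    by push_cast; ring, Complex.exp_add, Complex.exp_two_pi_mul_I, mul_one]

lemma memLp_of_norm_le {f : ℝ → ℂ} (hf : Measurable f) {C : ℝ} (hC : ∀ t, ‖f t‖ ≤ C)
    (p : ℝ≥0∞) : MemLp f p (volume.restrict (Ioc 0 (2 * Real.pi))) :=
  MemLp.of_bound hf.aestronglyMeasurable C (Filter.Eventually.of_forall hC)

lemma intervalIntegrable_of_norm_le {f : ℝ → ℂ} (hf : Measurable f) {C : ℝ} (hC : ∀ t, ‖f t‖ ≤ C)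
    (a b : ℝ) : IntervalIntegrable f volume a b :=
  (intervalIntegrable_const (c := C)).mono_fun hf.aestronglyMeasurable
    (Filter.Eventually.of_forall fun t => (hC t).trans (le_abs_self C))

lemma hasSum_norm_circleCoeff_unimodular (hθ : Measurable θ) :
    HasSum (fun n => ‖circleCoeff (unimodular θ) n‖ ^ 2) 1 := by
  have := hasSum_norm_circleCoeff_sq
    (memLp_of_norm_le (measurable_unimodular hθ) (fun t => (norm_unimodular t).le) 2)
  simp only [norm_unimodular] at this
  convert this using 1
  have := Real.pi_pos
  simp; field_simp

/-- Parseval for `t ↦ e^{iθ(t+s)} - e^{iθ(t)}`, whose coefficients are `(e^{ins} - 1) a n`, together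
with `|e^{ix} - 1|² = 2 (1 - cos x)`. -/
lemma hasSum_meanIncrement (hθ : IsMonotoneCircleLift θ) (s : ℝ) :
    HasSum (fun n : ℤ => ‖circleCoeff (unimodular θ) n‖ ^ 2 * (1 - Real.cos (n * s)))
      (meanIncrement θ s) := by
  have hm := measurable_unimodular hθ.measurable
  have hm' : Measurable (fun t => unimodular θ (t + s)) := hm.comp (measurable_add_const s)
  have i1 := intervalIntegrable_of_norm_le hm (fun t => (norm_unimodular t).le) 0 (2 * Real.pi)
  have i2 := intervalIntegrable_of_norm_le hm' (fun t => (norm_unimodular _).le) 0 (2 * Real.pi)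
  have hb : ∀ t, ‖unimodular θ (t + s) - unimodular θ t‖ ≤ 2 := fun t => by
    refine (norm_sub_le _ _).trans ?_
    rw [norm_unimodular, norm_unimodular]; norm_num
  have h := hasSum_norm_circleCoeff_sq (memLp_of_norm_le (hm'.sub hm) hb 2)
  have nsq : ∀ x : ℝ, ‖Complex.exp (x * Complex.I) - 1‖ ^ 2 = 2 * (1 - Real.cos x) := by
    intro x
    rw [← Complex.normSq_eq_norm_sq, Complex.normSq_apply]
    simp only [Complex.sub_re, Complex.exp_ofReal_mul_I_re, Complex.one_re, Complex.sub_im,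
      Complex.exp_ofReal_mul_I_im, Complex.one_im, sub_zero]
    nlinarith [Real.sin_sq_add_cos_sq x]
  have e1 : ∀ n : ℤ, ‖circleCoeff (fun t => unimodular θ (t + s) - unimodular θ t) n‖ ^ 2 =
      2 * (‖circleCoeff (unimodular θ) n‖ ^ 2 * (1 - Real.cos (n * s))) := by
    intro n
    rw [circleCoeff_sub i2 i1, circleCoeff_shift hθ.periodic_unimodular, ← sub_one_mul, norm_mul,
      mul_pow, show (n : ℂ) * s * Complex.I = ((n * s : ℝ) : ℂ) * Complex.I by push_cast; ring, nsq]
    ring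
  have e2 : ∀ t, ‖unimodular θ (t + s) - unimodular θ t‖ ^ 2 =
      2 * (1 - Real.cos (θ (t + s) - θ t)) := by
    intro t
    have : unimodular θ (t + s) - unimodular θ t =
        (Complex.exp (((θ (t + s) - θ t : ℝ) : ℂ) * Complex.I) - 1) * unimodular θ t := by
      simp only [unimodular, sub_one_mul, ← Complex.exp_add]
      congr 2; push_cast; ring
    rw [this, norm_mul, norm_unimodular, mul_one, nsq]
  have h2 := h.mul_left (1 / 2)
  have e3 : (fun n : ℤ => 1 / 2 * ‖circleCoeff ((fun t => unimodular θ (t + s)) - unimodular θ) n‖ ^ 2) =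
      fun n : ℤ => ‖circleCoeff (unimodular θ) n‖ ^ 2 * (1 - Real.cos (n * s)) := by
    funext n
    rw [show (fun t => unimodular θ (t + s)) - unimodular θ =
      fun t => unimodular θ (t + s) - unimodular θ t from rfl, e1]; ring
  rw [e3] at h2
  simp only [Pi.sub_apply, e2, intervalIntegral.integral_const_mul] at h2
  rwa [show ∀ I : ℝ, 1 / 2 * (1 / (2 * Real.pi) * (2 * I)) = 1 / (2 * Real.pi) * I by intro I; ring]
    at h2

/-- Since `θ` may jump, continuity is read off from the uniformly convergent Fourier series. -/
lemma continuous_meanIncrement (hθ : IsMonotoneCircleLift θ) : Continuous (meanIncrement θ) := by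
  have : meanIncrement θ = fun s =>
      ∑' n : ℤ, ‖circleCoeff (unimodular θ) n‖ ^ 2 * (1 - Real.cos (n * s)) :=
    funext fun s => (hasSum_meanIncrement hθ s).tsum_eq.symm
  rw [this]
  refine continuous_tsum (fun n => by fun_prop)
    ((hasSum_norm_circleCoeff_unimodular hθ.measurable).summable.mul_right 2) fun n s => ?_
  rw [norm_mul, Real.norm_of_nonneg (sq_nonneg _)]
  gcongr
  rw [Real.norm_of_nonneg (by linarith [Real.cos_le_one (n * s)])]
  linarith [Real.neg_one_le_cos (n * s)]

/-! ### The sine weight and its Fourier multiplier. -/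

/-- The weighted integral of `H` against `sin (L - s)` over `[0, L]`. -/
def sineWeighted (H : ℝ → ℝ) (L : ℝ) : ℝ := ∫ s in (0 : ℝ)..L, Real.sin (L - s) * H s

/-- Fold the second half onto the first by `s ↦ L - s`, replace `H (L - s)` by `-H s`, and use `sin
(L - s) - sin s = 2 cos (L/2) sin (L/2 - s)`. -/
lemma sineWeighted_halve {H : ℝ → ℝ} (hH : Continuous H) {L : ℝ} (hL : 0 ≤ L) (hLpi : L ≤ Real.pi)
    (h : ∀ s, 0 ≤ s → s ≤ L → H s + H (L - s) ≤ 0) :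
    sineWeighted H L ≤ 2 * Real.cos (L / 2) * sineWeighted H (L / 2) := by
  have ii : ∀ {f : ℝ → ℝ} (a b : ℝ), Continuous f → IntervalIntegrable f volume a b :=
    fun a b hf => hf.intervalIntegrable a b
  have split : sineWeighted H L = (∫ s in (0 : ℝ)..(L / 2), Real.sin (L - s) * H s) +
      ∫ s in (0 : ℝ)..(L / 2), Real.sin s * H (L - s) := by
    rw [sineWeighted, ← intervalIntegral.integral_add_adjacent_intervals (b := L / 2)
      (ii _ _ (by fun_prop)) (ii _ _ (by fun_prop))]
    congr 1
    have := intervalIntegral.integral_comp_sub_left (a := 0) (b := L / 2)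
      (fun s => Real.sin (L - s) * H s) L
    simp only [sub_sub_cancel, sub_zero] at this
    rw [this]; congr 1; ring
  have le : (∫ s in (0 : ℝ)..(L / 2), Real.sin s * H (L - s)) ≤
      ∫ s in (0 : ℝ)..(L / 2), -(Real.sin s * H s) := by
    refine intervalIntegral.integral_mono_on (by linarith) (ii _ _ (by fun_prop))
      (ii _ _ (by fun_prop)) fun s hs => ?_
    have := Real.sin_nonneg_of_nonneg_of_le_pi hs.1 (by linarith [hs.2])
    nlinarith [h s hs.1 (by linarith [hs.2])]
  rw [split]
  refine (add_le_add_right le _).trans (le_of_eq ?_)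
  rw [← intervalIntegral.integral_add (ii _ _ (by fun_prop)) (ii _ _ (by fun_prop)), sineWeighted,
    ← intervalIntegral.integral_const_mul]
  refine intervalIntegral.integral_congr fun s _ => ?_
  have : Real.sin (L - s) - Real.sin s = 2 * Real.cos (L / 2) * Real.sin (L / 2 - s) := by
    rw [Real.sin_sub_sin]
    rw [show (L - s + s) / 2 = L / 2 by ring, show (L - s - s) / 2 = L / 2 - s by ring]; ring
  linear_combination H s * this

lemma abs_sineWeighted_le {H : ℝ → ℝ} {C : ℝ} {L : ℝ} (hL : 0 ≤ L)
    (h : ∀ s, 0 ≤ s → s ≤ L → |H s| ≤ C) :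
    |sineWeighted H L| ≤ C * L ^ 2 := by
  have := intervalIntegral.norm_integral_le_of_norm_le_const (a := 0) (b := L) (C := L * C)
    (f := fun s => Real.sin (L - s) * H s) (fun s hs => by
      rw [uIoc_of_le hL] at hs
      rw [norm_mul]
      have h1 : |Real.sin (L - s)| ≤ L := by
        have := Real.abs_sin_le_abs (x := L - s)
        rw [abs_of_nonneg (a := L - s) (by linarith [hs.2])] at this
        linarith [hs.1]
      exact mul_le_mul h1 (h s hs.1.le hs.2) (abs_nonneg _) hL)
  rw [sub_zero, abs_of_nonneg hL] at this
  calc _ ≤ _ := this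
    _ = _ := by ring

/-- If the value `S` at `2π/3` were positive, halving `k` times would give `S ≤ 2^k · sineWeighted H
(L k)`, whereas `sineWeighted H (L k)` is `O((L k)²) = O(4^{-k})`. -/
lemma sineWeighted_nonpos {H : ℝ → ℝ} (hH : Continuous H)
    (h : ∀ m : ℕ, 2 < m → ∀ s, 0 ≤ s → s ≤ 2 * Real.pi / m → H s + H (2 * Real.pi / m - s) ≤ 0) :
    sineWeighted H (2 * Real.pi / 3) ≤ 0 := by
  have hpi := Real.pi_pos
  set L : ℕ → ℝ := fun k => 2 * Real.pi / (3 * 2 ^ k : ℕ) with hL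
  have Lpos : ∀ k, 0 < L k := fun k => by simp only [hL]; positivity
  have Lsucc : ∀ k, L (k + 1) = L k / 2 := fun k => by
    simp only [hL]; push_cast; rw [pow_succ]; field_simp
  have Leq : ∀ k, L k = 2 * Real.pi / 3 * (1 / 2) ^ k := fun k => by
    simp only [hL]; push_cast; rw [one_div, inv_pow]; field_simp
  have Lle : ∀ k, L k ≤ 2 * Real.pi / 3 := fun k => by
    rw [Leq]
    exact mul_le_of_le_one_right (by positivity) (pow_le_one₀ (by norm_num) (by norm_num))
  obtain ⟨C, hC⟩ := (isCompact_Icc (a := (0 : ℝ)) (b := 2 * Real.pi / 3)).exists_bound_of_continuousOn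
    hH.continuousOn
  by_contra! hneg
  have step : ∀ k, sineWeighted H (2 * Real.pi / 3) ≤ 2 ^ k * sineWeighted H (L k) := by
    intro k
    induction k with
    | zero => simp [hL]
    | succ k ih =>
      have h0 : 0 < sineWeighted H (L k) := by
        have : 0 < 2 ^ k * sineWeighted H (L k) := hneg.trans_le ih
        exact pos_of_mul_pos_right this (by positivity)
      have h1 := sineWeighted_halve hH (Lpos k).le ((Lle k).trans (by linarith))
        (h (3 * 2 ^ k) (by have := Nat.one_le_two_pow (n := k); omega))
      rw [← Lsucc] at h1
      -- The bound `cos ≤ 1` may be used only because the halved integral is positive, which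
      -- positivity of the larger one forces.
      have h2 : 2 * Real.cos (L (k + 1)) * sineWeighted H (L (k + 1)) ≤ 2 * sineWeighted H (L (k + 1)) := by
        have hc : 0 ≤ Real.cos (L (k + 1)) := Real.cos_nonneg_of_neg_pi_div_two_le_of_le
          (by linarith [Lpos (k + 1)]) (by rw [Lsucc]; linarith [Lle k])
        have hp : 0 < sineWeighted H (L (k + 1)) := by
          by_contra! hn
          have := mul_nonpos_of_nonneg_of_nonpos (mul_nonneg two_pos.le hc) hn
          linarith
        have := Real.cos_le_one (L (k + 1))
        nlinarith
      calc _ ≤ _ := ih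
        _ ≤ 2 ^ k * (2 * sineWeighted H (L (k + 1))) := by gcongr; exact h1.trans h2
        _ = _ := by ring
  have bound : ∀ k, sineWeighted H (2 * Real.pi / 3) ≤
      C * (2 * Real.pi / 3) ^ 2 * (1 / 2) ^ k := by
    intro k
    refine (step k).trans ?_
    have := abs_sineWeighted_le (Lpos k).le
      (fun s h0 h1 => hC s ⟨h0, h1.trans (Lle k)⟩)
    calc _ ≤ 2 ^ k * (C * L k ^ 2) := by gcongr; exact (le_abs_self _).trans this
      _ = C * (2 * Real.pi / 3) ^ 2 * ((1 / 2) ^ k * (2 ^ k * (1 / 2) ^ k)) := by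
        rw [Leq]; ring
      _ = _ := by rw [← mul_pow]; norm_num
  have lim : Filter.Tendsto (fun k : ℕ => C * (2 * Real.pi / 3) ^ 2 * (1 / 2 : ℝ) ^ k)
      Filter.atTop (nhds (C * (2 * Real.pi / 3) ^ 2 * 0)) :=
    (tendsto_pow_atTop_nhds_zero_of_lt_one (by norm_num) (by norm_num)).const_mul _
  rw [mul_zero] at lim
  exact hneg.not_ge (ge_of_tendsto' lim bound)

/-- The factor `1 - n²` stays on the left so that one identity covers all `n`; it says nothing at
the resonance `n = ±1`, which is computed separately. -/
lemma integral_sin_mul_cos (L : ℝ) (n : ℤ) :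
    (1 - (n : ℝ) ^ 2) * ∫ s in (0 : ℝ)..L, Real.sin (L - s) * Real.cos (n * s) =
      Real.cos (n * L) - Real.cos L := by
  have hd : ∀ s : ℝ, HasDerivAt (fun s => Real.cos (L - s) * Real.cos (n * s) -
      n * (Real.sin (L - s) * Real.sin (n * s)))
      ((1 - (n : ℝ) ^ 2) * (Real.sin (L - s) * Real.cos (n * s))) s := by
    intro s
    have h1 : HasDerivAt (fun s => L - s) (-1) s := by simpa using (hasDerivAt_id s).const_sub L
    have h2 : HasDerivAt (fun s => (n : ℝ) * s) n s := by
      simpa using (hasDerivAt_id s).const_mul (n : ℝ)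
    refine ((h1.cos.mul h2.cos).sub ((h1.sin.mul h2.sin).const_mul (n : ℝ))).congr_deriv ?_
    ring
  rw [← intervalIntegral.integral_const_mul,
    intervalIntegral.integral_eq_sub_of_hasDerivAt (fun s _ => hd s)
      (Continuous.intervalIntegrable (by fun_prop) _ _)]
  simp

lemma integral_sin_mul_cos_one (L : ℝ) :
    ∫ s in (0 : ℝ)..L, Real.sin (L - s) * Real.cos s = L * Real.sin L / 2 := by
  have hd : ∀ s : ℝ, HasDerivAt (fun s => s * Real.sin L / 2 + Real.cos (L - 2 * s) / 4)
      (Real.sin (L - s) * Real.cos s) s := by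
    intro s
    have h1 : HasDerivAt (fun s => L - 2 * s) (-2) s := by
      simpa using ((hasDerivAt_id s).const_mul 2).const_sub L
    refine ((((hasDerivAt_id s).mul_const (Real.sin L)).div_const 2).add
      (h1.cos.div_const 4)).congr_deriv ?_
    have e1 := Real.sin_add (L - s) s
    have e2 := Real.sin_sub (L - s) s
    rw [show L - s + s = L by ring] at e1
    rw [show L - s - s = L - 2 * s by ring] at e2
    linear_combination (1 / 2) * e1 + (1 / 2) * e2
  rw [intervalIntegral.integral_eq_sub_of_hasDerivAt (fun s _ => hd s)
      (Continuous.intervalIntegrable (by fun_prop) _ _)]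
  simp only [zero_mul, mul_zero, sub_zero]
  rw [show L - 2 * L = -L by ring, Real.cos_neg]; ring

lemma integral_sin_mul_id (L : ℝ) :
    ∫ s in (0 : ℝ)..L, Real.sin (L - s) * s = L - Real.sin L := by
  have hd : ∀ s : ℝ, HasDerivAt (fun s => s * Real.cos (L - s) + Real.sin (L - s))
      (Real.sin (L - s) * s) s := by
    intro s
    have h1 : HasDerivAt (fun s => L - s) (-1) s := by simpa using (hasDerivAt_id s).const_sub L
    refine (((hasDerivAt_id s).mul h1.cos).add h1.sin).congr_deriv ?_
    simp; ring
  rw [intervalIntegral.integral_eq_sub_of_hasDerivAt (fun s _ => hd s)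
      (Continuous.intervalIntegrable (by fun_prop) _ _)]
  simp

lemma cos_two_pi_div_three : Real.cos (2 * Real.pi / 3) = -1 / 2 := by
  rw [show 2 * Real.pi / 3 = Real.pi - Real.pi / 3 by ring, Real.cos_pi_sub, Real.cos_pi_div_three]
  norm_num

lemma sin_two_pi_div_three : Real.sin (2 * Real.pi / 3) = Real.sqrt 3 / 2 := by
  rw [show 2 * Real.pi / 3 = Real.pi - Real.pi / 3 by ring, Real.sin_pi_sub, Real.sin_pi_div_three]

/-- The triple angle formula gives `(c - 1)(2c + 1)² = 0` for this cosine `c`. -/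
lemma neg_half_le_cos_third (n : ℤ) : -1 / 2 ≤ Real.cos (n * (2 * Real.pi / 3)) := by
  have h := Real.cos_three_mul (n * (2 * Real.pi / 3))
  rw [show 3 * (n * (2 * Real.pi / 3)) = n * (2 * Real.pi) by ring, Real.cos_int_mul_two_pi] at h
  by_contra! hlt
  nlinarith [sq_nonneg (2 * Real.cos (n * (2 * Real.pi / 3)) + 1),
    mul_pos_of_neg_of_neg (show 2 * Real.cos (n * (2 * Real.pi / 3)) + 1 < 0 by linarith)
    (show 2 * Real.cos (n * (2 * Real.pi / 3)) + 1 < 0 by linarith)]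

/-- The Fourier multiplier `∫₀^{2π/3} sin (2π/3 - s) (1 - cos (n s)) ds`. -/
def sineMultiplier (n : ℤ) : ℝ :=
  ∫ s in (0 : ℝ)..(2 * Real.pi / 3), Real.sin (2 * Real.pi / 3 - s) * (1 - Real.cos (n * s))

lemma sineMultiplier_eq (n : ℤ) : sineMultiplier n = 3 / 2 -
    ∫ s in (0 : ℝ)..(2 * Real.pi / 3), Real.sin (2 * Real.pi / 3 - s) * Real.cos (n * s) := by
  have h0 := integral_sin_mul_cos (2 * Real.pi / 3) 0
  simp [cos_two_pi_div_three] at h0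
  simp only [sineMultiplier, mul_sub, mul_one]
  rw [intervalIntegral.integral_sub (Continuous.intervalIntegrable (by fun_prop) _ _)
    (Continuous.intervalIntegrable (by fun_prop) _ _)]
  congr 1
  simp [cos_two_pi_div_three]
  norm_num

lemma sineMultiplier_zero : sineMultiplier 0 = 0 := by
  simp [sineMultiplier]

lemma sineMultiplier_one : sineMultiplier 1 = 3 / 2 - Real.pi * Real.sqrt 3 / 6 := by
  rw [sineMultiplier_eq]
  simp only [Int.cast_one, one_mul]
  rw [integral_sin_mul_cos_one, sin_two_pi_div_three]; ring

lemma sineMultiplier_neg_one : sineMultiplier (-1) = 3 / 2 - Real.pi * Real.sqrt 3 / 6 := by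
  rw [← sineMultiplier_one]
  simp [sineMultiplier]

/-- Here `(1 - n²) ∫ sin (L - s) cos (n s) = cos (2πn/3) + 1/2 ≥ 0` while `1 - n² < 0`, so the
integral subtracted from `3/2` is nonpositive. The choice `L = 2π/3` makes the right-hand side
nonnegative for every `n`. -/
lemma le_sineMultiplier {n : ℤ} (hn : n ∉ ({-1, 0, 1} : Finset ℤ)) : 3 / 2 ≤ sineMultiplier n := by
  rw [sineMultiplier_eq]
  have h := integral_sin_mul_cos (2 * Real.pi / 3) n
  have hc := neg_half_le_cos_third n
  rw [cos_two_pi_div_three] at h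
  simp only [Finset.mem_insert, Finset.mem_singleton, not_or] at hn
  have h2 : 4 ≤ n ^ 2 := by
    rcases le_or_gt n (-2) with h | h
    · nlinarith
    · have : 2 ≤ n := by omega
      nlinarith
  have h2' : (4 : ℝ) ≤ (n : ℝ) ^ 2 := by exact_mod_cast h2
  by_contra! hlt
  have : 0 < ∫ s in (0 : ℝ)..(2 * Real.pi / 3), Real.sin (2 * Real.pi / 3 - s) * Real.cos (n * s) := by
    linarith
  nlinarith

lemma hasSum_sineMultiplier (hθ : IsMonotoneCircleLift θ) :
    HasSum (fun n : ℤ => ‖circleCoeff (unimodular θ) n‖ ^ 2 * sineMultiplier n)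
      (sineWeighted (meanIncrement θ) (2 * Real.pi / 3)) := by
  have := hasSum_intervalIntegral_of_norm_le (a := 0) (b := 2 * Real.pi / 3)
    (f := fun (n : ℤ) s => ‖circleCoeff (unimodular θ) n‖ ^ 2 *
      (Real.sin (2 * Real.pi / 3 - s) * (1 - Real.cos (n * s))))
    (F := fun s => Real.sin (2 * Real.pi / 3 - s) * meanIncrement θ s)
    (B := fun n => ‖circleCoeff (unimodular θ) n‖ ^ 2) (g := fun _ => 2)
    (fun n => Continuous.aestronglyMeasurable (by fun_prop))
    (fun n s _ => by
      rw [norm_mul, Real.norm_of_nonneg (sq_nonneg _), norm_mul]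
      gcongr
      rw [Real.norm_eq_abs, Real.norm_of_nonneg (by linarith [Real.cos_le_one (n * s)])]
      have h1 := Real.abs_sin_le_one (2 * Real.pi / 3 - s)
      have h2 := Real.neg_one_le_cos (n * s)
      have h3 := Real.cos_le_one (n * s)
      nlinarith [abs_nonneg (Real.sin (2 * Real.pi / 3 - s))])
    (hasSum_norm_circleCoeff_unimodular hθ.measurable).summable
    intervalIntegrable_const
    (fun s _ => by
      have := (hasSum_meanIncrement hθ s).mul_left (Real.sin (2 * Real.pi / 3 - s))
      simpa only [mul_left_comm] using this)
  simpa only [intervalIntegral.integral_const_mul, sineMultiplier, sineWeighted] using this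

/-- The slope `9/(4π)` is the one for which the linear function absorbs the bound exactly: `9/(4π) ·
2π/m = 9/(2m)`. -/
lemma sineWeighted_meanIncrement_le (hθ : IsMonotoneCircleLift θ) :
    sineWeighted (meanIncrement θ) (2 * Real.pi / 3) ≤
      9 / (4 * Real.pi) * (2 * Real.pi / 3 - Real.sqrt 3 / 2) := by
  have hpi := Real.pi_pos
  have hG := continuous_meanIncrement hθ
  have h := sineWeighted_nonpos (H := fun s => meanIncrement θ s - 9 / (4 * Real.pi) * s)
    (by fun_prop) (fun m hm s h0 h1 => by
      have := meanIncrement_add_le hθ (m := m) (by omega) h0 h1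
      have hm' : (0 : ℝ) < m := by exact_mod_cast (by omega : 0 < m)
      have e : (9 : ℝ) / (2 * m) = 9 / (4 * Real.pi) * (2 * Real.pi / m) := by field_simp; norm_num
      rw [e] at this
      linarith)
  simp only [sineWeighted, mul_sub] at h
  rw [intervalIntegral.integral_sub (Continuous.intervalIntegrable (by fun_prop) _ _)
    (Continuous.intervalIntegrable (by fun_prop) _ _)] at h
  simp only [mul_left_comm _ (9 / (4 * Real.pi))] at h
  rw [intervalIntegral.integral_const_mul, integral_sin_mul_id, sin_two_pi_div_three] at h
  simpa [sineWeighted] using h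

/-- Hall's inequality for the Fourier coefficients of `e^{iθ}` with `θ` monotone. -/
theorem heinz_fourier (hθ : IsMonotoneCircleLift θ) :
    27 / (4 * Real.pi ^ 2) ≤ ‖circleCoeff (unimodular θ) 1‖ ^ 2 +
      3 * Real.sqrt 3 / Real.pi * ‖circleCoeff (unimodular θ) 0‖ ^ 2 +
      ‖circleCoeff (unimodular θ) (-1)‖ ^ 2 := by
  have hpi := Real.pi_pos
  have h3 : Real.sqrt 3 ^ 2 = 3 := Real.sq_sqrt (by norm_num)
  have h3p : 0 < Real.sqrt 3 := by positivity
  -- Subtracting `3/2` times Parseval's sum makes all terms with `|n| ≥ 2` nonnegative, so the three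
  -- remaining terms bound the sum from below.
  have h1 := (hasSum_sineMultiplier hθ).sub
    ((hasSum_norm_circleCoeff_unimodular hθ.measurable).mul_right (3 / 2))
  simp only [← mul_sub] at h1
  have h2 := sum_le_hasSum {-1, 0, 1} (fun n hn => mul_nonneg (sq_nonneg _)
    (sub_nonneg.2 (le_sineMultiplier hn))) h1
  rw [Finset.sum_insert (by decide), Finset.sum_insert (by decide), Finset.sum_singleton,
    sineMultiplier_neg_one, sineMultiplier_zero, sineMultiplier_one] at h2
  have h4 := h2.trans (sub_le_sub_right (sineWeighted_meanIncrement_le hθ) _)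
  set a := ‖circleCoeff (unimodular θ) 1‖ ^ 2
  set b := ‖circleCoeff (unimodular θ) 0‖ ^ 2
  set c := ‖circleCoeff (unimodular θ) (-1)‖ ^ 2
  have e : 9 / (4 * Real.pi) * (2 * Real.pi / 3 - Real.sqrt 3 / 2) - 1 * (3 / 2) =
    -(9 * Real.sqrt 3 / (8 * Real.pi)) := by field_simp; ring
  rw [e] at h4
  have h5 : 9 * Real.sqrt 3 / (8 * Real.pi) ≤ Real.pi * Real.sqrt 3 / 6 * (a + c) + 3 / 2 * b := by
    linarith
  -- This factor normalises the coefficients of `a` and `c` to `1`.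
  have h6 := mul_le_mul_of_nonneg_right h5 (show 0 ≤ 6 / (Real.pi * Real.sqrt 3) by positivity)
  have e1 : 9 * Real.sqrt 3 / (8 * Real.pi) * (6 / (Real.pi * Real.sqrt 3)) =
      27 / (4 * Real.pi ^ 2) := by field_simp; norm_num
  have e2 : (Real.pi * Real.sqrt 3 / 6 * (a + c) + 3 / 2 * b) * (6 / (Real.pi * Real.sqrt 3)) =
      a + 3 * Real.sqrt 3 / Real.pi * b + c := by
    field_simp
    linear_combination (-6 * b) * h3
  linarith

end KernelHarmonic
end

noncomputable section
namespace KernelHarmonic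

/-! ### The expansion of the kernel and of its integrals -/

open MeasureTheory Set

lemma hasSum_of_eq {ι E : Type*} [AddCommMonoid E] [TopologicalSpace E] {f g : ι → E} {a : E}
    (h : HasSum f a) (e : ∀ i, g i = f i) : HasSum g a := by
  rwa [funext e]

/-- The coefficient of `P_{α,n+1}(|z|²) z̄^(n+1)` in the expansion of the Poisson kernel. -/
def kernelCoeff (α : ℝ) (n : ℕ) : ℝ := (α + 1) * Ring.choose (α + 1 + n) n

lemma mem_disk {z : ℂ} : z ∈ disk ↔ ‖z‖ < 1 := by simp [disk]

lemma hasSum_choose_mul_pow (α : ℝ) {w : ℂ} (hw : ‖w‖ < 1) :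
    HasSum (fun n : ℕ => ((Ring.choose (α + 1 + n) n : ℝ) : ℂ) * w ^ n)
      (1 / (1 - w) ^ ((α + 2 : ℝ) : ℂ)) := by
  have h := (Complex.one_div_one_sub_cpow_hasFPowerSeriesOnBall_zero ((α + 2 : ℝ) : ℂ)).hasSum
    (y := w) (by
      simp only [Metric.mem_eball, edist_zero_right]
      rw [← ofReal_norm, ← ENNReal.ofReal_one]
      exact (ENNReal.ofReal_lt_ofReal_iff one_pos).2 hw)
  simp only [FormalMultilinearSeries.ofScalars_apply_eq, zero_add, smul_eq_mul] at h
  refine hasSum_of_eq h fun n => ?_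
  rw [Complex.ofReal_choose]
  congr 2
  push_cast; ring

lemma summable_norm_choose_mul_pow (α : ℝ) {r : ℝ} (h0 : 0 ≤ r) (h1 : r < 1) :
    Summable (fun n : ℕ => |Ring.choose (α + 1 + n) n| * r ^ n) := by
  have h := (hasSum_choose_mul_pow α (w := r) (by simpa [abs_of_nonneg h0] using h1)).summable.norm
  simpa [abs_of_nonneg h0] using h

lemma one_sub_mul_pos {x s : ℝ} (hx : x < 1) (hs : s ∈ Icc (0 : ℝ) 1) : 0 < 1 - s * x := by
  rcases le_or_gt x 0 with h | h
  · nlinarith [hs.1]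
  · nlinarith [hs.1, hs.2]

lemma continuousOn_one_sub_mul_rpow (α : ℝ) {x : ℝ} (hx : x < 1) :
    ContinuousOn (fun s : ℝ => (1 - s * x) ^ α) (Icc 0 1) :=
  ContinuousOn.rpow_const (by fun_prop) fun _ hs => Or.inl (one_sub_mul_pos hx hs).ne'

lemma one_sub_mem_slitPlane {w : ℂ} (hw : ‖w‖ < 1) : 1 - w ∈ Complex.slitPlane := by
  left
  simp only [Complex.sub_re, Complex.one_re]
  linarith [Complex.re_le_norm w]

lemma norm_ofReal_mul_lt_one {w : ℂ} (hw : ‖w‖ < 1) {s : ℝ} (hs : s ∈ Icc (0 : ℝ) 1) :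
    ‖(s : ℂ) * w‖ < 1 := by
  rw [norm_mul, Complex.norm_real, Real.norm_of_nonneg hs.1]
  exact (mul_le_of_le_one_left (norm_nonneg _) hs.2).trans_lt hw

/-- The integrand with its prefactor is the derivative in `s` of `(1 - s|z|²)^(α+1) (1 - s
z̄)^(-(α+1))`: the product rule produces `z̄ - |z|² = z̄ (1 - z)`. -/
lemma integral_kernel_density (α : ℝ) {z : ℂ} (hz : ‖z‖ < 1) :
    (α + 1 : ℂ) * (conj z * (1 - z)) * ∫ s in (0 : ℝ)..1,
      (((1 - s * ‖z‖ ^ 2) ^ α : ℝ) : ℂ) * (1 / (1 - s * conj z) ^ ((α + 2 : ℝ) : ℂ)) =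
    (((1 - ‖z‖ ^ 2) ^ (α + 1) : ℝ) : ℂ) / (1 - conj z) ^ ((α + 1 : ℝ) : ℂ) - 1 := by
  set w := conj z with hw
  have hwn : ‖w‖ < 1 := by rwa [hw, RCLike.norm_conj]
  set x := ‖z‖ ^ 2 with hx
  have hx1 : x < 1 := by rw [hx]; nlinarith [norm_nonneg z]
  have hxzw : (x : ℂ) = z * w := by rw [hw, Complex.mul_conj, Complex.normSq_eq_norm_sq]
  have hd : ∀ s ∈ uIcc (0 : ℝ) 1, HasDerivAt
      (fun s : ℝ => (((1 - s * x) ^ (α + 1) : ℝ) : ℂ) * (1 - s * w) ^ (-((α + 1 : ℝ) : ℂ)))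
      ((α + 1 : ℂ) * (w * (1 - z)) * ((((1 - s * x) ^ α : ℝ) : ℂ) *
        (1 / (1 - s * w) ^ ((α + 2 : ℝ) : ℂ)))) s := by
    intro s hs
    rw [uIcc_of_le zero_le_one] at hs
    have p1 := one_sub_mul_pos hx1 hs
    have p2 := one_sub_mem_slitPlane (norm_ofReal_mul_lt_one hwn hs)
    have p3 : (1 - s * w : ℂ) ≠ 0 := Complex.slitPlane_ne_zero p2
    have d1 : HasDerivAt (fun s : ℝ => 1 - s * x) (-x) s := by
      simpa using ((hasDerivAt_id s).mul_const x).const_sub 1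
    have d2 : HasDerivAt (fun s : ℝ => (1 - s * w : ℂ)) (-w) s := by
      simpa using (((hasDerivAt_id s).ofReal_comp).mul_const w).const_sub 1
    have d3 := (d1.rpow_const (p := α + 1) (Or.inl p1.ne')).ofReal_comp
    have d4 := HasDerivAt.scomp (g₁ := fun x : ℂ => x ^ (-((α + 1 : ℝ) : ℂ))) s
      (Complex.hasStrictDerivAt_cpow_const p2).hasDerivAt d2
    refine (d3.mul d4).congr_deriv ?_
    simp only [Function.comp_apply]
    rw [smul_eq_mul, add_sub_cancel_right, Real.rpow_add_one p1.ne',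
      show (-((α + 1 : ℝ) : ℂ) - 1) = -((α + 2 : ℝ) : ℂ) by push_cast; ring,
      show (-((α + 1 : ℝ) : ℂ)) = -((α + 2 : ℝ) : ℂ) + 1 by push_cast; ring,
      Complex.cpow_add _ _ p3, Complex.cpow_one, Complex.cpow_neg, one_div]
    push_cast
    rw [hxzw]
    ring
  have hcont : ContinuousOn (fun s : ℝ => (α + 1 : ℂ) * (w * (1 - z)) *
      ((((1 - s * x) ^ α : ℝ) : ℂ) * (1 / (1 - s * w) ^ ((α + 2 : ℝ) : ℂ)))) (uIcc 0 1) := by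
    rw [uIcc_of_le zero_le_one]
    refine continuousOn_const.mul (ContinuousOn.mul ?_ ?_)
    · exact Complex.continuous_ofReal.comp_continuousOn (continuousOn_one_sub_mul_rpow α hx1)
    · refine ContinuousOn.div continuousOn_const (ContinuousOn.cpow_const (by fun_prop) ?_) ?_
      · exact fun s hs => one_sub_mem_slitPlane (norm_ofReal_mul_lt_one hwn hs)
      · intro s hs
        rw [Ne, Complex.cpow_eq_zero_iff, not_and_or]
        exact Or.inl (Complex.slitPlane_ne_zero
          (one_sub_mem_slitPlane (norm_ofReal_mul_lt_one hwn hs)))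
  rw [← intervalIntegral.integral_const_mul,
    intervalIntegral.integral_eq_sub_of_hasDerivAt hd hcont.intervalIntegrable]
  rw [Complex.cpow_neg, Complex.cpow_neg]
  simp [div_eq_mul_inv]

lemma hasSum_integral_density (α : ℝ) {w : ℂ} (hw : ‖w‖ < 1) {x : ℝ} (hx1 : x < 1) :
    HasSum (fun n : ℕ => ((Ring.choose (α + 1 + n) n : ℝ) : ℂ) *
      ((radialFactor α (n + 1) x : ℝ) : ℂ) * w ^ n)
      (∫ s in (0 : ℝ)..1, (((1 - s * x) ^ α : ℝ) : ℂ) *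
        (1 / (1 - s * w) ^ ((α + 2 : ℝ) : ℂ))) := by
  have hc := continuousOn_one_sub_mul_rpow α hx1
  have h := hasSum_intervalIntegral_of_norm_le (a := 0) (b := 1)
    (f := fun (n : ℕ) (s : ℝ) => (((1 - s * x) ^ α : ℝ) : ℂ) *
      (((Ring.choose (α + 1 + n) n : ℝ) : ℂ) * (s * w) ^ n))
    (F := fun s : ℝ => (((1 - s * x) ^ α : ℝ) : ℂ) * (1 / (1 - s * w) ^ ((α + 2 : ℝ) : ℂ)))
    (B := fun n : ℕ => |Ring.choose (α + 1 + n) n| * ‖w‖ ^ n) (g := fun s => (1 - s * x) ^ α)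
    (fun n => ?_) (fun n s hs => ?_) (summable_norm_choose_mul_pow α (norm_nonneg _) hw) ?_ ?_
  · refine hasSum_of_eq h fun n => ?_
    unfold radialFactor
    rw [← intervalIntegral.integral_ofReal, ← intervalIntegral.integral_const_mul,
      ← intervalIntegral.integral_mul_const]
    refine intervalIntegral.integral_congr fun s _ => ?_
    simp only [Nat.add_sub_cancel]
    push_cast
    ring
  · refine ContinuousOn.aestronglyMeasurable ?_ measurableSet_uIoc
    refine ContinuousOn.mul ?_ (by fun_prop)
    refine (Complex.continuous_ofReal.comp_continuousOn hc).mono ?_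
    rw [uIoc_of_le zero_le_one]; exact Ioc_subset_Icc_self
  · rw [uIoc_of_le zero_le_one] at hs
    have p := one_sub_mul_pos hx1 ⟨hs.1.le, hs.2⟩
    rw [norm_mul, norm_mul, Complex.norm_real, Complex.norm_real, norm_pow, norm_mul,
      Complex.norm_real, Real.norm_of_nonneg (Real.rpow_nonneg p.le _), Real.norm_of_nonneg hs.1.le,
      mul_comm, Real.norm_eq_abs]
    gcongr
    · exact mul_nonneg hs.1.le (norm_nonneg _)
    · exact mul_le_of_le_one_left (norm_nonneg _) hs.2
  · exact (hc.mono (by rw [uIcc_of_le zero_le_one])).intervalIntegrable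
  · intro s hs
    rw [uIoc_of_le zero_le_one] at hs
    exact (hasSum_choose_mul_pow α (norm_ofReal_mul_lt_one hw ⟨hs.1.le, hs.2⟩)).mul_left _

lemma one_sub_ne_zero_of_norm_lt_one {z : ℂ} (hz : ‖z‖ < 1) : 1 - z ≠ 0 :=
  Complex.slitPlane_ne_zero (one_sub_mem_slitPlane hz)

lemma sq_norm_lt_one {z : ℂ} (hz : ‖z‖ < 1) : ‖z‖ ^ 2 < 1 := by nlinarith [norm_nonneg z]

/-- Dividing `integral_kernel_density` by `1 - z` splits off the analytic part `1 / (1 - z)`. In the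
rest, `(1 - s z̄)^(-(α+2))` is expanded binomially, and integration in `s` turns the powers of `s`
into the radial factors. -/
lemma hasSum_poissonKernel (α : ℝ) {z : ℂ} (hz : ‖z‖ < 1) :
    HasSum (fun n : ℕ => (kernelCoeff α n : ℂ) * ((radialFactor α (n + 1) (‖z‖ ^ 2) : ℝ) : ℂ) *
      conj z ^ (n + 1)) (poissonKernel α z - 1 / (1 - z)) := by
  have hz1 := one_sub_ne_zero_of_norm_lt_one hz
  have hz2 : (1 - conj z) ^ ((α + 1 : ℝ) : ℂ) ≠ 0 := by
    rw [Ne, Complex.cpow_eq_zero_iff, not_and_or]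
    exact Or.inl (one_sub_ne_zero_of_norm_lt_one (by rwa [RCLike.norm_conj]))
  have h := (hasSum_integral_density α (w := conj z) (by rwa [RCLike.norm_conj])
    (sq_norm_lt_one hz)).mul_left ((α + 1 : ℂ) * conj z)
  have e := integral_kernel_density α hz
  have e2 : poissonKernel α z - 1 / (1 - z) = (α + 1 : ℂ) * conj z * ∫ s in (0 : ℝ)..1,
      (((1 - s * ‖z‖ ^ 2) ^ α : ℝ) : ℂ) * (1 / (1 - s * conj z) ^ ((α + 2 : ℝ) : ℂ)) := by
    have : poissonKernel α z - 1 / (1 - z) = ((((1 - ‖z‖ ^ 2) ^ (α + 1) : ℝ) : ℂ) /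
        (1 - conj z) ^ ((α + 1 : ℝ) : ℂ) - 1) / (1 - z) := by
      rw [poissonKernel]; field_simp
    rw [this, ← e, div_eq_iff hz1]
    ring
  rw [e2]
  refine hasSum_of_eq h fun n => ?_
  rw [kernelCoeff]
  push_cast
  ring

lemma radialFactor_nonneg (α : ℝ) (n : ℕ) {x : ℝ} (hx : x < 1) :
    0 ≤ radialFactor α n x := by
  refine intervalIntegral.integral_nonneg zero_le_one fun t ht => ?_
  exact mul_nonneg (pow_nonneg ht.1 _) (Real.rpow_nonneg (one_sub_mul_pos hx ht).le _)

lemma radialFactor_pos (α : ℝ) (n : ℕ) {x : ℝ} (hx : x < 1) :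
    0 < radialFactor α n x := by
  refine intervalIntegral.intervalIntegral_pos_of_pos_on ?_ (fun t ht => ?_) zero_lt_one
  · refine ContinuousOn.intervalIntegrable ?_
    rw [uIcc_of_le zero_le_one]
    exact (by fun_prop : ContinuousOn (fun t : ℝ => t ^ (n - 1)) _).mul
      (continuousOn_one_sub_mul_rpow α hx)
  · exact mul_pos (pow_pos ht.1 _) (Real.rpow_pos_of_pos (one_sub_mul_pos hx ⟨ht.1.le, ht.2.le⟩) _)

/-- The extension of boundary values `F` to the disk by the kernel `𝒫_α`. -/
def poissonExtension (α : ℝ) (F : ℝ → ℂ) (z : ℂ) : ℂ :=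
  (1 / (2 * Real.pi) : ℂ) * ∫ φ in (0 : ℝ)..(2 * Real.pi),
    poissonKernel α (z * Complex.exp (-((φ : ℂ) * Complex.I))) * F φ

/-- The coefficients of the expansion of `poissonExtension α F`. -/
def extensionCoeff (α : ℝ) (F : ℝ → ℂ) (k : ℤ) : ℂ :=
  if 0 ≤ k then circleCoeff F k else kernelCoeff α (k.natAbs - 1) * circleCoeff F k

lemma extensionCoeff_natCast (α : ℝ) (F : ℝ → ℂ) (k : ℕ) :
    extensionCoeff α F k = circleCoeff F k := by
  simp [extensionCoeff]

lemma extensionCoeff_neg (α : ℝ) (F : ℝ → ℂ) (n : ℕ) :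
    extensionCoeff α F (-((n : ℤ) + 1)) = kernelCoeff α n * circleCoeff F (-((n : ℤ) + 1)) := by
  have h1 : ¬ (0 ≤ -((n : ℤ) + 1)) := by omega
  have h2 : (-((n : ℤ) + 1)).natAbs - 1 = n := by omega
  rw [extensionCoeff, if_neg h1, h2]

lemma norm_exp_neg_mul_I (φ : ℝ) : ‖Complex.exp (-((φ : ℂ) * Complex.I))‖ = 1 := by
  rw [← neg_mul, ← Complex.ofReal_neg, Complex.norm_exp_ofReal_mul_I]

lemma norm_exp_neg_int_mul_I (n : ℤ) (t : ℝ) :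
    ‖Complex.exp (-((n : ℂ) * t * Complex.I))‖ = 1 := by
  rw [show -((n : ℂ) * t * Complex.I) = ((-(n * t) : ℝ) : ℂ) * Complex.I by push_cast; ring,
    Complex.norm_exp_ofReal_mul_I]

lemma norm_mul_exp_neg (z : ℂ) (φ : ℝ) : ‖z * Complex.exp (-((φ : ℂ) * Complex.I))‖ = ‖z‖ := by
  rw [norm_mul, norm_exp_neg_mul_I, mul_one]

lemma conj_mul_exp_neg_pow (z : ℂ) (φ : ℝ) (n : ℕ) :
    conj (z * Complex.exp (-((φ : ℂ) * Complex.I))) ^ n =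
      conj z ^ n * Complex.exp (-(((-(n : ℤ) : ℤ) : ℂ) * φ * Complex.I)) := by
  rw [map_mul, mul_pow, ← Complex.exp_conj, ← Complex.exp_nat_mul]
  congr 2
  simp
  ring

lemma mul_exp_neg_pow (z : ℂ) (φ : ℝ) (n : ℕ) :
    (z * Complex.exp (-((φ : ℂ) * Complex.I))) ^ n =
      z ^ n * Complex.exp (-(((n : ℤ) : ℂ) * φ * Complex.I)) := by
  rw [mul_pow, ← Complex.exp_nat_mul]
  congr 2
  push_cast
  ring

lemma summable_kernel_terms (α : ℝ) {z : ℂ} (hz : ‖z‖ < 1) :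
    Summable (fun n : ℕ => |kernelCoeff α n| * radialFactor α (n + 1) (‖z‖ ^ 2) * ‖z‖ ^ (n + 1)) := by
  have := (hasSum_poissonKernel α hz).summable.norm
  simpa [abs_of_nonneg (radialFactor_nonneg α _ (sq_norm_lt_one hz))] using this

lemma hasSum_poissonExtension_left {F : ℝ → ℂ}
    (hF : IntervalIntegrable F volume 0 (2 * Real.pi)) {z : ℂ} (hz : ‖z‖ < 1) :
    HasSum (fun k : ℕ => circleCoeff F k * z ^ k)
      ((1 / (2 * Real.pi) : ℂ) * ∫ φ in (0 : ℝ)..(2 * Real.pi),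
        1 / (1 - z * Complex.exp (-((φ : ℂ) * Complex.I))) * F φ) := by
  have hm : ∀ n : ℕ, AEStronglyMeasurable
      (fun φ : ℝ => (z * Complex.exp (-((φ : ℂ) * Complex.I))) ^ n * F φ)
      (volume.restrict (uIoc 0 (2 * Real.pi))) := fun n =>
    AEStronglyMeasurable.mul (Continuous.aestronglyMeasurable (by fun_prop))
      hF.def'.aestronglyMeasurable
  have hs : ∀ φ ∈ uIoc 0 (2 * Real.pi),
      HasSum (fun n : ℕ => (z * Complex.exp (-((φ : ℂ) * Complex.I))) ^ n * F φ)
      (1 / (1 - z * Complex.exp (-((φ : ℂ) * Complex.I))) * F φ) := fun φ _ => by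
    have := hasSum_geometric_of_norm_lt_one (ξ := z * Complex.exp (-((φ : ℂ) * Complex.I)))
      (by rwa [norm_mul_exp_neg])
    rw [one_div]
    exact this.mul_right (F φ)
  have h := (hasSum_intervalIntegral_of_norm_le (a := 0) (b := 2 * Real.pi)
    (f := fun (n : ℕ) (φ : ℝ) => (z * Complex.exp (-((φ : ℂ) * Complex.I))) ^ n * F φ)
    (F := fun φ : ℝ => 1 / (1 - z * Complex.exp (-((φ : ℂ) * Complex.I))) * F φ)
    (B := fun n : ℕ => ‖z‖ ^ n) (g := fun φ => ‖F φ‖)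
    hm
    (fun n φ _ => by rw [norm_mul, norm_pow, norm_mul_exp_neg])
    (summable_geometric_of_lt_one (norm_nonneg _) hz) hF.norm
    hs).mul_left (1 / (2 * Real.pi) : ℂ)
  refine hasSum_of_eq h fun n => ?_
  rw [circleCoeff, mul_assoc, ← intervalIntegral.integral_mul_const]
  congr 1
  refine intervalIntegral.integral_congr fun φ _ => ?_
  simp only [mul_exp_neg_pow]
  ring

lemma hasSum_poissonExtension_right (α : ℝ) {F : ℝ → ℂ}
    (hF : IntervalIntegrable F volume 0 (2 * Real.pi)) {z : ℂ} (hz : ‖z‖ < 1) :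
    HasSum (fun n : ℕ => extensionCoeff α F (-((n : ℤ) + 1)) *
      ((radialFactor α (n + 1) (‖z‖ ^ 2) : ℝ) : ℂ) * (conj z) ^ (n + 1))
      ((1 / (2 * Real.pi) : ℂ) * ∫ φ in (0 : ℝ)..(2 * Real.pi),
        (poissonKernel α (z * Complex.exp (-((φ : ℂ) * Complex.I))) -
          1 / (1 - z * Complex.exp (-((φ : ℂ) * Complex.I)))) * F φ) := by
  have hm : ∀ n : ℕ, AEStronglyMeasurable (fun φ : ℝ => (kernelCoeff α n : ℂ) *
      ((radialFactor α (n + 1) (‖z‖ ^ 2) : ℝ) : ℂ) *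
      conj (z * Complex.exp (-((φ : ℂ) * Complex.I))) ^ (n + 1) * F φ)
      (volume.restrict (uIoc 0 (2 * Real.pi))) := fun n =>
    AEStronglyMeasurable.mul (Continuous.aestronglyMeasurable (by fun_prop))
      hF.def'.aestronglyMeasurable
  have h := (hasSum_intervalIntegral_of_norm_le (a := 0) (b := 2 * Real.pi)
    (f := fun (n : ℕ) (φ : ℝ) => (kernelCoeff α n : ℂ) *
      ((radialFactor α (n + 1) (‖z‖ ^ 2) : ℝ) : ℂ) *
      conj (z * Complex.exp (-((φ : ℂ) * Complex.I))) ^ (n + 1) * F φ)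
    (F := fun φ : ℝ => (poissonKernel α (z * Complex.exp (-((φ : ℂ) * Complex.I))) -
          1 / (1 - z * Complex.exp (-((φ : ℂ) * Complex.I)))) * F φ)
    (B := fun n : ℕ => |kernelCoeff α n| * radialFactor α (n + 1) (‖z‖ ^ 2) * ‖z‖ ^ (n + 1))
    (g := fun φ => ‖F φ‖)
    hm
    (fun n φ _ => by
      rw [norm_mul, norm_mul, norm_mul, norm_pow, RCLike.norm_conj, norm_mul_exp_neg,
        Complex.norm_real, Complex.norm_real,
        Real.norm_of_nonneg (radialFactor_nonneg α _ (sq_norm_lt_one hz)), Real.norm_eq_abs])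
    (summable_kernel_terms α hz) hF.norm
    (fun φ _ => by
      have := hasSum_poissonKernel α (z := z * Complex.exp (-((φ : ℂ) * Complex.I)))
        (by rwa [norm_mul_exp_neg])
      rw [norm_mul_exp_neg] at this
      exact this.mul_right _)).mul_left (1 / (2 * Real.pi) : ℂ)
  refine hasSum_of_eq h fun n => ?_
  have e : ∀ a b c d I : ℂ, a * (b * I) * c * d = b * (a * c * d * I) := by intros; ring
  rw [extensionCoeff_neg, circleCoeff, e, ← intervalIntegral.integral_const_mul]
  congr 1
  refine intervalIntegral.integral_congr fun φ _ => ?_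
  simp only [conj_mul_exp_neg_pow]
  push_cast
  ring

lemma poissonExtension_split (α : ℝ) {F : ℝ → ℂ}
    (hF : IntervalIntegrable F volume 0 (2 * Real.pi)) {z : ℂ} (hz : ‖z‖ < 1) :
    poissonExtension α F z = (1 / (2 * Real.pi) : ℂ) * (∫ φ in (0 : ℝ)..(2 * Real.pi),
        1 / (1 - z * Complex.exp (-((φ : ℂ) * Complex.I))) * F φ) +
      (1 / (2 * Real.pi) : ℂ) * ∫ φ in (0 : ℝ)..(2 * Real.pi),
        (poissonKernel α (z * Complex.exp (-((φ : ℂ) * Complex.I))) -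
          1 / (1 - z * Complex.exp (-((φ : ℂ) * Complex.I)))) * F φ := by
  have hne : ∀ φ : ℝ, 1 - z * Complex.exp (-((φ : ℂ) * Complex.I)) ≠ 0 := fun φ =>
    one_sub_ne_zero_of_norm_lt_one (by rwa [norm_mul_exp_neg])
  have c1 : Continuous fun φ : ℝ => 1 / (1 - z * Complex.exp (-((φ : ℂ) * Complex.I))) :=
    continuous_const.div (by fun_prop) hne
  have c2 : Continuous fun φ : ℝ => poissonKernel α (z * Complex.exp (-((φ : ℂ) * Complex.I))) := by
    have hs : ∀ φ : ℝ, 1 - conj (z * Complex.exp (-((φ : ℂ) * Complex.I))) ∈ Complex.slitPlane :=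
      fun φ => one_sub_mem_slitPlane (by rwa [RCLike.norm_conj, norm_mul_exp_neg])
    simp only [poissonKernel, norm_mul_exp_neg]
    refine continuous_const.div ((by fun_prop : Continuous _).mul
      (Continuous.cpow (by fun_prop) continuous_const hs)) fun φ => mul_ne_zero (hne φ) ?_
    rw [Ne, Complex.cpow_eq_zero_iff, not_and_or]
    exact Or.inl (Complex.slitPlane_ne_zero (hs φ))
  rw [← mul_add, ← intervalIntegral.integral_add (hF.continuousOn_mul c1.continuousOn)
    (hF.continuousOn_mul (g := fun φ => poissonKernel α (z * Complex.exp (-((φ : ℂ) * Complex.I))) -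
      1 / (1 - z * Complex.exp (-((φ : ℂ) * Complex.I)))) (c2.sub c1).continuousOn), poissonExtension]
  congr 1
  refine intervalIntegral.integral_congr fun φ _ => ?_
  ring

lemma exists_norm_circleCoeff_le (F : ℝ → ℂ) : ∃ C, ∀ n, ‖circleCoeff F n‖ ≤ C := by
  refine ⟨‖(1 / (2 * Real.pi) : ℂ)‖ * ∫ t in (0 : ℝ)..(2 * Real.pi), ‖F t‖, fun n => ?_⟩
  rw [circleCoeff, norm_mul]
  gcongr
  refine (intervalIntegral.norm_integral_le_integral_norm Real.two_pi_pos.le).trans (le_of_eq ?_)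
  simp only [norm_mul, norm_exp_neg_int_mul_I, one_mul]

end KernelHarmonic
end

noncomputable section
namespace KernelHarmonic

/-! ### Coefficients of functions with an expansion -/

open MeasureTheory Set

/-- One factor `ρ` absorbs the constant, as `C ≤ ρ^N ≤ ρ^|k|` for large `|k|`; then `ρ * ρ` is taken
arbitrarily close to `1`. -/
lemma limsup_rpow_le_one {c : ℤ → ℂ}
    (h : ∀ ρ : ℝ, 1 < ρ → ∃ C : ℝ, ∀ k, ‖c k‖ ≤ C * ρ ^ k.natAbs) :
    Filter.limsup (fun k : ℤ => ‖c k‖ₑ ^ (1 / |(k : ℝ)|)) Filter.cofinite ≤ 1 := by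
  have key : ∀ ρ : ℝ, 1 < ρ →
      Filter.limsup (fun k : ℤ => ‖c k‖ₑ ^ (1 / |(k : ℝ)|)) Filter.cofinite ≤ ENNReal.ofReal (ρ * ρ) := by
    intro ρ hρ
    obtain ⟨C, hC⟩ := h ρ hρ
    obtain ⟨N, hN⟩ := pow_unbounded_of_one_lt C hρ
    refine Filter.limsup_le_of_le (by isBoundedDefault) ?_
    have hfin : {k : ℤ | k.natAbs ≤ N}.Finite := by
      refine (Set.finite_Icc (-(N : ℤ)) N).subset fun k hk => ?_
      simp only [mem_ofPred_eq] at hk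
      constructor <;> omega
    filter_upwards [hfin.compl_mem_cofinite] with k hk
    simp only [mem_compl_iff, mem_ofPred_eq, not_le] at hk
    have hk0 : (0 : ℝ) < k.natAbs := by exact_mod_cast (by omega : 0 < k.natAbs)
    have habs : |(k : ℝ)| = (k.natAbs : ℝ) := by
      rw [← Int.cast_abs, Int.abs_eq_natAbs]; simp
    have hle : ‖c k‖ ≤ (ρ * ρ) ^ k.natAbs := by
      refine (hC k).trans ?_
      rw [mul_pow]
      gcongr
      exact hN.le.trans (pow_le_pow_right₀ hρ.le hk.le)
    have : ‖c k‖ₑ ≤ ENNReal.ofReal (ρ * ρ) ^ (k.natAbs : ℝ) := by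
      rw [ENNReal.rpow_natCast, ← ENNReal.ofReal_pow (by positivity), ← ofReal_norm]
      exact ENNReal.ofReal_le_ofReal hle
    calc _ ≤ (ENNReal.ofReal (ρ * ρ) ^ (k.natAbs : ℝ)) ^ (1 / |(k : ℝ)|) :=
          ENNReal.rpow_le_rpow this (by positivity)
      _ = _ := by rw [habs, ← ENNReal.rpow_mul, mul_one_div_cancel hk0.ne', ENNReal.rpow_one]
  refine le_of_forall_gt fun q hq => ?_
  by_cases hq' : q = ⊤
  · rw [hq']
    exact (key 2 (by norm_num)).trans_lt ENNReal.ofReal_lt_top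
  have hq1 : 1 < q.toReal := by
    rw [← ENNReal.toReal_one]; exact (ENNReal.toReal_lt_toReal (by simp) hq').2 hq
  set ρ := Real.sqrt ((1 + q.toReal) / 2) with hρ
  have hρρ : ρ * ρ = (1 + q.toReal) / 2 := Real.mul_self_sqrt (by linarith)
  have hρ1 : 1 < ρ := by
    rw [hρ]; exact Real.lt_sqrt_of_sq_lt (by linarith)
  refine (key ρ hρ1).trans_lt ?_
  rw [hρρ, ENNReal.ofReal_lt_iff_lt_toReal (by linarith) hq']
  linarith

/-- The binomial series converges at `ρ⁻¹ < 1`, so its terms are bounded and the generalised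
binomial coefficients are `O(ρ^n)`. -/
lemma exists_norm_extensionCoeff_le (α : ℝ) (F : ℝ → ℂ) {ρ : ℝ} (hρ : 1 < ρ) :
    ∃ C : ℝ, ∀ k, ‖extensionCoeff α F k‖ ≤ C * ρ ^ k.natAbs := by
  obtain ⟨A, hA⟩ := exists_norm_circleCoeff_le F
  have hA0 : 0 ≤ A := (norm_nonneg _).trans (hA 0)
  have hρ0 : 0 < ρ := by linarith
  obtain ⟨M, hM⟩ := (summable_norm_choose_mul_pow α (r := ρ⁻¹) (by positivity)
    (inv_lt_one_of_one_lt₀ hρ)).tendsto_atTop_zero.bddAbove_range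
  have hM' : ∀ n : ℕ, |Ring.choose (α + 1 + n) n| ≤ M * ρ ^ n := fun n => by
    have := hM ⟨n, rfl⟩
    simp only [inv_pow] at this
    rwa [← div_eq_mul_inv, div_le_iff₀ (by positivity)] at this
  have hM0 : 0 ≤ M := by
    have := (abs_nonneg _).trans (hM' 0)
    simpa using this
  refine ⟨A + |α + 1| * M * A, fun k => ?_⟩
  have h1 : 1 ≤ ρ ^ k.natAbs := one_le_pow₀ hρ.le
  rw [extensionCoeff]
  split_ifs with hk
  · refine (hA k).trans ?_
    have : 0 ≤ |α + 1| * M * A := by positivity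
    nlinarith
  · rw [norm_mul, Complex.norm_real, kernelCoeff, norm_mul, Real.norm_eq_abs, Real.norm_eq_abs]
    calc |α + 1| * |Ring.choose (α + 1 + (k.natAbs - 1 : ℕ)) (k.natAbs - 1)| * ‖circleCoeff F k‖
        ≤ |α + 1| * (M * ρ ^ k.natAbs) * A := by
          gcongr
          · refine (hM' _).trans ?_
            gcongr
            · exact hρ.le
            · omega
          · exact hA k
      _ ≤ _ := by nlinarith

theorem hasExpansion_poissonExtension (α : ℝ) {F : ℝ → ℂ}
    (hF : IntervalIntegrable F volume 0 (2 * Real.pi)) :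
    HasExpansion α (extensionCoeff α F) (poissonExtension α F) := by
  refine ⟨limsup_rpow_le_one fun ρ hρ => exists_norm_extensionCoeff_le α F hρ, fun z hz => ?_⟩
  rw [mem_disk] at hz
  refine ⟨_, _, ?_, hasSum_poissonExtension_right α hF hz, poissonExtension_split α hF hz⟩
  simp only [extensionCoeff_natCast]
  exact hasSum_poissonExtension_left hF hz

/-- The `k`-th Fourier coefficient on the circle of radius `r` of a function with coefficients
`c`. -/
def circleMode (α : ℝ) (c : ℤ → ℂ) (r : ℝ) (k : ℤ) : ℂ :=
  if 0 ≤ k then c k * r ^ k.natAbs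
  else c k * ((radialFactor α k.natAbs (r ^ 2) : ℝ) : ℂ) * r ^ k.natAbs

lemma circleMode_natCast (α : ℝ) (c : ℤ → ℂ) (r : ℝ) (k : ℕ) :
    circleMode α c r k = c k * r ^ k := by simp [circleMode]

lemma circleMode_neg (α : ℝ) (c : ℤ → ℂ) (r : ℝ) (n : ℕ) :
    circleMode α c r (-((n : ℤ) + 1)) = c (-((n : ℤ) + 1)) *
      ((radialFactor α (n + 1) (r ^ 2) : ℝ) : ℂ) * r ^ (n + 1) := by
  have h1 : ¬ (0 ≤ -((n : ℤ) + 1)) := by omega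
  have h2 : (-((n : ℤ) + 1)).natAbs = n + 1 := by omega
  rw [circleMode, if_neg h1, h2]

/-- The point of the plane with polar coordinates `r` and `t`. -/
def polar (r t : ℝ) : ℂ := r * Complex.exp (t * Complex.I)

lemma norm_polar {r : ℝ} (hr : 0 ≤ r) (t : ℝ) : ‖polar r t‖ = r := by
  rw [polar, norm_mul, Complex.norm_exp_ofReal_mul_I, mul_one, Complex.norm_real,
    Real.norm_of_nonneg hr]

lemma continuous_polar : Continuous fun p : ℝ × ℝ => polar p.1 p.2 := by unfold polar; fun_prop

lemma HasExpansion.hasSum_circleMode {α : ℝ} {c : ℤ → ℂ} {u : ℂ → ℂ} (h : HasExpansion α c u)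
    {r : ℝ} (h0 : 0 ≤ r) (h1 : r < 1) (t : ℝ) :
    HasSum (fun k : ℤ => circleMode α c r k * Complex.exp ((k : ℂ) * t * Complex.I))
      (u (polar r t)) := by
  obtain ⟨a, b, ha, hb, hab⟩ := h.2 (polar r t) (by rw [mem_disk, norm_polar h0]; exact h1)
  rw [hab]
  refine HasSum.of_nat_of_neg_add_one (hasSum_of_eq ha fun k => ?_) (hasSum_of_eq hb fun n => ?_)
  · rw [circleMode_natCast, polar, mul_pow, ← Complex.exp_nat_mul]
    push_cast
    ring_nf
  · rw [circleMode_neg, norm_polar h0, polar, map_mul, mul_pow, ← Complex.exp_conj,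
      ← Complex.exp_nat_mul, Complex.conj_ofReal, map_mul, Complex.conj_ofReal, Complex.conj_I]
    push_cast
    ring_nf

lemma norm_exp_int_mul_I (n : ℤ) (t : ℝ) : ‖Complex.exp ((n : ℂ) * t * Complex.I)‖ = 1 := by
  rw [show (n : ℂ) * t * Complex.I = ((n * t : ℝ) : ℂ) * Complex.I by push_cast; ring,
    Complex.norm_exp_ofReal_mul_I]

lemma HasExpansion.summable_norm_circleMode {α : ℝ} {c : ℤ → ℂ} {u : ℂ → ℂ}
    (h : HasExpansion α c u) {r : ℝ} (h0 : 0 ≤ r) (h1 : r < 1) :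
    Summable fun k : ℤ => ‖circleMode α c r k‖ := by
  have := (h.hasSum_circleMode h0 h1 0).summable.norm
  simpa using this

lemma circleCoeff_exp (k n : ℤ) :
    circleCoeff (fun t => Complex.exp ((k : ℂ) * t * Complex.I)) n = if k = n then 1 else 0 := by
  have hpi : (Real.pi : ℂ) ≠ 0 := by exact_mod_cast Real.pi_ne_zero
  have e : ∀ t : ℝ, Complex.exp (-((n : ℂ) * t * Complex.I)) * Complex.exp ((k : ℂ) * t * Complex.I) =
      Complex.exp ((((k - n : ℤ) : ℂ) * Complex.I) * t) := by
    intro t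
    rw [← Complex.exp_add]
    congr 1
    push_cast; ring
  simp only [circleCoeff, e]
  split_ifs with hkn
  · simp [hkn]; field_simp
  · have hne : ((k - n : ℤ) : ℂ) * Complex.I ≠ 0 :=
      mul_ne_zero (by exact_mod_cast sub_ne_zero.2 hkn) Complex.I_ne_zero
    rw [integral_exp_mul_complex hne, show ((k - n : ℤ) : ℂ) * Complex.I * ((2 * Real.pi : ℝ) : ℂ) =
      ((k - n : ℤ) : ℂ) * (2 * Real.pi * Complex.I) by push_cast; ring,
      Complex.exp_int_mul_two_pi_mul_I]
    simp

lemma circleCoeff_of_hasSum {d : ℤ → ℂ} {f : ℝ → ℂ} (hd : Summable fun k => ‖d k‖)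
    (hf : ∀ t : ℝ, HasSum (fun k : ℤ => d k * Complex.exp ((k : ℂ) * t * Complex.I)) (f t)) (n : ℤ) :
    circleCoeff f n = d n := by
  have h := (hasSum_intervalIntegral_of_norm_le (a := 0) (b := 2 * Real.pi)
    (f := fun (k : ℤ) (t : ℝ) => Complex.exp (-((n : ℂ) * t * Complex.I)) *
      (d k * Complex.exp ((k : ℂ) * t * Complex.I)))
    (F := fun t : ℝ => Complex.exp (-((n : ℂ) * t * Complex.I)) * f t)
    (B := fun k => ‖d k‖) (g := fun _ => 1)
    (fun k => Continuous.aestronglyMeasurable (by fun_prop))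
    (fun k t _ => by rw [norm_mul, norm_mul, norm_exp_neg_int_mul_I, norm_exp_int_mul_I]; simp)
    hd intervalIntegrable_const (fun t _ => (hf t).mul_left _)).mul_left (1 / (2 * Real.pi) : ℂ)
  have e : ∀ k : ℤ, (1 / (2 * Real.pi) : ℂ) * ∫ t in (0 : ℝ)..(2 * Real.pi),
      Complex.exp (-((n : ℂ) * t * Complex.I)) * (d k * Complex.exp ((k : ℂ) * t * Complex.I)) =
      if k = n then d n else 0 := by
    intro k
    have := circleCoeff_exp k n
    rw [circleCoeff] at this
    simp only [mul_left_comm _ (d k)]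
    rw [intervalIntegral.integral_const_mul, mul_left_comm, this]
    split_ifs with hk
    · rw [hk, mul_one]
    · rw [mul_zero]
  simp only [e] at h
  exact h.unique (hasSum_ite_eq n (d n))

lemma HasExpansion.circleCoeff_eq {α : ℝ} {c : ℤ → ℂ} {u : ℂ → ℂ} (h : HasExpansion α c u)
    {r : ℝ} (h0 : 0 ≤ r) (h1 : r < 1) (n : ℤ) :
    circleCoeff (fun t => u (polar r t)) n = circleMode α c r n :=
  circleCoeff_of_hasSum (h.summable_norm_circleMode h0 h1) (h.hasSum_circleMode h0 h1) n

/-- One circle determines all coefficients, because the radial factors are positive. An arbitrary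
`c` in the hypotheses can therefore be replaced by `extensionCoeff`. -/
lemma HasExpansion.coeff_unique {α : ℝ} {c c' : ℤ → ℂ} {u : ℂ → ℂ} (h : HasExpansion α c u)
    (h' : HasExpansion α c' u) : c = c' := by
  funext k
  have e := (h.circleCoeff_eq (r := 1 / 2) (by norm_num) (by norm_num) k).symm.trans
    (h'.circleCoeff_eq (by norm_num) (by norm_num) k)
  rw [circleMode, circleMode] at e
  have hp : (((1 / 2 : ℝ) : ℂ)) ^ k.natAbs ≠ 0 := pow_ne_zero _ (by norm_num)
  have hR : ((radialFactor α k.natAbs ((1 / 2) ^ 2) : ℝ) : ℂ) ≠ 0 := by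
    exact_mod_cast (radialFactor_pos α k.natAbs (by norm_num)).ne'
  split_ifs at e
  · exact mul_right_cancel₀ hp e
  · exact mul_right_cancel₀ hR (mul_right_cancel₀ hp e)

/-- `kernelCoeff α 0 = α + 1` cancels the weight of the last term; this removes `α` from the
problem. -/
lemma heinzSum_extensionCoeff {α : ℝ} (hα : -1 < α) (F : ℝ → ℂ) :
    heinzSum α (extensionCoeff α F) = ‖circleCoeff F 1‖ ^ 2 +
      3 * Real.sqrt 3 / Real.pi * ‖circleCoeff F 0‖ ^ 2 + ‖circleCoeff F (-1)‖ ^ 2 := by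
  have h1 := extensionCoeff_natCast α F 1
  have h0 := extensionCoeff_natCast α F 0
  have hn := extensionCoeff_neg α F 0
  simp only [kernelCoeff, Nat.cast_one, Nat.cast_zero, zero_add, Ring.choose_zero_right, mul_one] at h1 h0 hn
  rw [heinzSum, h1, h0, hn, norm_mul, mul_pow, Complex.norm_real, Real.norm_eq_abs, sq_abs]
  have : α + 1 ≠ 0 := by linarith
  field_simp

theorem heinz_poissonIntegral {α : ℝ} (hα : -1 < α) {θ : ℝ → ℝ} {c : ℤ → ℂ}
    (hθ : IsMonotoneCircleLift θ) (h : HasExpansion α c (poissonIntegral α θ)) :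
    27 / (4 * Real.pi ^ 2) ≤ heinzSum α c := by
  have hF := intervalIntegrable_of_norm_le (measurable_unimodular hθ.measurable)
    (fun t => (norm_unimodular t).le) 0 (2 * Real.pi)
  -- `poissonIntegral α θ` unfolds to `poissonExtension α (unimodular θ)`.
  rw [h.coeff_unique (hasExpansion_poissonExtension α hF), heinzSum_extensionCoeff hα]
  exact heinz_fourier hθ

end KernelHarmonic
end

noncomputable section
namespace KernelHarmonic

/-! ### Wirtinger derivatives and integrals depending on a parameter -/

open MeasureTheory Set

/-- The real-linear map `v ↦ a v + b v̄`. -/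
def wirt (a b : ℂ) : ℂ →L[ℝ] ℂ :=
  a • ContinuousLinearMap.id ℝ ℂ + b • (Complex.conjCLE : ℂ →L[ℝ] ℂ)

@[simp] lemma wirt_apply (a b v : ℂ) : wirt a b v = a * v + b * conj v := by
  simp [wirt]

lemma dz_eq {u : ℂ → ℂ} {a b z : ℂ} (h : HasFDerivAt u (wirt a b) z) : dz u z = a := by
  rw [dz, h.fderiv]
  simp only [wirt_apply, map_one, Complex.conj_I]
  linear_combination ((b - a) / 2) * Complex.I_mul_I

lemma dzbar_eq {u : ℂ → ℂ} {a b z : ℂ} (h : HasFDerivAt u (wirt a b) z) : dzbar u z = b := by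
  rw [dzbar, h.fderiv]
  simp only [wirt_apply, map_one, Complex.conj_I]
  linear_combination ((a - b) / 2) * Complex.I_mul_I

lemma hasFDerivAt_wirt_comp {h g : ℂ → ℂ} {h' a b z : ℂ} (hh : HasDerivAt h h' (g z))
    (hg : HasFDerivAt g (wirt a b) z) :
    HasFDerivAt (fun w => h (g w)) (wirt (h' * a) (h' * b)) z := by
  refine ((hh.hasFDerivAt.restrictScalars ℝ).comp z hg).congr_fderiv ?_
  ext v
  simp
  ring

lemma hasFDerivAt_wirt_mul {f g : ℂ → ℂ} {a b a' b' z : ℂ} (hf : HasFDerivAt f (wirt a b) z)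
    (hg : HasFDerivAt g (wirt a' b') z) :
    HasFDerivAt (fun w => f w * g w) (wirt (f z * a' + a * g z) (f z * b' + b * g z)) z := by
  refine (hf.mul hg).congr_fderiv ?_
  ext v
  simp
  ring

lemma hasFDerivAt_wirt_id (z : ℂ) : HasFDerivAt (fun w : ℂ => w) (wirt 1 0) z := by
  refine (hasFDerivAt_id z).congr_fderiv ?_
  ext v; simp

lemma hasFDerivAt_wirt_conj (z : ℂ) : HasFDerivAt (fun w : ℂ => conj w) (wirt 0 1) z := by
  refine (Complex.conjCLE.hasFDerivAt (x := z)).congr_fderiv ?_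
  ext v; simp

/-- All smoothness sits in `K`; compactness of a closed ball times the interval bounds its
derivative, and the bounded factor `F` only has to be measurable. -/
lemma hasFDerivAt_parametric {E : Type} [NormedAddCommGroup E] [NormedSpace ℝ E] [NormedSpace ℂ E]
    [SMulCommClass ℝ ℂ E] [CompleteSpace E] {s : Set ℂ} (hs : IsOpen s) {K : ℂ × ℝ → E}
    (hK : ContDiffOn ℝ 1 K (s ×ˢ univ)) {F : ℝ → ℂ} (hF : Measurable F) {C : ℝ}
    (hC : ∀ t, ‖F t‖ ≤ C) {z : ℂ} (hz : z ∈ s) (a b : ℝ) :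
    HasFDerivAt (fun w => ∫ φ in a..b, F φ • K (w, φ))
      (∫ φ in a..b, F φ • (fderiv ℝ K (z, φ)).comp (ContinuousLinearMap.inl ℝ ℂ ℝ)) z := by
  have hopen : IsOpen (s ×ˢ (univ : Set ℝ)) := hs.prod isOpen_univ
  obtain ⟨ε, hε, hball⟩ := Metric.nhds_basis_closedBall.mem_iff.1 (hs.mem_nhds hz)
  have hcd : ContinuousOn (fderiv ℝ K) (s ×ˢ univ) := hK.continuousOn_fderiv_of_isOpen hopen le_rfl
  obtain ⟨M, hM⟩ := ((isCompact_closedBall z ε).prod (isCompact_uIcc (a := a) (b := b))).exists_bound_of_continuousOn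
    (hcd.mono (prod_mono hball (subset_univ _)))
  have hsec : ∀ w ∈ s, Continuous fun φ : ℝ => K (w, φ) := fun w hw =>
    hK.continuousOn.comp_continuous (by fun_prop) fun φ => ⟨hw, mem_univ _⟩
  have hsec' : ∀ w ∈ s, Continuous fun φ : ℝ => fderiv ℝ K (w, φ) := fun w hw =>
    hcd.comp_continuous (by fun_prop) fun φ => ⟨hw, mem_univ _⟩
  refine intervalIntegral.hasFDerivAt_integral_of_dominated_of_fderiv_le
    (s := Metric.ball z ε) (F := fun w φ => F φ • K (w, φ))
    (F' := fun w φ => F φ • (fderiv ℝ K (w, φ)).comp (ContinuousLinearMap.inl ℝ ℂ ℝ))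
    (bound := fun _ => C * (M * ‖ContinuousLinearMap.inl ℝ ℂ ℝ‖)) (Metric.ball_mem_nhds z hε)
    ?_ ?_ ?_ ?_ intervalIntegrable_const ?_
  · filter_upwards [hs.mem_nhds hz] with w hw
    exact hF.aestronglyMeasurable.smul (hsec w hw).aestronglyMeasurable
  · have : IntervalIntegrable F volume a b := intervalIntegrable_of_norm_le hF hC a b
    exact this.smul_continuousOn (hsec z hz).continuousOn
  · refine hF.aestronglyMeasurable.smul (Continuous.aestronglyMeasurable ?_)
    exact (hsec' z hz).clm_comp continuous_const
  · refine Filter.Eventually.of_forall fun φ hφ w hw => ?_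
    rw [norm_smul]
    have := hM (w, φ) ⟨Metric.ball_subset_closedBall hw, uIoc_subset_uIcc hφ⟩
    have h2 := ContinuousLinearMap.opNorm_comp_le (fderiv ℝ K (w, φ)) (ContinuousLinearMap.inl ℝ ℂ ℝ)
    have C0 : 0 ≤ C := (norm_nonneg _).trans (hC 0)
    refine mul_le_mul (hC φ) (h2.trans ?_) (norm_nonneg _) C0
    gcongr
  · refine Filter.Eventually.of_forall fun φ hφ w hw => ?_
    have hw' : w ∈ s := hball (Metric.ball_subset_closedBall hw)
    have h1 : HasFDerivAt K (fderiv ℝ K (w, φ)) (w, φ) :=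
      ((hK.contDiffAt (hopen.mem_nhds ⟨hw', mem_univ _⟩)).differentiableAt (by simp)).hasFDerivAt
    exact (h1.comp w (hasFDerivAt_prodMk_left w φ)).const_smul (F φ)

/-- The target `E` varies in the induction since the differentiated kernel takes values in linear
maps. One order of smoothness is lost because continuity at the base is deduced from
differentiability; this is why the kernels are shown to be `C³`. -/
lemma contDiffOn_parametric {s : Set ℂ} (hs : IsOpen s) {F : ℝ → ℂ} (hF : Measurable F) {C : ℝ}
    (hC : ∀ t, ‖F t‖ ≤ C) (a b : ℝ) (n : ℕ) :
    ∀ {E : Type} [NormedAddCommGroup E] [NormedSpace ℝ E] [NormedSpace ℂ E]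
    [SMulCommClass ℝ ℂ E] [CompleteSpace E] {K : ℂ × ℝ → E}
    (_ : ContDiffOn ℝ (n + 1) K (s ×ˢ univ)),
    ContDiffOn ℝ n (fun w => ∫ φ in a..b, F φ • K (w, φ)) s := by
  have hopen : IsOpen (s ×ˢ (univ : Set ℝ)) := hs.prod isOpen_univ
  induction n with
  | zero =>
    intro E _ _ _ _ _ K hK
    simp only [Nat.cast_zero, contDiffOn_zero]
    exact fun z hz => (hasFDerivAt_parametric hs (by simpa using hK) hF hC hz a b).continuousAt.continuousWithinAt
  | succ n ih =>
    intro E _ _ _ _ _ K hK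
    have hK1 : ContDiffOn ℝ 1 K (s ×ˢ univ) := hK.of_le (by norm_cast; omega)
    have hd := fun z hz => hasFDerivAt_parametric hs hK1 hF hC (z := z) hz a b
    rw [Nat.cast_add, Nat.cast_one, contDiffOn_succ_iff_fderiv_of_isOpen hs]
    refine ⟨fun z hz => (hd z hz).differentiableAt.differentiableWithinAt, by simp, ?_⟩
    have hK' : ContDiffOn ℝ (n + 1) (fun p => (fderiv ℝ K p).comp (ContinuousLinearMap.inl ℝ ℂ ℝ))
        (s ×ˢ univ) := by
      refine ContDiffOn.clm_comp ?_ contDiffOn_const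
      refine hK.fderiv_of_isOpen hopen ?_
      norm_cast
    exact (ih hK').congr fun z hz => (hd z hz).fderiv

lemma hasFDerivAt_parametric_apply {s : Set ℂ} (hs : IsOpen s) {K : ℂ × ℝ → ℂ}
    (hK : ContDiffOn ℝ 1 K (s ×ˢ univ)) {F : ℝ → ℂ} (hF : Measurable F) {C : ℝ}
    (hC : ∀ t, ‖F t‖ ≤ C) {z : ℂ} (hz : z ∈ s) (a b : ℝ) {A B : ℝ → ℂ}
    (hAB : ∀ φ, HasFDerivAt (fun w => K (w, φ)) (wirt (A φ) (B φ)) z) :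
    dz (fun w => ∫ φ in a..b, F φ * K (w, φ)) z = ∫ φ in a..b, F φ * A φ ∧
    dzbar (fun w => ∫ φ in a..b, F φ * K (w, φ)) z = ∫ φ in a..b, F φ * B φ := by
  have hopen : IsOpen (s ×ˢ (univ : Set ℝ)) := hs.prod isOpen_univ
  have h := hasFDerivAt_parametric hs hK hF hC hz a b
  have e : ∀ φ, (fderiv ℝ K (z, φ)).comp (ContinuousLinearMap.inl ℝ ℂ ℝ) = wirt (A φ) (B φ) := fun φ => by
    have h1 : HasFDerivAt K (fderiv ℝ K (z, φ)) (z, φ) :=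
      ((hK.contDiffAt (hopen.mem_nhds ⟨hz, mem_univ _⟩)).differentiableAt (by simp)).hasFDerivAt
    exact (h1.comp z (hasFDerivAt_prodMk_left z φ)).unique (hAB φ)
  have hcd : ContinuousOn (fderiv ℝ K) (s ×ˢ univ) := hK.continuousOn_fderiv_of_isOpen hopen le_rfl
  have hsec : Continuous fun φ : ℝ => wirt (A φ) (B φ) := by
    simp only [← e]
    exact (hcd.comp_continuous (f := fun φ : ℝ => (z, φ)) (by fun_prop)
      fun φ => ⟨hz, mem_univ _⟩).clm_comp continuous_const
  have hFi : IntervalIntegrable F volume a b := intervalIntegrable_of_norm_le hF hC a b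
  -- Evaluating the map `wirt (A φ) (B φ)` at `1` and at `I` recovers `A + B` and `A - B`.
  have c1 : Continuous fun φ => A φ + B φ := by simpa using hsec.clm_apply (continuous_const (y := (1 : ℂ)))
  have c2 : Continuous fun φ => A φ - B φ := by
    have := (hsec.clm_apply (continuous_const (y := Complex.I))).mul (continuous_const (y := -Complex.I))
    refine this.congr fun φ => ?_
    simp only [Pi.mul_apply, wirt_apply, Complex.conj_I]
    linear_combination (B φ - A φ) * Complex.I_mul_I
  have cA : Continuous A := by
    refine ((c1.add c2).div_const 2).congr fun φ => ?_
    simp only [Pi.add_apply]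
    ring
  have cB : Continuous B := by
    refine ((c1.sub c2).div_const 2).congr fun φ => ?_
    simp only [Pi.sub_apply]
    ring
  have hw : (∫ φ in a..b, F φ • (fderiv ℝ K (z, φ)).comp (ContinuousLinearMap.inl ℝ ℂ ℝ)) =
      wirt (∫ φ in a..b, F φ * A φ) (∫ φ in a..b, F φ * B φ) := by
    simp only [e]
    ext1 v
    rw [ContinuousLinearMap.intervalIntegral_apply (hFi.smul_continuousOn hsec.continuousOn), wirt_apply,
      ← intervalIntegral.integral_mul_const, ← intervalIntegral.integral_mul_const,
      ← intervalIntegral.integral_add ((hFi.mul_continuousOn cA.continuousOn).mul_const _)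
        ((hFi.mul_continuousOn cB.continuousOn).mul_const _)]
    refine intervalIntegral.integral_congr fun φ _ => ?_
    simp
    ring
  rw [hw] at h
  simp only [smul_eq_mul] at h
  exact ⟨dz_eq h, dzbar_eq h⟩

end KernelHarmonic
end

noncomputable section
namespace KernelHarmonic

/-! ### Kernel harmonicity of the extension, and the three-valued step function -/

open MeasureTheory Set

lemma isOpen_disk : IsOpen disk := Metric.isOpen_ball

lemma contDiffOn_poissonKernel (α : ℝ) : ContDiffOn ℝ 3 (poissonKernel α) disk := by
  intro z hz
  rw [mem_disk] at hz
  refine ContDiffAt.contDiffWithinAt ?_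
  have hc : ContDiffAt ℝ 3 (fun w : ℂ => conj w) z := Complex.conjCLE.contDiff.contDiffAt
  have h1 : ContDiffAt ℝ 3 (fun w : ℂ => (((1 - ‖w‖ ^ 2) ^ (α + 1) : ℝ) : ℂ)) z := by
    refine Complex.ofRealCLM.contDiff.contDiffAt.comp z ?_
    refine ContDiffAt.rpow_const_of_ne (contDiffAt_const.sub (contDiff_norm_sq ℝ).contDiffAt) ?_
    linarith [sq_norm_lt_one hz] 
  have h2 : ContDiffAt ℝ 3 (fun w : ℂ => (1 - conj w) ^ ((α + 1 : ℝ) : ℂ)) z := by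
    have hs : 1 - conj z ∈ Complex.slitPlane := one_sub_mem_slitPlane (by rwa [RCLike.norm_conj])
    have : ContDiffAt ℂ 3 (fun x : ℂ => x ^ ((α + 1 : ℝ) : ℂ)) (1 - conj z) :=
      (analyticAt_id.cpow analyticAt_const hs).contDiffAt
    exact (this.restrict_scalars ℝ).comp z (contDiffAt_const.sub hc)
  have h3 : ContDiffAt ℝ 3 (fun w : ℂ => 1 - w) z := contDiffAt_const.sub contDiffAt_id
  have h4 : ContDiffAt ℝ 3 (fun w : ℂ => (1 - w) * (1 - conj w) ^ ((α + 1 : ℝ) : ℂ)) z := h3.mul h2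
  have e : poissonKernel α = fun w => (((1 - ‖w‖ ^ 2) ^ (α + 1) : ℝ) : ℂ) *
      ((1 - w) * (1 - conj w) ^ ((α + 1 : ℝ) : ℂ))⁻¹ := by
    funext w; rw [poissonKernel, div_eq_mul_inv]
  rw [e]
  refine ContDiffAt.mul h1 (ContDiffAt.inv h4 (mul_ne_zero ?_ ?_))
  · exact one_sub_ne_zero_of_norm_lt_one hz
  · rw [Ne, Complex.cpow_eq_zero_iff, not_and_or]
    exact Or.inl (one_sub_ne_zero_of_norm_lt_one (by rwa [RCLike.norm_conj]))

lemma contDiffOn_conj_cpow (β : ℂ) : ContDiffOn ℝ 3 (fun w : ℂ => (1 - conj w) ^ β) disk := by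
  intro z hz
  rw [mem_disk] at hz
  refine ContDiffAt.contDiffWithinAt ?_
  have hc : ContDiffAt ℝ 3 (fun w : ℂ => conj w) z := Complex.conjCLE.contDiff.contDiffAt
  have hs : 1 - conj z ∈ Complex.slitPlane := one_sub_mem_slitPlane (by rwa [RCLike.norm_conj])
  have : ContDiffAt ℂ 3 (fun x : ℂ => x ^ β) (1 - conj z) :=
    (analyticAt_id.cpow analyticAt_const hs).contDiffAt
  exact (this.restrict_scalars ℝ).comp z (contDiffAt_const.sub hc)

lemma contDiffOn_rotate {g : ℂ → ℂ} (hg : ContDiffOn ℝ 3 g disk) :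
    ContDiffOn ℝ 3 (fun p : ℂ × ℝ => g (p.1 * Complex.exp (-((p.2 : ℂ) * Complex.I))))
      (disk ×ˢ univ) := by
  refine hg.comp (ContDiff.contDiffOn ?_) fun p hp => ?_
  · refine contDiff_fst.mul (ContDiff.cexp ?_)
    exact ((Complex.ofRealCLM.contDiff.comp contDiff_snd).mul contDiff_const).neg
  · have := hp.1
    rw [mem_disk] at this ⊢
    rwa [norm_mul_exp_neg]

lemma hasFDerivAt_wirt_one_sub_mul (e z : ℂ) :
    HasFDerivAt (fun w => 1 - e * w) (wirt (-e) 0) z := by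
  refine (((hasFDerivAt_id z).const_mul e).const_sub 1).congr_fderiv ?_
  ext v; simp

lemma hasFDerivAt_wirt_one_sub_mul_conj (e z : ℂ) :
    HasFDerivAt (fun w => 1 - e * conj w) (wirt 0 (-e)) z := by
  refine (((Complex.conjCLE.hasFDerivAt (x := z)).const_mul e).const_sub 1).congr_fderiv ?_
  ext v; simp

lemma hasFDerivAt_wirt_one_sub_self_mul_conj (z : ℂ) :
    HasFDerivAt (fun w => 1 - w * conj w) (wirt (-conj z) (-z)) z := by
  refine ((hasFDerivAt_wirt_mul (hasFDerivAt_wirt_id z) (hasFDerivAt_wirt_conj z)).const_sub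
    1).congr_fderiv ?_
  ext v; simp; ring

lemma hasFDerivAt_wirt_conj_cpow (β : ℂ) {e z : ℂ} (hz : ‖e * conj z‖ < 1) :
    HasFDerivAt (fun w => (1 - e * conj w) ^ β)
      (wirt 0 (β * (1 - e * conj z) ^ (β - 1) * -e)) z := by
  have h := hasFDerivAt_wirt_comp (g := fun w => 1 - e * conj w)
    (Complex.hasStrictDerivAt_cpow_const (c := β) (one_sub_mem_slitPlane hz)).hasDerivAt
    (hasFDerivAt_wirt_one_sub_mul_conj e z)
  simpa only [mul_zero] using h

lemma poissonKernel_mul_eq (α : ℝ) {e w : ℂ} (he : ‖e‖ = 1) (hw : ‖w‖ < 1) :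
    poissonKernel α (w * e) = (1 - w * conj w) ^ ((α + 1 : ℝ) : ℂ) * ((1 - e * w)⁻¹ *
      (1 - conj e * conj w) ^ (-((α + 1 : ℝ) : ℂ))) := by
  have h1 : 0 ≤ 1 - ‖w‖ ^ 2 := by linarith [sq_norm_lt_one hw]
  rw [poissonKernel, norm_mul, he, mul_one, Complex.ofReal_cpow h1, map_mul, Complex.cpow_neg,
    mul_comm w e, mul_comm (conj w)]
  push_cast
  rw [← Complex.mul_conj', div_eq_mul_inv, mul_inv]

/-- The `z̄`-derivative is the weight `(1 - |z|²)^α` times an antiholomorphic function, so after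
removal of the weight it is annihilated by `∂/∂z`. The `z`-derivative plays no role and is left
existential. -/
lemma exists_hasFDerivAt_poissonKernel_mul (α : ℝ) {e z : ℂ} (he : ‖e‖ = 1) (hz : ‖z‖ < 1) :
    ∃ a, HasFDerivAt (fun w => poissonKernel α (w * e))
      (wirt a ((((1 - ‖z‖ ^ 2) ^ α : ℝ) : ℂ) * ((α + 1) * conj e *
        (1 - conj e * conj z) ^ (-((α + 2 : ℝ) : ℂ))))) z := by
  have hq0 : 0 < 1 - ‖z‖ ^ 2 := by linarith [sq_norm_lt_one hz]
  have hq : 1 - z * conj z = ((1 - ‖z‖ ^ 2 : ℝ) : ℂ) := by rw [Complex.mul_conj']; push_cast; rfl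
  have hqs : 1 - z * conj z ∈ Complex.slitPlane := by
    rw [hq]; exact Complex.ofReal_mem_slitPlane.2 hq0
  have hez : ‖e * z‖ < 1 := by rwa [norm_mul, he, one_mul]
  have hez' : ‖conj e * conj z‖ < 1 := by rwa [← map_mul, RCLike.norm_conj]
  have hn : 1 - e * z ≠ 0 := one_sub_ne_zero_of_norm_lt_one hez
  have hn' : 1 - conj e * conj z ≠ 0 := one_sub_ne_zero_of_norm_lt_one hez'
  have hee : e * conj e = 1 := by rw [Complex.mul_conj', he]; simp
  have d1 := hasFDerivAt_wirt_comp (g := fun w => 1 - w * conj w)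
    (Complex.hasStrictDerivAt_cpow_const (c := ((α + 1 : ℝ) : ℂ)) hqs).hasDerivAt
    (hasFDerivAt_wirt_one_sub_self_mul_conj z)
  have d2 := hasFDerivAt_wirt_comp (g := fun w => 1 - e * w) (hasDerivAt_inv hn)
    (hasFDerivAt_wirt_one_sub_mul e z)
  have d3 := hasFDerivAt_wirt_conj_cpow (-((α + 1 : ℝ) : ℂ)) hez'
  have d := hasFDerivAt_wirt_mul d1 (hasFDerivAt_wirt_mul d2 d3)
  refine ⟨_, (d.congr_of_eventuallyEq ?_).congr_fderiv (congrArg (wirt _) ?_)⟩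
  · filter_upwards [isOpen_disk.mem_nhds (mem_disk.2 hz)] with w hw
    exact poissonKernel_mul_eq α he (mem_disk.1 hw)
  · have e1 : ((α + 1 : ℝ) : ℂ) - 1 = (α : ℂ) := by push_cast; ring
    have e2 : (1 - z * conj z) ^ ((α + 1 : ℝ) : ℂ) = (1 - z * conj z) ^ (α : ℂ) * (1 - z * conj z) := by
      rw [Complex.ofReal_add, Complex.cpow_add _ _ (Complex.slitPlane_ne_zero hqs),
        Complex.ofReal_one, Complex.cpow_one]
    have e3 : (1 - conj e * conj z) ^ (-((α + 1 : ℝ) : ℂ)) =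
        (1 - conj e * conj z) ^ (-((α + 2 : ℝ) : ℂ)) * (1 - conj e * conj z) := by
      rw [show (-((α + 1 : ℝ) : ℂ)) = -((α + 2 : ℝ) : ℂ) + 1 by push_cast; ring,
        Complex.cpow_add _ _ hn', Complex.cpow_one]
    have e4 : -((α + 1 : ℝ) : ℂ) - 1 = -((α + 2 : ℝ) : ℂ) := by push_cast; ring
    have e5 : (((1 - ‖z‖ ^ 2) ^ α : ℝ) : ℂ) = (1 - z * conj z) ^ (α : ℂ) := by
      rw [hq, Complex.ofReal_cpow hq0.le]
    simp only [e1, e2, e3, e4, e5]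
    generalize (1 - z * conj z) ^ (α : ℂ) = Q
    generalize (1 - conj e * conj z) ^ (-((α + 2 : ℝ) : ℂ)) = Z
    have hX := inv_mul_cancel₀ hn
    generalize (1 - e * z)⁻¹ = X at *
    push_cast
    linear_combination ((α + 1) * Q * Z * conj e) * hX + ((α + 1) * Q * Z * X * z) * hee

theorem isKernelHarmonic_poissonExtension (α : ℝ) {F : ℝ → ℂ} (hF : Measurable F) {C : ℝ}
    (hC : ∀ t, ‖F t‖ ≤ C) : IsKernelHarmonic α (poissonExtension α F) := by
  have hK := contDiffOn_rotate (contDiffOn_poissonKernel α)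
  have hK' := contDiffOn_rotate (contDiffOn_conj_cpow (-((α + 2 : ℝ) : ℂ)))
  have hu : poissonExtension α F = fun z => ∫ φ in (0 : ℝ)..(2 * Real.pi), F φ *
      ((1 / (2 * Real.pi) : ℂ) * poissonKernel α (z * Complex.exp (-((φ : ℂ) * Complex.I)))) := by
    funext z
    rw [poissonExtension, ← intervalIntegral.integral_const_mul]
    refine intervalIntegral.integral_congr fun φ _ => ?_
    ring
  have hK1 : ContDiffOn ℝ 3 (fun p : ℂ × ℝ => (1 / (2 * Real.pi) : ℂ) *
    poissonKernel α (p.1 * Complex.exp (-((p.2 : ℂ) * Complex.I)))) (disk ×ˢ univ) :=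
    contDiffOn_const.mul hK
  refine ⟨?_, fun z hz => ?_⟩
  · rw [hu]
    have := contDiffOn_parametric isOpen_disk hF hC 0 (2 * Real.pi) 2 (by norm_num; exact hK1)
    simp only [smul_eq_mul] at this
    exact_mod_cast this
  · have hdzbar : ∀ w ∈ disk, (((1 - ‖w‖ ^ 2) ^ (-α) : ℝ) : ℂ) * dzbar (poissonExtension α F) w =
        ∫ φ in (0 : ℝ)..(2 * Real.pi), (F φ * ((1 / (2 * Real.pi) : ℂ) * ((α + 1) *
          conj (Complex.exp (-((φ : ℂ) * Complex.I)))))) *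
          (1 - conj (w * Complex.exp (-((φ : ℂ) * Complex.I)))) ^ (-((α + 2 : ℝ) : ℂ)) := by
      intro w hw
      have hw1 := mem_disk.1 hw
      choose A hA using fun φ : ℝ => exists_hasFDerivAt_poissonKernel_mul α
        (e := Complex.exp (-((φ : ℂ) * Complex.I))) (norm_exp_neg_mul_I φ) hw1
      have hp : 0 < 1 - ‖w‖ ^ 2 := by linarith [sq_norm_lt_one hw1]
      have := (hasFDerivAt_parametric_apply isOpen_disk (hK1.of_le (by norm_num)) hF hC hw 0 (2 * Real.pi)
        (A := fun φ => (1 / (2 * Real.pi) : ℂ) * A φ)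
        (B := fun φ => (1 / (2 * Real.pi) : ℂ) * ((((1 - ‖w‖ ^ 2) ^ α : ℝ) : ℂ) *
          ((α + 1) * conj (Complex.exp (-((φ : ℂ) * Complex.I))) *
          (1 - conj (Complex.exp (-((φ : ℂ) * Complex.I))) * conj w) ^ (-((α + 2 : ℝ) : ℂ)))))
        (fun φ => by
          refine ((hA φ).const_mul (1 / (2 * Real.pi) : ℂ)).congr_fderiv ?_
          ext v; simp; ring)).2
      rw [hu, this, ← intervalIntegral.integral_const_mul]
      refine intervalIntegral.integral_congr fun φ _ => ?_
      have hinv : (((1 - ‖w‖ ^ 2) ^ (-α) : ℝ) : ℂ) * (((1 - ‖w‖ ^ 2) ^ α : ℝ) : ℂ) = 1 := by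
        rw [← Complex.ofReal_mul, ← Real.rpow_add hp]; simp
      simp only [map_mul, mul_comm (conj w)]
      linear_combination (F φ * (1 / (2 * Real.pi) : ℂ) *
        ((α + 1) * conj (Complex.exp (-((φ : ℂ) * Complex.I))) *
          (1 - conj (Complex.exp (-((φ : ℂ) * Complex.I))) * conj w) ^ (-((α + 2 : ℝ) : ℂ)))) * hinv
    have hev : (fun w => (((1 - ‖w‖ ^ 2) ^ (-α) : ℝ) : ℂ) * dzbar (poissonExtension α F) w) =ᶠ[nhds z]
        fun w => ∫ φ in (0 : ℝ)..(2 * Real.pi), (F φ * ((1 / (2 * Real.pi) : ℂ) * ((α + 1) *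
          conj (Complex.exp (-((φ : ℂ) * Complex.I)))))) *
          (1 - conj (w * Complex.exp (-((φ : ℂ) * Complex.I)))) ^ (-((α + 2 : ℝ) : ℂ)) := by
      filter_upwards [isOpen_disk.mem_nhds hz] with w hw using hdzbar w hw
    have hG : Measurable (fun φ : ℝ => F φ * ((1 / (2 * Real.pi) : ℂ) * ((α + 1) *
          conj (Complex.exp (-((φ : ℂ) * Complex.I)))))) :=
      hF.mul (Continuous.measurable (by fun_prop))
    have hGC : ∀ φ, ‖F φ * ((1 / (2 * Real.pi) : ℂ) * ((α + 1) *
          conj (Complex.exp (-((φ : ℂ) * Complex.I)))))‖ ≤ C * (‖(1 / (2 * Real.pi) : ℂ)‖ * ‖(α + 1 : ℂ)‖) := by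
      intro φ
      rw [norm_mul, norm_mul, norm_mul, RCLike.norm_conj, norm_exp_neg_mul_I, mul_one]
      gcongr
      exact hC φ
    rw [weightedLaplacian, dz, hev.fderiv_eq, ← dz]
    -- The unweighted integrand is antiholomorphic in `z`, whence `A = 0`.
    have := (hasFDerivAt_parametric_apply isOpen_disk (hK'.of_le (by norm_num)) hG hGC hz 0 (2 * Real.pi)
      (A := fun φ => 0) (B := fun φ => _)
      (fun φ => by
        have h := hasFDerivAt_wirt_conj_cpow (-((α + 2 : ℝ) : ℂ))
          (e := conj (Complex.exp (-((φ : ℂ) * Complex.I)))) (z := z) (by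
            rw [norm_mul, RCLike.norm_conj, RCLike.norm_conj, norm_exp_neg_mul_I, one_mul]
            exact mem_disk.1 hz)
        simp only [map_mul, mul_comm (conj _) (conj (Complex.exp _))]
        exact h)).1
    rw [this]
    simp

/-! ### The extremal step function. -/

lemma floor_stepLift_arg_add (φ : ℝ) :
    (3 * (φ + 2 * Real.pi / 3) + Real.pi) / (2 * Real.pi) = (3 * φ + Real.pi) / (2 * Real.pi) + 1 := by
  have := Real.pi_pos
  field_simp
  ring

lemma stepLift_add_third (φ : ℝ) : stepLift (φ + 2 * Real.pi / 3) = stepLift φ + 2 * Real.pi / 3 := by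
  rw [stepLift, stepLift, floor_stepLift_arg_add, Int.floor_add_one]
  push_cast; ring

lemma isMonotoneCircleLift_stepLift : IsMonotoneCircleLift stepLift := by
  have hpi := Real.pi_pos
  refine ⟨fun a b hab => ?_, fun φ => ?_⟩
  · unfold stepLift
    gcongr
  · have e : φ + 2 * Real.pi = φ + 2 * Real.pi / 3 + 2 * Real.pi / 3 + 2 * Real.pi / 3 := by ring
    rw [e, stepLift_add_third, stepLift_add_third, stepLift_add_third]
    ring

lemma unimodular_stepLift_add (φ : ℝ) : unimodular stepLift (φ + 2 * Real.pi / 3) =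
    Complex.exp ((2 * Real.pi / 3 : ℝ) * Complex.I) * unimodular stepLift φ := by
  rw [unimodular, stepLift_add_third, unimodular, ← Complex.exp_add]
  congr 1
  push_cast; ring

/-- Translation by `2π/3` multiplies the function by `e^{2πi/3}` and its `n`-th coefficient by
`e^{2πin/3}`; if these differ, the coefficient vanishes. -/
lemma circleCoeff_stepLift_eq_zero {n : ℤ}
    (hn : Complex.exp ((n : ℂ) * (2 * Real.pi / 3 : ℝ) * Complex.I) ≠
      Complex.exp ((2 * Real.pi / 3 : ℝ) * Complex.I)) :
    circleCoeff (unimodular stepLift) n = 0 := by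
  have h := circleCoeff_shift isMonotoneCircleLift_stepLift.periodic_unimodular (2 * Real.pi / 3) n
  have h2 : circleCoeff (fun t => unimodular stepLift (t + 2 * Real.pi / 3)) n =
      Complex.exp ((2 * Real.pi / 3 : ℝ) * Complex.I) * circleCoeff (unimodular stepLift) n := by
    simp only [unimodular_stepLift_add, circleCoeff, mul_left_comm _ (Complex.exp ((2 * Real.pi / 3 : ℝ) * Complex.I)),
      intervalIntegral.integral_const_mul]
  rw [h2] at h
  by_contra hne
  exact hn (mul_right_cancel₀ hne h).symm

lemma exp_third_im : (Complex.exp ((2 * Real.pi / 3 : ℝ) * Complex.I)).im = Real.sqrt 3 / 2 := by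
  rw [Complex.exp_ofReal_mul_I_im, sin_two_pi_div_three]

lemma circleCoeff_stepLift_zero : circleCoeff (unimodular stepLift) 0 = 0 := by
  refine circleCoeff_stepLift_eq_zero fun h => ?_
  have := congrArg Complex.im h
  rw [exp_third_im] at this
  have h3 : 0 < Real.sqrt 3 := by positivity
  simp at this
  linarith

lemma circleCoeff_stepLift_neg_one : circleCoeff (unimodular stepLift) (-1) = 0 := by
  refine circleCoeff_stepLift_eq_zero fun h => ?_
  have := congrArg Complex.im h
  rw [exp_third_im, show ((-1 : ℤ) : ℂ) * ((2 * Real.pi / 3 : ℝ) : ℂ) = ((-(2 * Real.pi / 3) : ℝ) : ℂ)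
    by push_cast; ring, Complex.exp_ofReal_mul_I_im, Real.sin_neg, sin_two_pi_div_three] at this
  have h3 : 0 < Real.sqrt 3 := by positivity
  linarith

lemma unimodular_stepLift_eq_one {t : ℝ} (h1 : -(Real.pi / 3) < t) (h2 : t < Real.pi / 3) :
    unimodular stepLift t = 1 := by
  have hpi := Real.pi_pos
  have : ⌊(3 * t + Real.pi) / (2 * Real.pi)⌋ = 0 := by
    rw [Int.floor_eq_zero_iff]
    constructor
    · apply div_nonneg <;> linarith
    · rw [div_lt_one (by positivity)]; linarith
  simp [unimodular, stepLift, this]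

lemma circleCoeff_stepLift_one :
    circleCoeff (unimodular stepLift) 1 = ((3 * Real.sqrt 3 / (2 * Real.pi) : ℝ) : ℂ) := by
  have hpi := Real.pi_pos
  have hper : Function.Periodic (fun t : ℝ => Complex.exp (-(((1 : ℤ) : ℂ) * t * Complex.I)) *
      unimodular stepLift t) (2 * Real.pi / 3) := by
    intro t
    simp only
    rw [unimodular_stepLift_add, ← mul_assoc, ← Complex.exp_add]
    congr 2
    push_cast; ring
  -- The integrand has period `2π/3`, so the integral is three times the one over `(-π/3, π/3)`,
  -- where the step function is `0`.
  have h := hper.intervalIntegral_add_zsmul_eq 3 0 fun a b =>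
    intervalIntegrable_of_norm_le ((Continuous.measurable (by fun_prop)).mul
      (measurable_unimodular isMonotoneCircleLift_stepLift.measurable)) (C := 1)
      (fun t => by
        rw [Pi.mul_apply, norm_mul, norm_exp_neg_int_mul_I, norm_unimodular, mul_one]) a b
  rw [hper.intervalIntegral_add_eq 0 (-(Real.pi / 3))] at h
  have hI : ∫ t in -(Real.pi / 3)..(-(Real.pi / 3) + 2 * Real.pi / 3),
      Complex.exp (-(((1 : ℤ) : ℂ) * t * Complex.I)) * unimodular stepLift t =
      ∫ t in -(Real.pi / 3)..(Real.pi / 3), Complex.exp (-Complex.I * t) := by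
    rw [show -(Real.pi / 3) + 2 * Real.pi / 3 = Real.pi / 3 by ring]
    refine intervalIntegral.integral_congr_ae ?_
    have : ∀ᵐ t : ℝ, t ≠ Real.pi / 3 := by
      rw [ae_iff]; simp
    filter_upwards [this] with t ht hmem
    rw [uIoc_of_le (by linarith)] at hmem
    rw [unimodular_stepLift_eq_one hmem.1 (lt_of_le_of_ne hmem.2 ht), mul_one]
    congr 1
    push_cast; ring
  rw [hI, integral_exp_mul_complex (by simp)] at h
  rw [circleCoeff]
  rw [show (0 : ℝ) + (3 : ℤ) • (2 * Real.pi / 3) = 2 * Real.pi by simp; ring] at h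
  rw [h]
  have e1 : Complex.exp (-Complex.I * ((Real.pi / 3 : ℝ) : ℂ)) = (1 / 2 : ℝ) - (Real.sqrt 3 / 2 : ℝ) * Complex.I := by
    rw [show -Complex.I * ((Real.pi / 3 : ℝ) : ℂ) = ((-(Real.pi / 3) : ℝ) : ℂ) * Complex.I by push_cast; ring,
      Complex.exp_mul_I, ← Complex.ofReal_cos, ← Complex.ofReal_sin, Real.cos_neg, Real.sin_neg,
      Real.cos_pi_div_three, Real.sin_pi_div_three]
    push_cast; ring
  have e2 : Complex.exp (-Complex.I * ((-(Real.pi / 3) : ℝ) : ℂ)) = (1 / 2 : ℝ) + (Real.sqrt 3 / 2 : ℝ) * Complex.I := by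
    rw [show -Complex.I * ((-(Real.pi / 3) : ℝ) : ℂ) = (((Real.pi / 3) : ℝ) : ℂ) * Complex.I by push_cast; ring,
      Complex.exp_mul_I, ← Complex.ofReal_cos, ← Complex.ofReal_sin,
      Real.cos_pi_div_three, Real.sin_pi_div_three]
  rw [e1, e2]
  have hpi' : (Real.pi : ℂ) ≠ 0 := by exact_mod_cast hpi.ne'
  push_cast
  simp only [zsmul_eq_mul]
  field_simp
  push_cast
  ring_nf

theorem heinzSum_stepLift {α : ℝ} (hα : -1 < α) :
    heinzSum α (extensionCoeff α (unimodular stepLift)) = 27 / (4 * Real.pi ^ 2) := by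
  rw [heinzSum_extensionCoeff hα, circleCoeff_stepLift_one, circleCoeff_stepLift_zero,
    circleCoeff_stepLift_neg_one, Complex.norm_real, Real.norm_eq_abs, sq_abs, div_pow, mul_pow,
    Real.sq_sqrt (by norm_num)]
  simp
  ring

end KernelHarmonic
end

noncomputable section
namespace KernelHarmonic

/-! ### Crossing curves and winding numbers -/

open Set

/-- The domain is the whole plane, so the lift through the covering `exp` is global. Maps given on
strips or rectangles are extended to it by `projIcc`. -/
lemma exists_continuous_log {f : ℝ × ℝ → ℂ} (hf : Continuous f) (h0 : ∀ p, f p ≠ 0) :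
    ∃ L : ℝ × ℝ → ℂ, Continuous L ∧ ∀ p, Complex.exp (L p) = f p := by
  obtain ⟨F, ⟨-, hF⟩, -⟩ := Complex.isCoveringMapOn_exp.existsUnique_continuousMap_lifts
    (⟨f, hf⟩ : C(ℝ × ℝ, ℂ)) (a₀ := (0, 0)) (Complex.exp_log (h0 (0, 0))) (fun p => h0 p)
  exact ⟨F, F.continuous, fun p => congrFun hF p⟩

/-- A continuous integer-valued function on a connected space is constant; every winding number
below arises in this way. -/
lemma exists_int_of_exp_eq_one {X : Type*} [TopologicalSpace X] [PreconnectedSpace X] {D : X → ℂ}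
    (hD : Continuous D) (h : ∀ x, Complex.exp (D x) = 1) :
    ∃ n : ℤ, ∀ x, D x = n * (2 * Real.pi * Complex.I) := by
  choose n hn using fun x => Complex.exp_eq_one_iff.1 (h x)
  have hpi := Real.pi_pos
  have hc : Continuous n := by
    rw [Int.isClosedEmbedding_coe_real.isInducing.continuous_iff]
    have : (fun x => (n x : ℝ)) = fun x => (D x).im / (2 * Real.pi) := by
      funext x
      rw [hn x]
      simp
    rw [Function.comp_def, this]
    fun_prop
  rcases isEmpty_or_nonempty X with hX | ⟨⟨x0⟩⟩
  · exact ⟨0, fun x => hX.elim x⟩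
  · exact ⟨n x0, fun x => by rw [hn x, PreconnectedSpace.constant inferInstance hc (x := x) (y := x0)]⟩

lemma exists_int_of_exp_eq {X : Type*} [TopologicalSpace X] [PreconnectedSpace X] {A B : X → ℂ}
    (hA : Continuous A) (hB : Continuous B) (h : ∀ x, Complex.exp (A x) = Complex.exp (B x)) :
    ∃ n : ℤ, ∀ x, A x = B x + n * (2 * Real.pi * Complex.I) := by
  obtain ⟨n, hn⟩ := exists_int_of_exp_eq_one (hA.sub hB) (fun x => by
    rw [Pi.sub_apply, Complex.exp_sub, h, div_self (Complex.exp_ne_zero _)])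
  exact ⟨n, fun x => by rw [← hn x, Pi.sub_apply]; ring⟩

lemma abs_le_pi_div_two_of_cos_nonneg {g : ℝ → ℝ} (hg : Continuous g) {x y : ℝ}
    (hcos : ∀ z ∈ uIcc x y, 0 ≤ Real.cos (g z)) (hx : |g x| ≤ Real.pi / 2) :
    |g y| ≤ Real.pi / 2 := by
  by_contra! hy
  -- Capping at `π` keeps the intermediate value in `(π/2, π]`, where the cosine is negative.
  set v := min |g y| Real.pi with hv
  have hpi := Real.pi_pos
  have h1 : Real.pi / 2 < v := lt_min hy (by linarith)
  obtain ⟨z, hz, hzv⟩ := intermediate_value_uIcc (f := fun z => |g z|) (a := x) (b := y)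
    (by fun_prop) (Icc_subset_uIcc ⟨by linarith, min_le_left _ _⟩ : v ∈ uIcc |g x| |g y|)
  have hzv : |g z| = v := hzv
  have h2 := hcos z hz
  rw [← Real.cos_abs, hzv] at h2
  exact h2.not_gt (Real.cos_neg_of_pi_div_two_lt_of_lt h1
    ((min_le_right _ _).trans_lt (by linarith)))

/-- Without a crossing, `p s - q τ` has a continuous argument on the rectangle, normalised to `π/2`
at the corner `(b, c)`. Along the three sides `τ = c`, `s = a`, `τ = d` the real part is nonpositive
and the argument stays within `π/2` of `π`; along `s = b` it stays within `π/2` of `0`. At `(b, d)`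
it must then be `π/2`, against the sign of the imaginary part there. -/
lemma exists_crossing_of_lt {p q : ℝ → ℂ} (hp : Continuous p) (hq : Continuous q) {a b c d M : ℝ}
    (hab : a ≤ b) (hcd : c ≤ d)
    (ha : ∀ τ ∈ Icc c d, (p a).re ≤ (q τ).re) (hpM : ∀ s ∈ Icc a b, (p s).re ≤ M)
    (hqM : ∀ τ ∈ Icc c d, (q τ).re ≤ M) (hb : (p b).re = M) (hc : (q c).re = M)
    (hd : (q d).re = M) (h1 : (q c).im < (p b).im) (h2 : (p b).im < (q d).im) :
    ∃ s ∈ Icc a b, ∃ τ ∈ Icc c d, p s = q τ := by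
  by_contra! hne
  have hpi := Real.pi_pos
  set f : ℝ × ℝ → ℂ := fun x => p (projIcc a b hab x.1) - q (projIcc c d hcd x.2) with hf
  have hfc : Continuous f := by
    have e1 : Continuous fun x : ℝ × ℝ => (projIcc a b hab x.1 : ℝ) :=
      continuous_subtype_val.comp (continuous_projIcc.comp continuous_fst)
    have e2 : Continuous fun x : ℝ × ℝ => (projIcc c d hcd x.2 : ℝ) :=
      continuous_subtype_val.comp (continuous_projIcc.comp continuous_snd)
    exact (hp.comp e1).sub (hq.comp e2)
  have hf0 : ∀ x, f x ≠ 0 := fun x => sub_ne_zero.2 (hne _ (projIcc a b hab x.1).2 _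
    (projIcc c d hcd x.2).2)
  have fval : ∀ s ∈ Icc a b, ∀ τ ∈ Icc c d, f (s, τ) = p s - q τ := fun s hs τ hτ => by
    simp only [hf, projIcc_of_mem hab hs, projIcc_of_mem hcd hτ]
  obtain ⟨L, hL, hLf⟩ := exists_continuous_log hfc hf0
  have ma : a ∈ Icc a b := ⟨le_rfl, hab⟩
  have mb : b ∈ Icc a b := ⟨hab, le_rfl⟩
  have mc : c ∈ Icc c d := ⟨le_rfl, hcd⟩
  have md : d ∈ Icc c d := ⟨hcd, le_rfl⟩
  have re_eq : ∀ x, (f x).re = Real.exp (L x).re * Real.cos (L x).im := fun x => by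
    rw [← hLf, Complex.exp_re]
  have im_eq : ∀ x, (f x).im = Real.exp (L x).re * Real.sin (L x).im := fun x => by
    rw [← hLf, Complex.exp_im]
  set κ := (L (b, c)).im - Real.pi / 2 with hκ
  -- the argument at the corner `(b, c)` is `π / 2` modulo `2π`
  have hcos0 : Real.cos (L (b, c)).im = 0 := by
    have := re_eq (b, c)
    rw [fval b mb c mc, Complex.sub_re, hb, hc, sub_self] at this
    exact (mul_eq_zero.1 this.symm).resolve_left (Real.exp_pos _).ne'
  have hsin0 : 0 < Real.sin (L (b, c)).im := by
    have := im_eq (b, c)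
    rw [fval b mb c mc, Complex.sub_im] at this
    have h3 : 0 < Real.exp (L (b, c)).re * Real.sin (L (b, c)).im := by linarith
    exact pos_of_mul_pos_right h3 (Real.exp_pos _).le
  have hsin1 : Real.sin (L (b, c)).im = 1 := by
    have := Real.sin_sq_add_cos_sq (L (b, c)).im
    rw [hcos0] at this
    nlinarith
  have cosκ : Real.cos κ = 1 := by rw [hκ, Real.cos_sub_pi_div_two, hsin1]
  have sinκ : Real.sin κ = 0 := by rw [hκ, Real.sin_sub_pi_div_two, hcos0, neg_zero]
  have cos_shift : ∀ x, Real.cos ((L x).im - κ) = Real.cos (L x).im := fun x => by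
    rw [Real.cos_sub, cosκ, sinκ]; ring
  have sin_shift : ∀ x, Real.sin ((L x).im - κ) = Real.sin (L x).im := fun x => by
    rw [Real.sin_sub, cosκ, sinκ]; ring
  set A : ℝ × ℝ → ℝ := fun x => (L x).im - κ with hA
  have hAc : Continuous A := by fun_prop
  have cos_nonpos : ∀ x, (f x).re ≤ 0 → 0 ≤ Real.cos (A x - Real.pi) := fun x hx => by
    rw [Real.cos_sub_pi, hA]
    simp only
    rw [cos_shift]
    rw [re_eq] at hx
    have := nonpos_of_mul_nonpos_right hx (Real.exp_pos _)
    linarith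
  have cos_nonneg : ∀ x, 0 ≤ (f x).re → 0 ≤ Real.cos (A x) := fun x hx => by
    rw [hA]
    simp only
    rw [cos_shift]
    rw [re_eq] at hx
    exact nonneg_of_mul_nonneg_right hx (Real.exp_pos _)
  have A0 : A (b, c) = Real.pi / 2 := by simp only [hA, hκ]; ring
  have s1 : |A (a, c) - Real.pi| ≤ Real.pi / 2 := by
    refine abs_le_pi_div_two_of_cos_nonneg (g := fun s => A (s, c) - Real.pi) (x := b) (by fun_prop)
      (fun s hs => cos_nonpos _ ?_) ?_
    · rw [uIcc_of_ge hab] at hs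
      rw [fval s hs c mc, Complex.sub_re, hc]
      linarith [hpM s hs]
    · simp only [A0]
      rw [abs_le]; constructor <;> linarith
  have s2 : |A (a, d) - Real.pi| ≤ Real.pi / 2 := by
    refine abs_le_pi_div_two_of_cos_nonneg (g := fun τ => A (a, τ) - Real.pi) (x := c) (by fun_prop)
      (fun τ hτ => cos_nonpos _ ?_) s1
    rw [uIcc_of_le hcd] at hτ
    rw [fval a ma τ hτ, Complex.sub_re]
    linarith [ha τ hτ]
  have s3 : |A (b, d) - Real.pi| ≤ Real.pi / 2 := by
    refine abs_le_pi_div_two_of_cos_nonneg (g := fun s => A (s, d) - Real.pi) (x := a) (by fun_prop)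
      (fun s hs => cos_nonpos _ ?_) s2
    rw [uIcc_of_le hab] at hs
    rw [fval s hs d md, Complex.sub_re, hd]
    linarith [hpM s hs]
  have s4 : |A (b, d)| ≤ Real.pi / 2 := by
    refine abs_le_pi_div_two_of_cos_nonneg (g := fun τ => A (b, τ)) (x := c) (by fun_prop)
      (fun τ hτ => cos_nonneg _ ?_) ?_
    · rw [uIcc_of_le hcd] at hτ
      rw [fval b mb τ hτ, Complex.sub_re, hb]
      linarith [hqM τ hτ]
    · simp only [A0]
      rw [abs_of_pos (by positivity)]
  have hA1 : A (b, d) = Real.pi / 2 := by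
    rw [abs_le] at s3 s4
    linarith [s3.1, s4.2]
  have : Real.sin (L (b, d)).im = 1 := by
    rw [← sin_shift]
    change Real.sin (A (b, d)) = 1
    rw [hA1, Real.sin_pi_div_two]
  have h3 := im_eq (b, d)
  rw [this, fval b mb d md, Complex.sub_im] at h3
  linarith [Real.exp_pos (L (b, d)).re]

/-- A path coming from the left inside the half-plane `re ≤ M` and ending on its boundary meets
every path joining boundary points on both sides of its endpoint. -/
lemma exists_crossing {p q : ℝ → ℂ} (hp : Continuous p) (hq : Continuous q) {a b c d M : ℝ}
    (hab : a ≤ b) (hcd : c ≤ d)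
    (ha : ∀ τ ∈ Icc c d, (p a).re ≤ (q τ).re) (hpM : ∀ s ∈ Icc a b, (p s).re ≤ M)
    (hqM : ∀ τ ∈ Icc c d, (q τ).re ≤ M) (hb : (p b).re = M) (hc : (q c).re = M)
    (hd : (q d).re = M)
    (h : ((q c).im < (p b).im ∧ (p b).im < (q d).im) ∨ ((q d).im < (p b).im ∧ (p b).im < (q c).im)) :
    ∃ s ∈ Icc a b, ∃ τ ∈ Icc c d, p s = q τ := by
  rcases h with ⟨h1, h2⟩ | ⟨h1, h2⟩
  · exact exists_crossing_of_lt hp hq hab hcd ha hpM hqM hb hc hd h1 h2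
  · obtain ⟨s, hs, τ, hτ, e⟩ := exists_crossing_of_lt (p := fun s => conj (p s))
      (q := fun s => conj (q s)) (by fun_prop) (by fun_prop) hab hcd (by simpa using ha)
      (by simpa using hpM) (by simpa using hqM) (by simpa using hb) (by simpa using hc)
      (by simpa using hd) (by simpa using h2) (by simpa using h1)
    exact ⟨s, hs, τ, hτ, (starRingEnd ℂ).injective e⟩

lemma polar_add_two_pi (r t : ℝ) : polar r (t + 2 * Real.pi) = polar r t := by
  rw [polar, polar, show ((t + 2 * Real.pi : ℝ) : ℂ) * Complex.I = t * Complex.I + 2 * Real.pi * Complex.I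
    by push_cast; ring, Complex.exp_add, Complex.exp_two_pi_mul_I, mul_one]

lemma polar_add_pi (r t : ℝ) : polar r (t + Real.pi) = -polar r t := by
  rw [polar, polar, show ((t + Real.pi : ℝ) : ℂ) * Complex.I = t * Complex.I + Real.pi * Complex.I
    by push_cast; ring, Complex.exp_add, Complex.exp_pi_mul_I]
  ring

lemma add_mul_polar_mem {z0 : ℂ} {ρ : ℝ} (hρ : 0 ≤ ρ) {c : ℝ} (hc : |c| ≤ 1) (t : ℝ) :
    z0 + c * polar ρ t ∈ Metric.closedBall z0 ρ := by
  rw [Metric.mem_closedBall, dist_eq_norm, add_sub_cancel_left, norm_mul, norm_polar hρ,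
    Complex.norm_real, Real.norm_eq_abs]
  exact mul_le_of_le_one_left hρ hc

lemma continuous_comp_closedBall {u : ℂ → ℂ} {z0 : ℂ} {ρ : ℝ} (hρ : 0 ≤ ρ)
    (hu : ContinuousOn u (Metric.closedBall z0 ρ)) {c : ℝ × ℝ → ℝ} (hc : Continuous c)
    (hc1 : ∀ x, |c x| ≤ 1) :
    Continuous fun x : ℝ × ℝ => u (z0 + c x * polar ρ x.2) := by
  refine hu.comp_continuous ?_ fun x => add_mul_polar_mem hρ (hc1 x) _
  unfold polar
  fun_prop

/-- The winding number of an injective planar map around the image of the centre of a disk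
is odd. -/
lemma odd_winding {u : ℂ → ℂ} {z0 : ℂ} {ρ : ℝ} (hρ : 0 < ρ)
    (hu : ContinuousOn u (Metric.closedBall z0 ρ)) (hinj : InjOn u (Metric.closedBall z0 ρ))
    {M : ℝ → ℂ} (hM : Continuous M)
    (hMu : ∀ t, Complex.exp (M t) = u (z0 + polar ρ t) - u z0) :
    ∃ n : ℤ, Odd n ∧ ∀ t, M (t + 2 * Real.pi) = M t + n * (2 * Real.pi * Complex.I) := by
  set σ : ℝ × ℝ → ℝ := fun x => projIcc (0 : ℝ) 1 zero_le_one x.1 with hσ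
  have hσc : Continuous σ := continuous_subtype_val.comp (continuous_projIcc.comp continuous_fst)
  have hσ0 : ∀ x, 0 ≤ σ x := fun x => (projIcc (0 : ℝ) 1 zero_le_one x.1).2.1
  have hσ1 : ∀ x, σ x ≤ 1 := fun x => (projIcc (0 : ℝ) 1 zero_le_one x.1).2.2
  have hσp : ∀ x, 0 < 1 + σ x := fun x => by linarith [hσ0 x]
  -- Borsuk's homotopy: the pair (circle point, centre) is slid to an antipodal pair. Since `c1 - c2
  -- = 1`, the two points stay distinct, and injectivity keeps `H` away from `0`.
  set c1 : ℝ × ℝ → ℝ := fun x => 1 / (1 + σ x) with hc1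
  set c2 : ℝ × ℝ → ℝ := fun x => -σ x / (1 + σ x) with hc2
  have c1c : Continuous c1 := continuous_const.div (by fun_prop) fun x => (hσp x).ne'
  have c2c : Continuous c2 := Continuous.div (by fun_prop) (by fun_prop) fun x => (hσp x).ne'
  have c1le : ∀ x, |c1 x| ≤ 1 := fun x => by
    rw [hc1]; simp only; rw [abs_of_pos (by have := hσp x; positivity), div_le_one (hσp x)]
    linarith [hσ0 x]
  have c2le : ∀ x, |c2 x| ≤ 1 := fun x => by
    rw [hc2]; simp only; rw [abs_div, abs_neg, abs_of_nonneg (hσ0 x), abs_of_pos (hσp x),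
      div_le_one (hσp x)]
    linarith
  have c12 : ∀ x, c1 x - c2 x = 1 := fun x => by
    have := (hσp x).ne'
    simp only [hc1, hc2]; field_simp; ring
  set H : ℝ × ℝ → ℂ := fun x => u (z0 + c1 x * polar ρ x.2) - u (z0 + c2 x * polar ρ x.2) with hH
  have Hc : Continuous H :=
    (continuous_comp_closedBall hρ.le hu c1c c1le).sub (continuous_comp_closedBall hρ.le hu c2c c2le)
  have H0 : ∀ x, H x ≠ 0 := fun x hx => by
    have := hinj (add_mul_polar_mem hρ.le (c1le x) x.2) (add_mul_polar_mem hρ.le (c2le x) x.2)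
      (sub_eq_zero.1 hx)
    have h2 : ((c1 x - c2 x : ℝ) : ℂ) * polar ρ x.2 = 0 := by push_cast; linear_combination this
    rw [c12, Complex.ofReal_one, one_mul] at h2
    have := norm_polar hρ.le x.2
    rw [h2, norm_zero] at this
    exact hρ.ne this
  obtain ⟨N, hN, hNH⟩ := exists_continuous_log Hc H0
  have σeq : ∀ s t t', σ (s, t) = σ (s, t') := fun s t t' => rfl
  obtain ⟨n, hn⟩ := exists_int_of_exp_eq (A := fun x : ℝ × ℝ => N (x.1, x.2 + 2 * Real.pi)) (B := N)
    (by fun_prop) hN (fun x => by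
      rw [hNH, hNH]
      simp only [hH, hc1, hc2, polar_add_two_pi, σeq x.1 (x.2 + 2 * Real.pi) x.2])
  have σone : ∀ t, σ (1, t) = 1 := fun t => by simp [hσ]
  have σzero : ∀ t, σ (0, t) = 0 := fun t => by simp [hσ]
  -- For the antipodal pair a half turn changes the sign of `H`, adding `(2k + 1)πi` to its
  -- logarithm; a full turn adds twice that, so `n = 2k + 1`.
  obtain ⟨k, hk⟩ := exists_int_of_exp_eq (A := fun t : ℝ => N (1, t + Real.pi))
    (B := fun t => N (1, t) + Real.pi * Complex.I) (by fun_prop) (by fun_prop) (fun t => by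
      rw [Complex.exp_add, Complex.exp_pi_mul_I, hNH, hNH]
      simp only [hH, hc1, hc2, polar_add_pi, σone]
      push_cast
      ring_nf)
  obtain ⟨j, hj⟩ := exists_int_of_exp_eq (A := M) (B := fun t => N (0, t)) hM (by fun_prop) (fun t => by
    rw [hMu, hNH]
    simp [hH, hc1, hc2, σzero])
  refine ⟨n, ⟨k, ?_⟩, fun t => ?_⟩
  · have h1 := hk 0
    have h2 := hk (0 + Real.pi)
    have h3 := hn (1, 0)
    simp only at h1 h2 h3
    rw [h1, show (0 : ℝ) + Real.pi + Real.pi = 0 + 2 * Real.pi by ring, h3] at h2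
    have hpi : (2 * Real.pi * Complex.I : ℂ) ≠ 0 := Complex.two_pi_I_ne_zero
    have h4 : (n : ℂ) * (2 * Real.pi * Complex.I) = ((2 * k + 1 : ℤ) : ℂ) * (2 * Real.pi * Complex.I) := by
      push_cast; linear_combination h2
    exact_mod_cast mul_right_cancel₀ hpi h4
  · rw [hj, hj]
    have := hn (0, t)
    simp only at this
    rw [this]; ring

/-- Invariance of domain in the plane. The image of the circle winds an odd number of times about `u
z0`, and also about any `w` nearer to `u z0` than that image. If `w` were omitted, contracting the
circle would make this number zero. -/
lemma image_closedBall_mem_nhds {u : ℂ → ℂ} {z0 : ℂ} {ρ : ℝ} (hρ : 0 < ρ)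
    (hu : ContinuousOn u (Metric.closedBall z0 ρ)) (hinj : InjOn u (Metric.closedBall z0 ρ)) :
    u '' Metric.closedBall z0 ρ ∈ nhds (u z0) := by
  have hpi : (2 * Real.pi * Complex.I : ℂ) ≠ 0 := Complex.two_pi_I_ne_zero
  have z0mem : z0 ∈ Metric.closedBall z0 ρ := Metric.mem_closedBall_self hρ.le
  have pmem : ∀ t, z0 + polar ρ t ∈ Metric.closedBall z0 ρ := fun t => by
    simpa using add_mul_polar_mem (z0 := z0) hρ.le (c := 1) (by simp) t
  obtain ⟨zm, hzm, hmin⟩ := (isCompact_sphere z0 ρ).exists_isMinOn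
    (f := fun z => ‖u z - u z0‖) ⟨z0 + polar ρ 0, by simp [norm_polar hρ.le]⟩
    ((hu.mono Metric.sphere_subset_closedBall).sub continuousOn_const).norm
  have hmpos : 0 < ‖u zm - u z0‖ := by
    rw [norm_pos_iff, sub_ne_zero]
    intro h
    have := hinj (Metric.sphere_subset_closedBall hzm) z0mem h
    rw [this] at hzm
    simp at hzm
    exact hρ.ne hzm
  set m := ‖u zm - u z0‖ with hm
  have hmle : ∀ t, m ≤ ‖u (z0 + polar ρ t) - u z0‖ := fun t =>
    hmin (show z0 + polar ρ t ∈ Metric.sphere z0 ρ by simp [norm_polar hρ.le])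
  refine Filter.mem_of_superset (Metric.ball_mem_nhds (u z0) hmpos) fun w hw => ?_
  rw [Metric.mem_ball, dist_eq_norm] at hw
  by_contra hwn
  have hσ0 : ∀ s, 0 ≤ (projIcc (0 : ℝ) 1 zero_le_one s : ℝ) := fun s => (projIcc (0 : ℝ) 1 zero_le_one s).2.1
  have hσ1 : ∀ s, (projIcc (0 : ℝ) 1 zero_le_one s : ℝ) ≤ 1 := fun s => (projIcc (0 : ℝ) 1 zero_le_one s).2.2
  have hσc : Continuous fun x : ℝ × ℝ => (projIcc (0 : ℝ) 1 zero_le_one x.1 : ℝ) :=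
    continuous_subtype_val.comp (continuous_projIcc.comp continuous_fst)
  have hσle : ∀ s, |(projIcc (0 : ℝ) 1 zero_le_one s : ℝ)| ≤ 1 := fun s => by
    rw [abs_of_nonneg (hσ0 s)]; exact hσ1 s
  -- contraction of the circle to its centre
  obtain ⟨N, hN, hNG⟩ := exists_continuous_log
    (f := fun x => u (z0 + ((projIcc (0 : ℝ) 1 zero_le_one x.1 : ℝ) : ℂ) * polar ρ x.2) - w)
    ((continuous_comp_closedBall hρ.le hu hσc fun x => hσle x.1).sub continuous_const)
    (fun x hx => hwn ⟨_, add_mul_polar_mem hρ.le (hσle x.1) x.2, sub_eq_zero.1 hx⟩)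
  obtain ⟨k, hk⟩ := exists_int_of_exp_eq (A := fun x : ℝ × ℝ => N (x.1, x.2 + 2 * Real.pi)) (B := N)
    (by fun_prop) hN (fun x => by rw [hNG, hNG]; simp only [polar_add_two_pi])
  obtain ⟨j, hj⟩ := exists_int_of_exp_eq (A := fun t => N (0, t)) (B := fun _ => N (0, 0))
    (by fun_prop) (by fun_prop) (fun t => by rw [hNG, hNG]; simp)
  have hk0 : k = 0 := by
    have h1 := hk (0, 0)
    simp only at h1
    have h2 := hj (0 + 2 * Real.pi)
    have h3 := hj 0
    have : (k : ℂ) * (2 * Real.pi * Complex.I) = 0 := by linear_combination h2 - h1 - h3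
    exact_mod_cast (mul_eq_zero.1 this).resolve_right hpi
  -- translation of the base point
  have uc : Continuous fun x : ℝ × ℝ => u (z0 + polar ρ x.2) := by
    simpa using continuous_comp_closedBall hρ.le hu (c := fun _ => 1) (by fun_prop) (by simp)
  obtain ⟨N', hN', hNG'⟩ := exists_continuous_log
    (f := fun x => u (z0 + polar ρ x.2) - u z0 + ((projIcc (0 : ℝ) 1 zero_le_one x.1 : ℝ) : ℂ) * (u z0 - w))
    ((uc.sub continuous_const).add ((Complex.continuous_ofReal.comp hσc).mul continuous_const))
    (fun x hx => by
      have h1 := hmle x.2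
      rw [eq_neg_of_add_eq_zero_left hx, norm_neg, norm_mul, Complex.norm_real,
        Real.norm_of_nonneg (hσ0 x.1), norm_sub_rev] at h1
      nlinarith [hσ1 x.1, norm_nonneg (w - u z0), hσ0 x.1])
  obtain ⟨k', hk'⟩ := exists_int_of_exp_eq (A := fun x : ℝ × ℝ => N' (x.1, x.2 + 2 * Real.pi)) (B := N')
    (by fun_prop) hN' (fun x => by rw [hNG', hNG']; simp only [polar_add_two_pi])
  obtain ⟨n, hodd, hn⟩ := odd_winding hρ hu hinj (M := fun t => N' (0, t)) (by fun_prop)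
    (fun t => by rw [hNG']; simp)
  obtain ⟨i, hi⟩ := exists_int_of_exp_eq (A := fun t => N' (1, t)) (B := fun t => N (1, t))
    (by fun_prop) (by fun_prop) (fun t => by rw [hNG', hNG]; simp)
  have h1 := hk' (0, 0)
  have h2 := hk' (1, 0)
  have h3 := hn 0
  have h4 := hk (1, 0)
  simp only at h1 h2 h3 h4
  rw [h1] at h3
  rw [hi, hi 0, h4, hk0] at h2
  have e1 : (k' : ℂ) * (2 * Real.pi * Complex.I) = (n : ℂ) * (2 * Real.pi * Complex.I) := by
    linear_combination h3
  have e2 : (k' : ℂ) * (2 * Real.pi * Complex.I) = 0 := by linear_combination -h2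
  rw [e1] at e2
  have : n = 0 := by exact_mod_cast (mul_eq_zero.1 e2).resolve_right hpi
  rw [this] at hodd
  exact absurd hodd (by decide)

/-- A continuous bijection of the disk onto itself is proper. -/
lemma exists_lt_norm_of_bijOn {u : ℂ → ℂ} (hu : ContinuousOn u disk) (hb : BijOn u disk disk) {R : ℝ}
    (hR : R < 1) : ∃ ρ : ℝ, ρ < 1 ∧ ∀ z, ρ < ‖z‖ → ‖z‖ < 1 → R < ‖u z‖ := by
  -- Images of smaller concentric disks are open and exhaust the disk, so one of them contains the
  -- closed ball of radius `R`; by injectivity no point outside that smaller disk is mapped into the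
  -- ball.
  have hopen : ∀ ρ ≤ (1 : ℝ), IsOpen (u '' Metric.ball 0 ρ) := fun ρ hρ => by
    rw [isOpen_iff_mem_nhds]
    rintro _ ⟨z, hz, rfl⟩
    obtain ⟨ε, hε, hball⟩ := Metric.nhds_basis_closedBall.mem_iff.1 (Metric.isOpen_ball.mem_nhds hz)
    have hsub : Metric.closedBall z ε ⊆ disk := hball.trans (Metric.ball_subset_ball hρ)
    exact Filter.mem_of_superset (image_closedBall_mem_nhds hε (hu.mono hsub) (hb.injOn.mono hsub))
      (image_mono hball)
  have hcov : Metric.closedBall (0 : ℂ) R ⊆ ⋃ n : ℕ, u '' Metric.ball 0 (1 - 1 / ((n : ℝ) + 1)) := by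
    intro w hw
    have hw' : w ∈ disk := mem_disk.2 (lt_of_le_of_lt (by simpa using hw) hR)
    obtain ⟨z, hz, rfl⟩ := hb.surjOn hw'
    obtain ⟨n, hn⟩ := exists_nat_one_div_lt (sub_pos.2 (mem_disk.1 hz))
    exact mem_iUnion.2 ⟨n, z, by rw [mem_ball_zero_iff]; linarith, rfl⟩
  obtain ⟨N, hN⟩ := (isCompact_closedBall (0 : ℂ) R).elim_directed_cover _
    (fun n => hopen _ (by have : (0 : ℝ) ≤ 1 / ((n : ℝ) + 1) := by positivity
                          linarith)) hcov
    (directed_of_isDirected_le fun i j hij => image_mono (Metric.ball_subset_ball (by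
      have : (1 : ℝ) / ((j : ℝ) + 1) ≤ 1 / ((i : ℝ) + 1) := by gcongr
      linarith)))
  refine ⟨1 - 1 / ((N : ℝ) + 1), by have : (0 : ℝ) < 1 / ((N : ℝ) + 1) := by positivity
                                    linarith, fun z hz hz1 => ?_⟩
  by_contra! hle
  obtain ⟨z', hz', e⟩ := hN (show u z ∈ Metric.closedBall 0 R by simpa using hle)
  rw [mem_ball_zero_iff] at hz'
  have hz'1 : ‖z'‖ < 1 := hz'.trans (hz.trans hz1)
  have := hb.injOn (mem_disk.2 hz'1) (mem_disk.2 hz1) e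
  rw [this] at hz'
  exact hz.not_gt hz'

end KernelHarmonic
end

noncomputable section
namespace KernelHarmonic

/-! ### Interlaced curves, and extension of monotone boundary functions -/

open Set Filter Topology

/-- `w0 + e^w` is a convex combination of `w0` and `w0 + e^(w+l)`. Hence a curve continued
horizontally to the right never re-enters the region `‖w0 + e^w‖ ≤ ρ`. -/
lemma lt_norm_add_exp_add {w0 w : ℂ} {ρ l : ℝ} (h0 : ‖w0‖ ≤ ρ) (hw : ρ < ‖w0 + Complex.exp w‖)
    (hl : 0 ≤ l) : ρ < ‖w0 + Complex.exp (w + l)‖ := by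
  by_contra! h
  have hm : 0 < Real.exp l := Real.exp_pos l
  have hm1 : (Real.exp l)⁻¹ ≤ 1 := inv_le_one_of_one_le₀ (Real.one_le_exp hl)
  have e : w0 + Complex.exp w = ((Real.exp l)⁻¹ : ℝ) * (w0 + Complex.exp (w + l))
      + ((1 - (Real.exp l)⁻¹ : ℝ) : ℂ) * w0 := by
    have : (Complex.exp l) ≠ 0 := Complex.exp_ne_zero _
    rw [Complex.exp_add]
    push_cast
    field_simp
    ring
  have h1 : ‖w0 + Complex.exp w‖ ≤ (Real.exp l)⁻¹ * ρ + (1 - (Real.exp l)⁻¹) * ρ := by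
    rw [e]
    refine (norm_add_le _ _).trans (add_le_add ?_ ?_)
    · rw [norm_mul, Complex.norm_real, Real.norm_of_nonneg (by positivity)]
      gcongr
    · rw [norm_mul, Complex.norm_real, Real.norm_of_nonneg (by linarith)]
      exact mul_le_mul_of_nonneg_left h0 (by linarith)
  linarith

lemma re_lt_of_norm_add_exp_lt {w0 w : ℂ} (h0 : ‖w0‖ < 1) (hw : ‖w0 + Complex.exp w‖ < 1) :
    w.re < Real.log 2 := by
  rw [Real.lt_log_iff_exp_lt two_pos, ← Complex.norm_exp]
  have := norm_sub_le (w0 + Complex.exp w) w0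
  rw [add_sub_cancel_left] at this
  linarith

/-- Two families of curves that escape to the boundary of a simply connected region in an
interlaced order have a common point. -/
lemma exists_eq_of_interlaced {L : ℝ × ℝ → ℂ} (hL : Continuous L) {w0 : ℂ} (h0 : ‖w0‖ < 1)
    (hlt : ∀ x, ‖w0 + Complex.exp (L x)‖ < 1)
    (hbot : ∀ B : ℝ, ∃ A : ℝ, ∀ x ≤ A, ∀ t, (L (x, t)).re ≤ B)
    (htop : ∀ ρ < (1 : ℝ), ∃ A : ℝ, ∀ x ≥ A, ∀ t, ρ < ‖w0 + Complex.exp (L (x, t))‖)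
    (hcpt : ∀ A : ℝ, ∃ ρ < (1 : ℝ), ∀ x ≤ A, ∀ t, ‖w0 + Complex.exp (L (x, t))‖ ≤ ρ)
    {t1 t2 t3 : ℝ} (ht : t2 ≤ t3) {n : ℤ} {R0 β γ : ℝ}
    (h1 : ∀ x ≥ R0, β < (L (x, t1)).im + n * (2 * Real.pi) ∧
      (L (x, t1)).im + n * (2 * Real.pi) < γ)
    (h23 : (∀ x ≥ R0, (L (x, t2)).im < β ∧ γ < (L (x, t3)).im) ∨
      (∀ x ≥ R0, (L (x, t3)).im < β ∧ γ < (L (x, t2)).im)) :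
    ∃ x x' : ℝ, ∃ t ∈ Icc t2 t3, L (x, t1) + n * (2 * Real.pi * Complex.I) = L (x', t) := by
  have hre : ∀ x, (L x).re < Real.log 2 := fun x => re_lt_of_norm_add_exp_lt h0 (hlt x)
  set M := Real.log 2 with hM
  obtain ⟨ρ1, hρ1, hρle⟩ := hcpt R0
  set ρ := max ρ1 ‖w0‖ with hρ
  obtain ⟨A1, hA1⟩ := htop ρ (max_lt hρ1 h0)
  set R := max A1 R0 with hR
  have hRtop : ∀ t, ρ < ‖w0 + Complex.exp (L (R, t))‖ := fun t => hA1 R (le_max_left _ _) t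
  have hR0 : R0 ≤ R := le_max_right _ _
  have hρle' : ∀ x ≤ R0, ∀ t, ‖w0 + Complex.exp (L (x, t))‖ ≤ ρ := fun x hx t =>
    (hρle x hx t).trans (le_max_left _ _)
  have hw0ρ : ‖w0‖ ≤ ρ := le_max_right _ _
  -- The translated ray `t1`, cut at `x = R` and continued horizontally up to the line `re = log 2`.
  set p : ℝ → ℂ := fun s => L (min s R, t1) + (max (s - R) 0 : ℝ) + n * (2 * Real.pi * Complex.I)
    with hp
  set T : ℝ → ℝ := fun τ => projIcc t2 t3 ht τ with hT
  -- This path comes in along the ray `t2`, crosses to `t3` at `x = R0`, and leaves along the ray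
  -- `t3`, with the same horizontal continuations. `T` clamps to `[t2, t3]`, and `|τ - T τ|` is the
  -- distance from the middle arc.
  set q : ℝ → ℂ := fun τ => L (R0 + min |τ - T τ| (R - R0), T τ) +
    (max (|τ - T τ| - (R - R0)) 0 : ℝ) with hq
  have hTc : Continuous T := continuous_subtype_val.comp continuous_projIcc
  have hpc : Continuous p := by fun_prop
  have hqc : Continuous q := by fun_prop
  set b := R + (M - (L (R, t1)).re) with hb
  set c := t2 - (R - R0) - (M - (L (R, t2)).re) with hc
  set d := t3 + (R - R0) + (M - (L (R, t3)).re) with hd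
  have hbR : R < b := by linarith [hre (R, t1)]
  have hct : c < t2 - (R - R0) := by linarith [hre (R, t2)]
  have hdt : t3 + (R - R0) < d := by linarith [hre (R, t3)]
  have hTleft : ∀ τ ≤ t2, T τ = t2 := fun τ h => by simp [hT, projIcc_of_le_left ht h]
  have hTright : ∀ τ ≥ t3, T τ = t3 := fun τ h => by simp [hT, projIcc_of_right_le ht h]
  have hTmid : ∀ τ ∈ Icc t2 t3, T τ = τ := fun τ h => by simp [hT, projIcc_of_mem ht h]
  obtain ⟨τ0, -, hτ0⟩ := (isCompact_Icc (a := c) (b := d)).exists_isMinOn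
    (f := fun τ => (q τ).re) ⟨c, le_rfl, by linarith⟩ (by fun_prop)
  obtain ⟨A, hA⟩ := hbot (q τ0).re
  set a := min A R with ha
  have hpim : ∀ s, (p s).im = (L (min s R, t1)).im + n * (2 * Real.pi) := fun s => by
    simp [hp]
  have hpre : ∀ s, (p s).re = (L (min s R, t1)).re + max (s - R) 0 := fun s => by
    simp [hp]
  have hqim : ∀ s, (q s).im = (L (R0 + min |s - T s| (R - R0), T s)).im := fun s => by
    simp [hq]
  have hqre : ∀ s, (q s).re = (L (R0 + min |s - T s| (R - R0), T s)).re
      + max (|s - T s| - (R - R0)) 0 := fun s => by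
    simp [hq]
  have hexp : ∀ s : ℝ, Complex.exp (p s) =
      Complex.exp (L (min s R, t1) + (max (s - R) 0 : ℝ)) := fun s => by
    simp only [hp]; rw [Complex.exp_add _ (n * (2 * Real.pi * Complex.I)),
      Complex.exp_int_mul_two_pi_mul_I, mul_one]
  -- Off its middle arc `q` avoids the strip `β < im < γ`, which contains `p` from `x = R0` onwards.
  have hnot : ∀ τ, τ ∉ Icc t2 t3 → ¬ (β < (q τ).im ∧ (q τ).im < γ) := by
    rintro τ hτ ⟨e1, e2⟩
    rw [hqim] at e1 e2
    have hx : R0 ≤ R0 + min |τ - T τ| (R - R0) := by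
      have : 0 ≤ min |τ - T τ| (R - R0) := le_min (abs_nonneg _) (by linarith)
      linarith
    rcases lt_or_ge τ t2 with h | h
    · rw [hTleft τ h.le] at e1 e2 hx
      rcases h23 with h23 | h23 <;> have := h23 _ hx <;> linarith
    · have h' : t3 < τ := by by_contra! h'; exact hτ ⟨h, h'⟩
      rw [hTright τ h'.le] at e1 e2 hx
      rcases h23 with h23 | h23 <;> have := h23 _ hx <;> linarith
  have hqc0 : |c - T c| = (R - R0) + (M - (L (R, t2)).re) := by
    rw [hTleft c (by linarith), abs_sub_comm, abs_of_nonneg (by linarith)]; ring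
  have hqd0 : |d - T d| = (R - R0) + (M - (L (R, t3)).re) := by
    rw [hTright d (by linarith), abs_of_nonneg (by linarith)]; ring
  have hqcR : R0 + min |c - T c| (R - R0) = R := by
    rw [hqc0, min_eq_right (by linarith [hre (R, t2)])]; ring
  have hqdR : R0 + min |d - T d| (R - R0) = R := by
    rw [hqd0, min_eq_right (by linarith [hre (R, t3)])]; ring
  have hbmin : min b R = R := min_eq_right hbR.le
  obtain ⟨s, hs, τ, hτ, heq⟩ := exists_crossing hpc hqc (a := a) (b := b) (c := c) (d := d)
    (M := M) ((min_le_right _ _).trans hbR.le) (by linarith)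
    (fun τ hτ => by
      have h2 : (q τ0).re ≤ (q τ).re := hτ0 hτ
      refine le_trans ?_ h2
      rw [hpre, min_eq_left (min_le_right _ _), max_eq_right (by linarith [min_le_right A R]),
        add_zero]
      exact hA _ (min_le_left _ _) _)
    (fun s hs => by
      rw [hpre]
      rcases le_total s R with h | h
      · rw [max_eq_right (by linarith)]; linarith [hre (min s R, t1)]
      · rw [max_eq_left (by linarith), min_eq_right h]; linarith [hs.2])
    (fun τ hτ => by
      rw [hqre]
      rcases le_total |τ - T τ| (R - R0) with h | h
      · rw [max_eq_right (by linarith)]; linarith [hre (R0 + min |τ - T τ| (R - R0), T τ)]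
      · rw [max_eq_left (by linarith), min_eq_right h, add_sub_cancel]
        rcases lt_or_ge τ t2 with h2 | h2
        · rw [hTleft τ h2.le, abs_sub_comm, abs_of_nonneg (by linarith)]
          linarith [hτ.1]
        · rcases lt_or_ge t3 τ with h3 | h3
          · rw [hTright τ h3.le, abs_of_nonneg (by linarith)]
            linarith [hτ.2]
          · rw [hTmid τ ⟨h2, h3⟩, sub_self, abs_zero]
            linarith [hre (R, τ)])
    (by rw [hpre, hbmin, max_eq_left (by linarith)]; linarith)
    (by rw [hqre, hqcR, hqc0, hTleft c (by linarith), max_eq_left (by linarith [hre (R, t2)])]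
        ring)
    (by rw [hqre, hqdR, hqd0, hTright d (by linarith), max_eq_left (by linarith [hre (R, t3)])]
        ring)
    (by
      rw [hpim, hqim, hqim, hbmin, hqcR, hqdR, hTleft c (by linarith), hTright d (by linarith)]
      have e1 := h1 R hR0
      rcases h23 with h23 | h23
      · have e2 := h23 R hR0
        left; constructor <;> linarith
      · have e2 := h23 R hR0
        right; constructor <;> linarith)
  -- A crossing on the continuation of `p` lies in the strip, hence on the middle arc of `q`; but
  -- there the norm is at most `ρ`, and on the continuation it exceeds `ρ`.
  have hsR : s ≤ R := by
    by_contra! hs'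
    have e1 := h1 R hR0
    have e2 : β < (p s).im ∧ (p s).im < γ := by rw [hpim, min_eq_right hs'.le]; exact e1
    have e3 : τ ∈ Icc t2 t3 := by
      by_contra h
      rw [heq] at e2
      exact hnot τ h e2
    have e4 : ρ < ‖w0 + Complex.exp (p s)‖ := by
      rw [hexp, min_eq_right hs'.le]
      exact lt_norm_add_exp_add hw0ρ (hRtop t1) (le_max_right _ _)
    have e5 : q τ = L (R0, τ) := by
      simp only [hq]
      rw [hTmid τ e3, sub_self, abs_zero, min_eq_left (by linarith), max_eq_right (by linarith)]
      simp
    rw [heq, e5] at e4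
    exact e4.not_ge (hρle' R0 le_rfl τ)
  have hp' : p s = L (s, t1) + n * (2 * Real.pi * Complex.I) := by
    simp only [hp]
    rw [min_eq_left hsR, max_eq_right (by linarith)]
    simp
  -- On a continuation of `q` the norm exceeds `ρ`, which forces `s > R0` and puts the point in the
  -- strip that `q` avoids there.
  have hτR : |τ - T τ| ≤ R - R0 := by
    by_contra! hτ'
    have e3 : τ ∉ Icc t2 t3 := fun h => by
      rw [hTmid τ h, sub_self, abs_zero] at hτ'
      linarith
    have e4 : ρ < ‖w0 + Complex.exp (q τ)‖ := by
      simp only [hq]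
      rw [min_eq_right hτ'.le, add_sub_cancel]
      exact lt_norm_add_exp_add hw0ρ (hRtop _) (le_max_right _ _)
    rw [← heq, hexp, min_eq_left hsR, max_eq_right (by linarith), Complex.ofReal_zero,
      add_zero] at e4
    rcases le_total s R0 with h | h
    · exact e4.not_ge (hρle' s h t1)
    · have e5 := h1 s h
      refine hnot τ e3 ?_
      rw [← heq, hpim, min_eq_left hsR]
      exact e5
  refine ⟨s, R0 + |τ - T τ|, T τ, (projIcc t2 t3 ht τ).2, ?_⟩
  rw [← hp', heq]
  simp only [hq]
  rw [min_eq_left hτR, max_eq_right (by linarith)]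
  simp

/-- Eventually `exp L / v` is in the slit plane; subtracting its principal logarithm from `L` leaves
a continuous logarithm of the constant `v`, hence a constant. -/
lemma exists_tendsto_of_tendsto_exp {L : ℝ → ℂ} (hL : Continuous L) {v : ℂ} (hv : v ≠ 0)
    (h : Tendsto (fun x => Complex.exp (L x)) atTop (𝓝 v)) : ∃ l, Tendsto L atTop (𝓝 l) := by
  have h1 : Tendsto (fun x => Complex.exp (L x) / v) atTop (𝓝 1) := by
    simpa [hv] using h.div_const v
  obtain ⟨x0, hx0⟩ := eventually_atTop.1
    (h1.eventually (Complex.isOpen_slitPlane.mem_nhds Complex.one_mem_slitPlane))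
  have h2 : Tendsto (fun x => Complex.log (Complex.exp (L x) / v)) atTop (𝓝 0) := by
    simpa using h1.clog Complex.one_mem_slitPlane
  set g : ℝ → ℂ := fun x => L (max x x0) - Complex.log (Complex.exp (L (max x x0)) / v) with hg
  have hgc : Continuous g := by
    refine (hL.comp (by fun_prop)).sub (Continuous.clog ?_ fun x => hx0 _ (le_max_right _ _))
    exact (Complex.continuous_exp.comp (hL.comp (by fun_prop))).div_const v
  have hge : ∀ x, Complex.exp (g x) = v := fun x => by
    rw [hg]
    simp only
    rw [Complex.exp_sub, Complex.exp_log (div_ne_zero (Complex.exp_ne_zero _) hv)]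
    field_simp [Complex.exp_ne_zero]
  obtain ⟨n, hn⟩ := exists_int_of_exp_eq hgc (continuous_const (y := g x0))
    (fun x => by rw [hge, hge])
  refine ⟨g x0 + n * (2 * Real.pi * Complex.I) + 0, Tendsto.congr' ?_
    ((tendsto_const_nhds (x := g x0 + n * (2 * Real.pi * Complex.I))).add h2)⟩
  filter_upwards [eventually_ge_atTop x0] with x hx
  rw [← hn x]
  simp only [hg, max_eq_left hx]
  ring

/-- The argument, seen from the centre, of the point of the unit circle lying in the direction `X`
from `w0`. -/
def visualAngle (w0 : ℂ) (X : ℝ) : ℝ :=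
  X + Real.arcsin (w0 * Complex.exp (-(X * Complex.I))).im

lemma norm_mul_exp_neg_ofReal (w0 : ℂ) (X : ℝ) : ‖w0 * Complex.exp (-(X * Complex.I))‖ = ‖w0‖ := by
  rw [norm_mul, ← neg_mul, ← Complex.ofReal_neg, Complex.norm_exp_ofReal_mul_I, mul_one]

lemma visualAngle_add_two_pi (w0 : ℂ) (X : ℝ) :
    visualAngle w0 (X + 2 * Real.pi) = visualAngle w0 X + 2 * Real.pi := by
  have : Complex.exp (-((X + 2 * Real.pi : ℝ) * Complex.I)) = Complex.exp (-(X * Complex.I)) := by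
    rw [← Complex.exp_periodic.sub_eq (-(X * Complex.I))]
    congr 1
    push_cast
    ring
  rw [visualAngle, visualAngle, this]
  ring

/-- The derivative is `1 - q / √(1 - p²)`, where `q` and `p` are the real and imaginary parts of `w0
e^{-iX}` and `p² + q² < 1`. -/
lemma monotone_visualAngle {w0 : ℂ} (h0 : ‖w0‖ < 1) : Monotone (visualAngle w0) := by
  set a := w0.re
  set b := w0.im
  have hs : ∀ X : ℝ, (w0 * Complex.exp (-(X * Complex.I))).im = b * Real.cos X - a * Real.sin X :=
    fun X => by
      simp [Complex.exp_re, Complex.exp_im, a, b]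
      ring
  have hab : a ^ 2 + b ^ 2 < 1 := by
    have h := Complex.sq_norm w0
    rw [Complex.normSq_apply] at h
    have : ‖w0‖ ^ 2 < 1 := by nlinarith [norm_nonneg w0]
    nlinarith
  have key : ∀ X : ℝ, (b * Real.sin X + a * Real.cos X) ^ 2 <
      1 - (b * Real.cos X - a * Real.sin X) ^ 2 := fun X => by
    have := Real.sin_sq_add_cos_sq X
    nlinarith [mul_self_nonneg (a * Real.sin X), congrArg (fun y => (a ^ 2 + b ^ 2) * y) this]
  have hd : ∀ X, HasDerivAt (visualAngle w0)
      (1 + 1 / √(1 - (b * Real.cos X - a * Real.sin X) ^ 2) *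
        (b * (-Real.sin X) - a * Real.cos X)) X := fun X => by
    have e : visualAngle w0 = fun X => X + Real.arcsin (b * Real.cos X - a * Real.sin X) := by
      funext X; rw [visualAngle, hs]
    rw [e]
    have hlt : (b * Real.cos X - a * Real.sin X) ^ 2 < 1 := by
      linarith [key X, sq_nonneg (b * Real.sin X + a * Real.cos X)]
    rw [sq_lt_one_iff_abs_lt_one, abs_lt] at hlt
    have h : HasDerivAt (fun X => b * Real.cos X - a * Real.sin X)
        (b * (-Real.sin X) - a * Real.cos X) X :=
      ((Real.hasDerivAt_cos X).const_mul b).sub ((Real.hasDerivAt_sin X).const_mul a)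
    have h' := HasDerivAt.comp X (Real.hasDerivAt_arcsin hlt.1.ne' hlt.2.ne) h
    exact (hasDerivAt_id X).add h'
  refine monotone_of_deriv_nonneg (fun X => (hd X).differentiableAt) fun X => ?_
  rw [(hd X).deriv]
  set S := √(1 - (b * Real.cos X - a * Real.sin X) ^ 2) with hS
  have h1 : |b * Real.sin X + a * Real.cos X| < S := Real.lt_sqrt_of_sq_lt (by
    rw [sq_abs]; exact key X)
  have hSpos : 0 < S := (abs_nonneg _).trans_lt h1
  have h2 := (abs_lt.1 h1).2
  have : 1 + 1 / S * (b * (-Real.sin X) - a * Real.cos X) =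
      (S - (b * Real.sin X + a * Real.cos X)) / S := by field_simp; ring
  rw [this]
  exact div_nonneg (by linarith) hSpos.le

/-- Rotated by `-X`, the point is `v + e` with `e > 0` real. It has modulus `1`, imaginary part
`v.im` and, as `|v| < 1`, nonnegative real part, so its angle is `arcsin v.im`. -/
lemma add_exp_eq_exp_visualAngle {w0 l : ℂ} (h0 : ‖w0‖ < 1) (h1 : ‖w0 + Complex.exp l‖ = 1) :
    w0 + Complex.exp l = Complex.exp (visualAngle w0 l.im * Complex.I) := by
  set X := l.im with hX
  set v := w0 * Complex.exp (-(X * Complex.I)) with hv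
  have hvn : ‖v‖ < 1 := by rw [hv, norm_mul_exp_neg_ofReal]; exact h0
  set e := Real.exp l.re with he
  have hepos : 0 < e := Real.exp_pos _
  have hl : Complex.exp l = e * Complex.exp (X * Complex.I) := by
    rw [he, Complex.ofReal_exp, ← Complex.exp_add, hX, Complex.re_add_im]
  have hfac : w0 + Complex.exp l = Complex.exp (X * Complex.I) * (v + e) := by
    rw [hl, hv, Complex.exp_neg]
    field_simp [Complex.exp_ne_zero]
  rw [hfac, norm_mul, Complex.norm_exp_ofReal_mul_I, one_mul] at h1
  have h2 : v.re ^ 2 + v.im ^ 2 < 1 := by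
    have h := Complex.sq_norm v
    rw [Complex.normSq_apply] at h
    nlinarith [norm_nonneg v]
  have h3 : (v.re + e) ^ 2 + v.im ^ 2 = 1 := by
    have h := Complex.sq_norm (v + e)
    rw [Complex.normSq_apply, h1] at h
    simp at h
    nlinarith
  have h4 : 0 ≤ v.re + e := by
    by_contra! h
    nlinarith
  have him : v.im ^ 2 ≤ 1 := by nlinarith [sq_nonneg (v.re + e)]
  have him' := abs_le.1 ((sq_le_one_iff_abs_le_one _).1 him)
  rw [hfac, visualAngle, Complex.ofReal_add, add_mul, Complex.exp_add]
  congr 1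
  rw [Complex.exp_mul_I, ← Complex.ofReal_cos, ← Complex.ofReal_sin, ← hv,
    Real.sin_arcsin him'.1 him'.2, Real.cos_arcsin]
  have h5 : √(1 - v.im ^ 2) = v.re + e := by
    rw [← h3, add_sub_cancel_right, Real.sqrt_sq h4]
  rw [h5]
  apply Complex.ext <;> simp

/-- Extend by the supremum over earlier points of `E`; invariance of `E` under `±2π` makes these
suprema finite and equivariant. -/
lemma exists_isMonotoneCircleLift {E : Set ℝ} (hne : E.Nonempty)
    (hadd : ∀ t ∈ E, t + 2 * Real.pi ∈ E) (hsub : ∀ t ∈ E, t - 2 * Real.pi ∈ E) {Y : ℝ → ℝ}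
    (hY : MonotoneOn Y E) (hper : ∀ t ∈ E, Y (t + 2 * Real.pi) = Y t + 2 * Real.pi) :
    ∃ θ, IsMonotoneCircleLift θ ∧ EqOn θ Y E := by
  have hpi := Real.two_pi_pos
  obtain ⟨t0, ht0⟩ := hne
  have haddn : ∀ n : ℕ, t0 + n * (2 * Real.pi) ∈ E := fun n => by
    induction n with
    | zero => simpa using ht0
    | succ n ih => have := hadd _ ih; push_cast; rwa [add_mul, one_mul, ← add_assoc]
  have hsubn : ∀ n : ℕ, t0 - n * (2 * Real.pi) ∈ E := fun n => by
    induction n with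
    | zero => simpa using ht0
    | succ n ih => have := hsub _ ih; push_cast; rwa [add_mul, one_mul, ← sub_sub]
  have hbelow : ∀ t, (Y '' (E ∩ Iic t)).Nonempty := fun t => by
    obtain ⟨n, hn⟩ := exists_nat_ge ((t0 - t) / (2 * Real.pi))
    rw [div_le_iff₀ hpi] at hn
    exact ⟨_, _, ⟨hsubn n, by simp only [mem_Iic]; linarith⟩, rfl⟩
  have habove : ∀ t, BddAbove (Y '' (E ∩ Iic t)) := fun t => by
    obtain ⟨n, hn⟩ := exists_nat_ge ((t - t0) / (2 * Real.pi))
    rw [div_le_iff₀ hpi] at hn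
    refine ⟨Y (t0 + n * (2 * Real.pi)), ?_⟩
    rintro _ ⟨s, ⟨hs, hst⟩, rfl⟩
    exact hY hs (haddn n) (le_trans hst (by linarith))
  refine ⟨fun t => sSup (Y '' (E ∩ Iic t)), ⟨fun s t hst => ?_, fun t => ?_⟩, fun t ht => ?_⟩
  · exact csSup_le_csSup (habove t) (hbelow s)
      (image_mono (inter_subset_inter_right _ (Iic_subset_Iic.2 hst)))
  · apply le_antisymm
    · refine csSup_le (hbelow _) ?_
      rintro _ ⟨s, ⟨hs, hst⟩, rfl⟩
      have h1 := hper _ (hsub s hs)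
      rw [sub_add_cancel] at h1
      rw [h1]
      have : Y (s - 2 * Real.pi) ≤ sSup (Y '' (E ∩ Iic t)) :=
        le_csSup (habove t) ⟨_, ⟨hsub s hs, by simp only [mem_Iic] at hst ⊢; linarith⟩, rfl⟩
      linarith
    · rw [← le_sub_iff_add_le]
      refine csSup_le (hbelow _) ?_
      rintro _ ⟨s, ⟨hs, hst⟩, rfl⟩
      rw [le_sub_iff_add_le, ← hper s hs]
      exact le_csSup (habove _) ⟨_, ⟨hadd s hs, by simp only [mem_Iic] at hst ⊢; linarith⟩, rfl⟩
  · refine IsGreatest.csSup_eq ⟨⟨t, ⟨ht, mem_Iic.2 le_rfl⟩, rfl⟩, ?_⟩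
    rintro _ ⟨s, ⟨hs, hst⟩, rfl⟩
    exact hY hs ht hst

end KernelHarmonic
end

noncomputable section
namespace KernelHarmonic

/-! ### Boundary values of homeomorphisms of the disk -/

open Set Filter Topology

lemma polar_mem_disk {r : ℝ} (h0 : 0 ≤ r) (h1 : r < 1) (t : ℝ) : polar r t ∈ disk := by
  rwa [mem_disk, norm_polar h0]

/-- The lift of a bijection of the disk to logarithmic polar coordinates centred at the origin and
at its image. -/
structure IsLogLift (u : ℂ → ℂ) (σ : ℤ) (L : ℝ × ℝ → ℂ) : Prop where
  continuous : Continuous L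
  exp_eq : ∀ x t, u 0 + Complex.exp (L (x, t)) = u (polar (Real.sigmoid x) t)
  shift : ∀ x t, L (x, t + 2 * Real.pi) = L (x, t) + σ * (2 * Real.pi * Complex.I)
  odd : Odd σ

variable {u : ℂ → ℂ} {σ : ℤ} {L : ℝ × ℝ → ℂ}

lemma exists_isLogLift (hu : ContinuousOn u disk) (hb : BijOn u disk disk) :
    ∃ σ L, IsLogLift u σ L := by
  have hmem : ∀ x t, polar (Real.sigmoid x) t ∈ disk := fun x t =>
    polar_mem_disk (Real.sigmoid_nonneg x) (Real.sigmoid_lt_one x) t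
  have h0 : (0 : ℂ) ∈ disk := mem_disk.2 (by simp)
  have hc : Continuous fun p : ℝ × ℝ => u (polar (Real.sigmoid p.1) p.2) :=
    hu.comp_continuous (continuous_polar.comp (by fun_prop : Continuous fun p : ℝ × ℝ =>
      (Real.sigmoid p.1, p.2))) fun p => hmem p.1 p.2
  obtain ⟨L, hL, hLe⟩ := exists_continuous_log (hc.sub (continuous_const (y := u 0))) (fun p hp => by
    have := hb.injOn (hmem p.1 p.2) h0 (sub_eq_zero.1 hp)
    have h := norm_polar (Real.sigmoid_nonneg p.1) p.2
    rw [this, norm_zero] at h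
    exact (Real.sigmoid_pos p.1).ne h)
  have hsub : Metric.closedBall (0 : ℂ) (Real.sigmoid 0) ⊆ disk :=
    Metric.closedBall_subset_ball (Real.sigmoid_lt_one 0)
  obtain ⟨σ, hodd, hσ⟩ := odd_winding (Real.sigmoid_pos 0) (hu.mono hsub) (hb.injOn.mono hsub)
    (M := fun t => L (0, t)) (by fun_prop) (fun t => by rw [hLe, zero_add]; rfl)
  obtain ⟨k, hk⟩ := exists_int_of_exp_eq (A := fun p : ℝ × ℝ => L (p.1, p.2 + 2 * Real.pi))
    (by fun_prop) hL (fun p => by rw [hLe, hLe]; simp only [Pi.sub_apply, polar_add_two_pi])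
  have hkσ : (k : ℂ) * (2 * Real.pi * Complex.I) = σ * (2 * Real.pi * Complex.I) := by
    have h1 := hk (0, 0)
    have h2 := hσ 0
    simp only at h1 h2
    linear_combination h2 - h1
  refine ⟨σ, L, hL, fun x t => ?_, fun x t => ?_, hodd⟩
  · rw [hLe]; simp
  · rw [← hkσ]; exact hk (x, t)

namespace IsLogLift

lemma shift_int (h : IsLogLift u σ L) (x t : ℝ) (k : ℤ) :
    L (x, t + k * (2 * Real.pi)) = L (x, t) + k * σ * (2 * Real.pi * Complex.I) := by
  induction k with
  | zero => simp
  | succ k ih =>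
    have := h.shift x (t + k * (2 * Real.pi))
    push_cast at ih ⊢
    rw [show t + ((k : ℝ) + 1) * (2 * Real.pi) = t + k * (2 * Real.pi) + 2 * Real.pi by ring, this, ih]
    ring
  | pred k ih =>
    have := h.shift x (t + (-k - 1) * (2 * Real.pi))
    push_cast at ih ⊢
    rw [show t + (-(k : ℝ) - 1) * (2 * Real.pi) + 2 * Real.pi = t + -k * (2 * Real.pi) by ring, ih] at this
    linear_combination -this

lemma conj_comp (h : IsLogLift u σ L) :
    IsLogLift (fun z => conj (u z)) (-σ) (fun p => conj (L p)) := by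
  refine ⟨by have := h.continuous; fun_prop, fun x t => ?_, fun x t => ?_, h.odd.neg⟩
  · rw [← h.exp_eq, map_add, Complex.exp_conj]
  · rw [h.shift]; simp [map_ofNat]

/-- Injectivity of `u` identifies the two points of the disk: equal radii, angles differing by
`2πk`. The shift law then determines `n`. -/
lemma eq_of_eq (h : IsLogLift u σ L) (hb : BijOn u disk disk) {x x' t t' : ℝ} {n : ℤ}
    (e : L (x, t) + n * (2 * Real.pi * Complex.I) = L (x', t')) :
    ∃ k : ℤ, t' = t + k * (2 * Real.pi) ∧ n = k * σ := by
  have h1 := congrArg Complex.exp e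
  rw [Complex.exp_add, Complex.exp_int_mul_two_pi_mul_I, mul_one] at h1
  have h2 : u (polar (Real.sigmoid x) t) = u (polar (Real.sigmoid x') t') := by
    rw [← h.exp_eq, ← h.exp_eq, h1]
  have h3 := hb.injOn (polar_mem_disk (Real.sigmoid_nonneg x) (Real.sigmoid_lt_one x) t)
    (polar_mem_disk (Real.sigmoid_nonneg x') (Real.sigmoid_lt_one x') t') h2
  have h4 := congrArg norm h3
  rw [norm_polar (Real.sigmoid_nonneg x), norm_polar (Real.sigmoid_nonneg x'),
    Real.sigmoid_inj] at h4
  subst h4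
  have h5 := mul_left_cancel₀ (Complex.ofReal_ne_zero.2 (Real.sigmoid_pos x).ne') h3
  obtain ⟨k, hk⟩ := Complex.exp_eq_exp_iff_exists_int.1 h5.symm
  have h6 : (t' : ℂ) = ((t + k * (2 * Real.pi) : ℝ) : ℂ) := by
    apply mul_right_cancel₀ Complex.I_ne_zero
    rw [hk]; push_cast; ring
  have h7 : t' = t + k * (2 * Real.pi) := Complex.ofReal_injective h6
  refine ⟨k, h7, ?_⟩
  rw [h7, h.shift_int] at e
  have h8 : (n : ℂ) * (2 * Real.pi * Complex.I) = ((k * σ : ℤ) : ℂ) * (2 * Real.pi * Complex.I) := by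
    push_cast; linear_combination e
  exact_mod_cast mul_right_cancel₀ Complex.two_pi_I_ne_zero h8

lemma norm_zero_lt (hb : BijOn u disk disk) : ‖u 0‖ < 1 :=
  mem_disk.1 (hb.mapsTo (mem_disk.2 (by simp)))

/-- Interlaced limits force a crossing, which injectivity converts into an arithmetic condition on
the angles and on `n`. -/
lemma exists_eq_of_tendsto (h : IsLogLift u σ L) (hu : ContinuousOn u disk)
    (hb : BijOn u disk disk) {t1 t2 t3 : ℝ} (ht : t2 ≤ t3) {n : ℤ} {l1 l2 l3 : ℂ}
    (h1 : Tendsto (fun x => L (x, t1)) atTop (𝓝 l1))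
    (h2 : Tendsto (fun x => L (x, t2)) atTop (𝓝 l2))
    (h3 : Tendsto (fun x => L (x, t3)) atTop (𝓝 l3))
    (hi : (l2.im < l1.im + n * (2 * Real.pi) ∧ l1.im + n * (2 * Real.pi) < l3.im) ∨
      (l3.im < l1.im + n * (2 * Real.pi) ∧ l1.im + n * (2 * Real.pi) < l2.im)) :
    ∃ k : ℤ, t1 + k * (2 * Real.pi) ∈ Icc t2 t3 ∧ n = k * σ := by
  have i1 : Tendsto (fun x => (L (x, t1)).im + n * (2 * Real.pi)) atTop
      (𝓝 (l1.im + n * (2 * Real.pi))) := ((Complex.continuous_im.tendsto _).comp h1).add_const _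
  have i2 : Tendsto (fun x => (L (x, t2)).im) atTop (𝓝 l2.im) :=
    (Complex.continuous_im.tendsto _).comp h2
  have i3 : Tendsto (fun x => (L (x, t3)).im) atTop (𝓝 l3.im) :=
    (Complex.continuous_im.tendsto _).comp h3
  have key : ∃ R0 β γ : ℝ, (∀ x ≥ R0, β < (L (x, t1)).im + n * (2 * Real.pi) ∧
      (L (x, t1)).im + n * (2 * Real.pi) < γ) ∧ ((∀ x ≥ R0, (L (x, t2)).im < β ∧ γ < (L (x, t3)).im) ∨
      (∀ x ≥ R0, (L (x, t3)).im < β ∧ γ < (L (x, t2)).im)) := by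
    rcases hi with ⟨a, b⟩ | ⟨a, b⟩
    all_goals
      obtain ⟨β, hβ1, hβ2⟩ := exists_between a
      obtain ⟨γ, hγ1, hγ2⟩ := exists_between b
    · obtain ⟨R0, hR0⟩ := eventually_atTop.1 ((i1.eventually (Ioo_mem_nhds hβ2 hγ1)).and
        ((i2.eventually (gt_mem_nhds hβ1)).and (i3.eventually (lt_mem_nhds hγ2))))
      exact ⟨R0, β, γ, fun x hx => (hR0 x hx).1, Or.inl fun x hx => (hR0 x hx).2⟩
    · obtain ⟨R0, hR0⟩ := eventually_atTop.1 ((i1.eventually (Ioo_mem_nhds hβ2 hγ1)).and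
        ((i3.eventually (gt_mem_nhds hβ1)).and (i2.eventually (lt_mem_nhds hγ2))))
      exact ⟨R0, β, γ, fun x hx => (hR0 x hx).1, Or.inr fun x hx => (hR0 x hx).2⟩
  obtain ⟨R0, β, γ, k1, k2⟩ := key
  have h0 : (0 : ℂ) ∈ disk := mem_disk.2 (by simp)
  obtain ⟨x, x', t, htm, e⟩ := exists_eq_of_interlaced h.continuous (norm_zero_lt hb)
    (fun p => by
      rw [h.exp_eq]
      exact mem_disk.1 (hb.mapsTo (polar_mem_disk (Real.sigmoid_nonneg _) (Real.sigmoid_lt_one _) _)))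
    (fun B => by
      have hcont : ContinuousAt u 0 := hu.continuousAt (isOpen_disk.mem_nhds h0)
      obtain ⟨δ, hδ, hδu⟩ := Metric.continuousAt_iff.1 hcont (Real.exp B) (Real.exp_pos B)
      obtain ⟨A, hA⟩ := eventually_atBot.1 (Real.tendsto_sigmoid_atBot.eventually (gt_mem_nhds hδ))
      refine ⟨A, fun x hx t => ?_⟩
      have e1 := hδu (x := polar (Real.sigmoid x) t) (by
        rw [dist_zero_right, norm_polar (Real.sigmoid_nonneg x)]; exact hA x hx)
      rw [← h.exp_eq, dist_eq_norm, add_sub_cancel_left, Complex.norm_exp] at e1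
      exact (Real.exp_lt_exp.1 e1).le)
    (fun ρ hρ => by
      obtain ⟨R, hR, hRu⟩ := exists_lt_norm_of_bijOn hu hb hρ
      obtain ⟨A, hA⟩ := eventually_atTop.1 (Real.tendsto_sigmoid_atTop.eventually (lt_mem_nhds hR))
      refine ⟨A, fun x hx t => ?_⟩
      rw [h.exp_eq]
      apply hRu <;> rw [norm_polar (Real.sigmoid_nonneg x)]
      exacts [hA x hx, Real.sigmoid_lt_one x])
    (fun A => by
      have hsub : Metric.closedBall (0 : ℂ) (Real.sigmoid A) ⊆ disk :=
        Metric.closedBall_subset_ball (Real.sigmoid_lt_one A)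
      obtain ⟨z, hz, hmax⟩ := (isCompact_closedBall (0 : ℂ) (Real.sigmoid A)).exists_isMaxOn
        (f := fun z => ‖u z‖) ⟨0, Metric.mem_closedBall_self (Real.sigmoid_nonneg A)⟩
        (hu.mono hsub).norm
      refine ⟨‖u z‖, mem_disk.1 (hb.mapsTo (hsub hz)), fun x hx t => ?_⟩
      rw [h.exp_eq]
      apply hmax
      rw [mem_closedBall_zero_iff, norm_polar (Real.sigmoid_nonneg x)]
      exact Real.sigmoid_le hx)
    ht k1 k2
  obtain ⟨k, rfl, hk⟩ := h.eq_of_eq hb e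
  exact ⟨k, htm, hk⟩

lemma tendsto_shift (h : IsLogLift u σ L) {t : ℝ} {l : ℂ}
    (ht : Tendsto (fun x => L (x, t)) atTop (𝓝 l)) (k : ℤ) :
    Tendsto (fun x => L (x, t + k * (2 * Real.pi))) atTop
      (𝓝 (l + k * σ * (2 * Real.pi * Complex.I))) := by
  simp only [h.shift_int]
  exact ht.add_const _

/-- If `|σ| ≥ 2`, the ray `t` translated by `2πi` or `-2πi` ends strictly between the rays `t` and
`t + 2π`, whose limits are `2π|σ|` apart. The forced crossing gives `σ ∣ 1`. -/
lemma eq_one_or_eq_neg_one (h : IsLogLift u σ L) (hu : ContinuousOn u disk)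
    (hb : BijOn u disk disk) {t : ℝ} {l : ℂ} (ht : Tendsto (fun x => L (x, t)) atTop (𝓝 l)) :
    σ = 1 ∨ σ = -1 := by
  have hpi := Real.two_pi_pos
  have ht' := h.tendsto_shift ht 1
  have hle : t ≤ t + (1 : ℤ) * (2 * Real.pi) := by push_cast; linarith
  have him : (l + (1 : ℤ) * σ * (2 * Real.pi * Complex.I)).im = l.im + σ * (2 * Real.pi) := by simp
  have hne : σ ≠ 0 := fun h0 => by have := h.odd; rw [h0] at this; exact absurd this (by decide)
  by_contra! hcon
  rcases lt_or_gt_of_ne hne with hneg | hpos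
  · have h2 : σ ≤ -2 := by have := hcon.2; lia
    have h2' : (σ : ℝ) ≤ -2 := by exact_mod_cast h2
    obtain ⟨k, -, hk⟩ := h.exists_eq_of_tendsto hu hb hle (n := -1) ht ht ht' (Or.inr (by
      rw [him]; push_cast; constructor <;> nlinarith))
    have : σ ∣ 1 := ⟨-k, by linear_combination -hk⟩
    rcases Int.isUnit_iff.1 (isUnit_of_dvd_one this) with h | h
    exacts [hcon.1 h, hcon.2 h]
  · have h2 : 2 ≤ σ := by have := hcon.1; lia
    have h2' : (2 : ℝ) ≤ σ := by exact_mod_cast h2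
    obtain ⟨k, -, hk⟩ := h.exists_eq_of_tendsto hu hb hle (n := 1) ht ht ht' (Or.inl (by
      rw [him]; push_cast; constructor <;> nlinarith))
    have : σ ∣ 1 := ⟨k, by linear_combination hk⟩
    rcases Int.isUnit_iff.1 (isUnit_of_dvd_one this) with h | h
    exacts [hcon.1 h, hcon.2 h]

/-- If the order were reversed, the limit on the ray `t1` would lie between those on `t2` and on `t1
+ 2πN ≥ t2`. The crossing with `n = 0` has `k = 0`, so `t1 ≥ t2`. -/
lemma im_le_im (h : IsLogLift u 1 L) (hu : ContinuousOn u disk) (hb : BijOn u disk disk)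
    {t1 t2 : ℝ} (ht : t1 ≤ t2) {l1 l2 : ℂ} (h1 : Tendsto (fun x => L (x, t1)) atTop (𝓝 l1))
    (h2 : Tendsto (fun x => L (x, t2)) atTop (𝓝 l2)) : l1.im ≤ l2.im := by
  have hpi := Real.two_pi_pos
  by_contra! hlt
  rcases ht.eq_or_lt with rfl | ht
  · rw [tendsto_nhds_unique h1 h2] at hlt
    exact lt_irrefl _ hlt
  obtain ⟨N, hN⟩ := exists_nat_ge ((t2 - t1) / (2 * Real.pi))
  rw [div_le_iff₀ hpi] at hN
  have hN0 : (0 : ℝ) < N := pos_of_mul_pos_left (by linarith : 0 < (N : ℝ) * (2 * Real.pi)) hpi.le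
  have h3 := h.tendsto_shift h1 N
  obtain ⟨k, hk1, hk2⟩ := h.exists_eq_of_tendsto hu hb (n := 0) (t3 := t1 + (N : ℤ) * (2 * Real.pi))
    (by push_cast; linarith) h1 h2 h3 (Or.inl (by
      simp only [Int.cast_zero, zero_mul, add_zero]
      refine ⟨hlt, ?_⟩
      simp
      positivity))
  rw [mul_one] at hk2
  rw [← hk2] at hk1
  have := hk1.1
  simp at this
  linarith

/-- Properness puts the radial limit on the unit circle, hence away from `u 0`, so the logarithm
converges as well. -/
lemma exists_tendsto (h : IsLogLift u σ L) (hu : ContinuousOn u disk) (hb : BijOn u disk disk)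
    {t : ℝ} {w : ℂ} (hw : Tendsto (fun r => u (polar r t)) (𝓝[<] 1) (𝓝 w)) :
    ‖w‖ = 1 ∧ ∃ l, Tendsto (fun x => L (x, t)) atTop (𝓝 l) ∧ u 0 + Complex.exp l = w := by
  have hs : Tendsto Real.sigmoid atTop (𝓝[<] 1) := tendsto_nhdsWithin_iff.2
    ⟨Real.tendsto_sigmoid_atTop, Eventually.of_forall fun x => Real.sigmoid_lt_one x⟩
  have h1 : Tendsto (fun x => u 0 + Complex.exp (L (x, t))) atTop (𝓝 w) := by
    simp only [h.exp_eq]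
    exact hw.comp hs
  have hn : ‖w‖ = 1 := by
    apply le_antisymm
    · refine le_of_tendsto h1.norm (Eventually.of_forall fun x => ?_)
      rw [h.exp_eq]
      exact (mem_disk.1 (hb.mapsTo (polar_mem_disk (Real.sigmoid_nonneg _)
        (Real.sigmoid_lt_one _) _))).le
    · refine le_of_forall_lt fun R hR => ?_
      obtain ⟨R', hR1, hR2⟩ := exists_between hR
      obtain ⟨ρ, hρ, hρu⟩ := exists_lt_norm_of_bijOn hu hb hR2
      refine hR1.trans_le (ge_of_tendsto h1.norm ?_)
      filter_upwards [Real.tendsto_sigmoid_atTop.eventually (lt_mem_nhds hρ)] with x hx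
      rw [h.exp_eq]
      refine (hρu _ ?_ ?_).le <;> rw [norm_polar (Real.sigmoid_nonneg x)]
      exacts [hx, Real.sigmoid_lt_one x]
  have h2 : Tendsto (fun x => Complex.exp (L (x, t))) atTop (𝓝 (w - u 0)) := by
    simpa using h1.sub_const (u 0)
  have hne : w - u 0 ≠ 0 := fun h0 => by
    have := norm_zero_lt hb
    rw [← sub_eq_zero.1 h0, hn] at this
    exact lt_irrefl _ this
  obtain ⟨l, hl⟩ := exists_tendsto_of_tendsto_exp
    (h.continuous.comp (by fun_prop : Continuous fun x : ℝ => (x, t))) hne h2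
  refine ⟨hn, l, hl, ?_⟩
  have h3 := (Complex.continuous_exp.tendsto l).comp hl
  rw [tendsto_nhds_unique h3 h2]
  ring

/-- The limits of `L` record directions seen from `u 0`; `visualAngle` turns their monotonicity into
that of arguments about the origin. -/
lemma exists_isMonotoneCircleLift (h : IsLogLift u 1 L) (hu : ContinuousOn u disk)
    (hb : BijOn u disk disk)
    (hne : ∃ t w, Tendsto (fun r => u (polar r t)) (𝓝[<] 1) (𝓝 w)) :
    ∃ θ, IsMonotoneCircleLift θ ∧ ∀ t w, Tendsto (fun r => u (polar r t)) (𝓝[<] 1) (𝓝 w) →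
      w = unimodular θ t := by
  set E : Set ℝ := {t | ∃ l, Tendsto (fun x => L (x, t)) atTop (𝓝 l)} with hE
  set X : ℝ → ℝ := fun t => (limUnder atTop fun x => L (x, t)).im with hX
  have hXl : ∀ {t l}, Tendsto (fun x => L (x, t)) atTop (𝓝 l) → X t = l.im := fun ht => by
    simp only [hX]; rw [Tendsto.limUnder_eq ht]
  have hsh : ∀ k : ℤ, ∀ t ∈ E, t + k * (2 * Real.pi) ∈ E := fun k t ⟨l, hl⟩ => ⟨_, h.tendsto_shift hl k⟩
  obtain ⟨θ, hθ, hθE⟩ := KernelHarmonic.exists_isMonotoneCircleLift (E := E)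
    (Y := fun t => visualAngle (u 0) (X t))
    (by
      obtain ⟨t, w, hw⟩ := hne
      obtain ⟨-, l, hl, -⟩ := h.exists_tendsto hu hb hw
      exact ⟨t, l, hl⟩)
    (fun t ht => by simpa using hsh 1 t ht)
    (fun t ht => by simpa [sub_eq_add_neg] using hsh (-1) t ht)
    (fun t1 ⟨l1, h1⟩ t2 ⟨l2, h2⟩ hle => by
      apply monotone_visualAngle (norm_zero_lt hb)
      rw [hXl h1, hXl h2]
      exact h.im_le_im hu hb hle h1 h2)
    (fun t ⟨l, hl⟩ => by
      have h1 := h.tendsto_shift hl 1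
      simp only [Int.cast_one, one_mul] at h1
      rw [← visualAngle_add_two_pi, hXl hl, hXl h1]
      simp)
  refine ⟨θ, hθ, fun t w hw => ?_⟩
  obtain ⟨hn, l, hl, hlw⟩ := h.exists_tendsto hu hb hw
  rw [unimodular, hθE ⟨l, hl⟩]
  simp only
  rw [hXl hl, ← hlw]
  exact add_exp_eq_exp_visualAngle (norm_zero_lt hb) (by rw [hlw, hn])

end IsLogLift

/-- The radial boundary values of a homeomorphism of the disk are given by a monotone boundary
function or the complex conjugate of such. -/
lemma exists_isMonotoneCircleLift_of_bijOn (hu : ContinuousOn u disk) (hb : BijOn u disk disk)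
    (hne : ∃ t w, Tendsto (fun r => u (polar r t)) (𝓝[<] 1) (𝓝 w)) :
    ∃ θ, IsMonotoneCircleLift θ ∧
      ((∀ t w, Tendsto (fun r => u (polar r t)) (𝓝[<] 1) (𝓝 w) → w = unimodular θ t) ∨
      (∀ t w, Tendsto (fun r => u (polar r t)) (𝓝[<] 1) (𝓝 w) → conj w = unimodular θ t)) := by
  obtain ⟨σ, L, h⟩ := exists_isLogLift hu hb
  obtain ⟨t, w, hw⟩ := hne
  obtain ⟨-, l, hl, -⟩ := h.exists_tendsto hu hb hw
  have hconj : ∀ {t w}, Tendsto (fun r => u (polar r t)) (𝓝[<] 1) (𝓝 w) →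
      Tendsto (fun r => conj (u (polar r t))) (𝓝[<] 1) (𝓝 (conj w)) := fun hw =>
    (Complex.continuous_conj.tendsto _).comp hw
  rcases h.eq_one_or_eq_neg_one hu hb hl with rfl | rfl
  · obtain ⟨θ, hθ, hθu⟩ := h.exists_isMonotoneCircleLift hu hb ⟨t, w, hw⟩
    exact ⟨θ, hθ, Or.inl hθu⟩
  · have hbc : BijOn (fun z => conj (u z)) disk disk := by
      refine BijOn.comp (g := fun z : ℂ => conj z) (t := disk) ⟨fun z hz => ?_, fun z _ w _ e => ?_, fun z hz => ?_⟩ hb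
      · rw [mem_disk] at hz ⊢; simpa using hz
      · exact (starRingEnd ℂ).injective e
      · exact ⟨conj z, by rw [mem_disk] at hz ⊢; simpa using hz, by simp⟩
    obtain ⟨θ, hθ, hθu⟩ := IsLogLift.exists_isMonotoneCircleLift (u := fun z => conj (u z))
      h.conj_comp (by fun_prop) hbc ⟨t, conj w, hconj hw⟩
    exact ⟨θ, hθ, Or.inr fun t w hw => hθu t _ (hconj hw)⟩

end KernelHarmonic
end

noncomputable section
namespace KernelHarmonic

/-! ### Concentration of the kernel at the boundary -/

open MeasureTheory Set Filter Topology

/-- Used with exponent `β + 1` to write the kernel as a superposition of interval indicators, and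
with `β` to integrate the majorant. -/
lemma lintegral_Ioi_one_add_rpow {β : ℝ} (hβ : 0 < β) {a : ℝ} (ha : 0 ≤ a) :
    ∫⁻ y in Ioi a, ENNReal.ofReal (β * (1 + y) ^ (-(β + 1))) = ENNReal.ofReal ((1 + a) ^ (-β)) := by
  have hd : ∀ x ∈ Ici a, HasDerivAt (fun y : ℝ => -(1 + y) ^ (-β)) (β * (1 + x) ^ (-(β + 1))) x := by
    intro x hx
    have hx0 : 1 + x ≠ 0 := by have : a ≤ x := hx; linarith
    have h := ((((hasDerivAt_id x).const_add 1).rpow_const (p := -β) (Or.inl hx0))).neg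
    refine h.congr_deriv ?_
    rw [show -β - 1 = -(β + 1) by ring]
    simp
  have hpos : ∀ x ∈ Ioi a, 0 ≤ β * (1 + x) ^ (-(β + 1)) := fun x hx => by
    have : a < x := hx
    have : 0 ≤ 1 + x := by linarith
    positivity
  have hlim : Tendsto (fun y : ℝ => -(1 + y) ^ (-β)) atTop (𝓝 0) := by
    simpa using ((tendsto_rpow_neg_atTop hβ).comp (tendsto_atTop_add_const_left _ 1 tendsto_id)).neg
  rw [← ofReal_integral_eq_lintegral_ofReal (integrableOn_Ioi_deriv_of_nonneg' hd hpos hlim)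
    (by filter_upwards [ae_restrict_mem measurableSet_Ioi] with x hx using hpos x hx),
    integral_Ioi_of_hasDerivAt_of_nonneg' hd hpos hlim]
  simp

/-- The kernels `ε⁻¹ (1 + |s| / ε)^(-(β+1))` concentrate at `0` as `ε → 0`, in the sense of
Lebesgue points. -/
lemma tendsto_lintegral_mul_rpow {β : ℝ} (hβ : 0 < β) {G : ℝ → ℝ≥0∞} (hG : Measurable G)
    (hfin : ∫⁻ s, G s ≠ ⊤)
    (hA : Tendsto (fun h => (∫⁻ s in Ioo (-h) h, G s) / ENNReal.ofReal h) (𝓝[>] 0) (𝓝 0)) :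
    Tendsto (fun ε : ℝ => ∫⁻ s, G s * (ENNReal.ofReal ε⁻¹ *
      ENNReal.ofReal ((1 + |s| / ε) ^ (-(β + 1))))) (𝓝[>] 0) (𝓝 0) := by
  set A : ℝ → ℝ≥0∞ := fun h => ∫⁻ s in Ioo (-h) h, G s with hAdef
  have hAmono : Monotone A := fun h h' hh =>
    lintegral_mono_set (Ioo_subset_Ioo (neg_le_neg hh) hh)
  -- For small `h` the averages are below `1` by `hA`; for large `h` the total mass suffices.
  obtain ⟨C, hC, hAC⟩ : ∃ C : ℝ≥0∞, C ≠ ⊤ ∧ ∀ h > 0, A h ≤ C * ENNReal.ofReal h := by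
    obtain ⟨δ, hδ, hδA⟩ := mem_nhdsGT_iff_exists_Ioo_subset.1 (hA.eventually (gt_mem_nhds one_pos))
    have hδ0 : 0 < ENNReal.ofReal δ := ENNReal.ofReal_pos.2 hδ
    refine ⟨1 + (∫⁻ s, G s) / ENNReal.ofReal δ, ?_, fun h hh => ?_⟩
    · exact ENNReal.add_ne_top.2 ⟨by simp, ENNReal.div_ne_top hfin hδ0.ne'⟩
    · rcases lt_or_ge h δ with hlt | hge
      · have h1 : A h / ENNReal.ofReal h < 1 := hδA ⟨hh, hlt⟩
        have h2 := (ENNReal.div_le_iff (ENNReal.ofReal_pos.2 hh).ne' ENNReal.ofReal_ne_top).1 h1.le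
        exact h2.trans (by gcongr; exact le_self_add)
      · have h1 : A h ≤ ∫⁻ s, G s := setLIntegral_le_lintegral _ _
        calc A h ≤ (∫⁻ s, G s) / ENNReal.ofReal δ * ENNReal.ofReal δ := by
              rwa [ENNReal.div_mul_cancel hδ0.ne' ENNReal.ofReal_ne_top]
          _ ≤ _ := by gcongr; exact le_add_self
  -- Layer cake and Tonelli: only the averages `ε⁻¹ A (ε y)` remain, integrated against a fixed
  -- density in `y`.
  have key : ∀ ε : ℝ, 0 < ε → ∫⁻ s, G s * (ENNReal.ofReal ε⁻¹ *
      ENNReal.ofReal ((1 + |s| / ε) ^ (-(β + 1)))) =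
      ∫⁻ y in Ioi (0 : ℝ), ENNReal.ofReal ((β + 1) * (1 + y) ^ (-(β + 1 + 1))) *
        (ENNReal.ofReal ε⁻¹ * A (ε * y)) := by
    intro ε hε
    have hms : MeasurableSet {p : ℝ × ℝ | |p.1| < ε * p.2} :=
      (isOpen_lt (by fun_prop) (by fun_prop)).measurableSet
    have h1 : ∀ s, G s * (ENNReal.ofReal ε⁻¹ * ENNReal.ofReal ((1 + |s| / ε) ^ (-(β + 1)))) =
        ∫⁻ y in Ioi (0 : ℝ), {p : ℝ × ℝ | |p.1| < ε * p.2}.indicator (fun p => G p.1 *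
          (ENNReal.ofReal ε⁻¹ * ENNReal.ofReal ((β + 1) * (1 + p.2) ^ (-(β + 1 + 1))))) (s, y) := by
      intro s
      rw [← lintegral_Ioi_one_add_rpow (by linarith : 0 < β + 1) (by positivity : 0 ≤ |s| / ε)]
      have e : ∀ y, {p : ℝ × ℝ | |p.1| < ε * p.2}.indicator (fun p => G p.1 *
          (ENNReal.ofReal ε⁻¹ * ENNReal.ofReal ((β + 1) * (1 + p.2) ^ (-(β + 1 + 1))))) (s, y) =
          (Ioi (|s| / ε)).indicator (fun y => G s *
          (ENNReal.ofReal ε⁻¹ * ENNReal.ofReal ((β + 1) * (1 + y) ^ (-(β + 1 + 1))))) y := fun y => by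
        simp only [indicator, mem_ofPred_eq, mem_Ioi, div_lt_iff₀' hε]
      simp only [e]
      rw [setLIntegral_indicator measurableSet_Ioi, inter_eq_left.2 (Ioi_subset_Ioi (by positivity)),
        lintegral_const_mul _ (by fun_prop), lintegral_const_mul _ (by fun_prop)]
    simp only [h1]
    rw [lintegral_lintegral_swap]
    · refine setLIntegral_congr_fun measurableSet_Ioi fun y hy => ?_
      have e : ∀ s, {p : ℝ × ℝ | |p.1| < ε * p.2}.indicator (fun p => G p.1 *
          (ENNReal.ofReal ε⁻¹ * ENNReal.ofReal ((β + 1) * (1 + p.2) ^ (-(β + 1 + 1))))) (s, y) =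
          (Ioo (-(ε * y)) (ε * y)).indicator (fun s => G s *
          (ENNReal.ofReal ε⁻¹ * ENNReal.ofReal ((β + 1) * (1 + y) ^ (-(β + 1 + 1))))) s := fun s => by
        simp only [indicator, mem_ofPred_eq, mem_Ioo, abs_lt]
      simp only [e]
      rw [lintegral_indicator measurableSet_Ioo, lintegral_mul_const _ hG]
      simp only [hAdef]
      ring
    · refine (Measurable.indicator ?_ hms).aemeasurable
      fun_prop
  have hlim : Tendsto (fun ε : ℝ => ∫⁻ y in Ioi (0 : ℝ),
      ENNReal.ofReal ((β + 1) * (1 + y) ^ (-(β + 1 + 1))) * (ENNReal.ofReal ε⁻¹ * A (ε * y)))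
      (𝓝[>] 0) (𝓝 (∫⁻ _ in Ioi (0 : ℝ), 0)) := by
    refine tendsto_lintegral_filter_of_dominated_convergence
      (fun y => C * ENNReal.ofReal ((β + 1) / β) * ENNReal.ofReal (β * (1 + y) ^ (-(β + 1))))
      ?_ ?_ ?_ ?_
    · filter_upwards [self_mem_nhdsWithin] with ε hε
      have : Measurable fun y => A (ε * y) := hAmono.measurable.comp (by fun_prop)
      exact Measurable.mul (by fun_prop) (this.const_mul _)
    · filter_upwards [self_mem_nhdsWithin] with ε hε
      filter_upwards [ae_restrict_mem measurableSet_Ioi] with y hy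
      have hε : 0 < ε := hε
      have hy : 0 < y := hy
      have h1y : 0 < 1 + y := by linarith
      calc _ ≤ ENNReal.ofReal ((β + 1) * (1 + y) ^ (-(β + 1 + 1))) *
            (ENNReal.ofReal ε⁻¹ * (C * ENNReal.ofReal (ε * y))) := by
            gcongr
            exact hAC _ (by positivity)
        _ = C * ENNReal.ofReal ((β + 1) * (1 + y) ^ (-(β + 1 + 1)) * (ε⁻¹ * (ε * y))) := by
            rw [ENNReal.ofReal_mul (by positivity : 0 ≤ (β + 1) * (1 + y) ^ (-(β + 1 + 1))),
              ENNReal.ofReal_mul (by positivity : 0 ≤ ε⁻¹)]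
            ring
        _ ≤ C * ENNReal.ofReal ((β + 1) / β * (β * (1 + y) ^ (-(β + 1)))) := by
            gcongr C * ENNReal.ofReal ?_
            rw [inv_mul_cancel_left₀ hε.ne', show -(β + 1) = -(β + 1 + 1) + 1 by ring,
              Real.rpow_add_one h1y.ne', ← mul_assoc, div_mul_cancel₀ _ hβ.ne', ← mul_assoc]
            gcongr
            linarith
        _ = _ := by rw [ENNReal.ofReal_mul (by positivity), mul_assoc]
    · rw [lintegral_const_mul _ (by fun_prop), lintegral_Ioi_one_add_rpow hβ le_rfl]
      exact ENNReal.mul_ne_top (ENNReal.mul_ne_top hC ENNReal.ofReal_ne_top) ENNReal.ofReal_ne_top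
    · filter_upwards [ae_restrict_mem measurableSet_Ioi] with y hy
      have hy : 0 < y := hy
      have h1 : Tendsto (fun ε : ℝ => ε * y) (𝓝[>] 0) (𝓝[>] 0) := by
        refine tendsto_nhdsWithin_iff.2 ⟨?_, ?_⟩
        · have : Tendsto (fun ε : ℝ => ε * y) (𝓝 0) (𝓝 (0 * y)) :=
            (continuous_id.mul continuous_const).tendsto _
          rw [zero_mul] at this
          exact this.mono_left nhdsWithin_le_nhds
        · filter_upwards [self_mem_nhdsWithin] with ε hε using mul_pos hε hy
      have h2 := ENNReal.Tendsto.const_mul (a := ENNReal.ofReal ((β + 1) * (1 + y) ^ (-(β + 1 + 1)))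
        * ENNReal.ofReal y) (hA.comp h1)
        (Or.inr (ENNReal.mul_ne_top ENNReal.ofReal_ne_top ENNReal.ofReal_ne_top))
      rw [mul_zero] at h2
      refine h2.congr' ?_
      filter_upwards [self_mem_nhdsWithin] with ε hε
      have hε : 0 < ε := hε
      simp only [Function.comp_apply, hAdef]
      rw [ENNReal.ofReal_mul hε.le, mul_assoc, div_eq_mul_inv, ENNReal.mul_inv (by simp) (by simp),
        ENNReal.ofReal_inv_of_pos hε]
      congr 1
      have : ENNReal.ofReal y * (ENNReal.ofReal y)⁻¹ = 1 :=
        ENNReal.mul_inv_cancel (ENNReal.ofReal_pos.2 hy).ne' ENNReal.ofReal_ne_top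
      calc _ = (ENNReal.ofReal y * (ENNReal.ofReal y)⁻¹) * ((ENNReal.ofReal ε)⁻¹ *
            ∫⁻ s in Ioo (-(ε * y)) (ε * y), G s) := by ring
        _ = _ := by rw [this, one_mul]
  rw [lintegral_zero] at hlim
  refine hlim.congr' ?_
  filter_upwards [self_mem_nhdsWithin] with ε hε using (key ε hε).symm

/-- The norm on the right dominates `1 - r`, and also `|s| / π`, by comparison with the chord `|1 -
e^{is}| ≥ 2|s|/π`. -/
lemma one_sub_add_abs_le_mul_norm_one_sub_polar {r s : ℝ} (h0 : 0 ≤ r) (h1 : r ≤ 1) (hs : |s| ≤ Real.pi) :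
    1 - r + |s| ≤ (1 + Real.pi) * ‖1 - polar r s‖ := by
  have hpi := Real.pi_pos
  have e1 : 1 - r ≤ ‖1 - polar r s‖ := by
    have := norm_sub_norm_le (1 : ℂ) (polar r s)
    rwa [norm_one, norm_polar h0] at this
  have e2 : ‖(1 : ℂ) - polar 1 s‖ ≤ ‖1 - polar r s‖ + (1 - r) := by
    have h : (1 : ℂ) - polar 1 s = (1 - polar r s) - polar (1 - r) s := by
      simp only [polar]; push_cast; ring
    rw [h]
    refine (norm_sub_le _ _).trans ?_
    rw [norm_polar (by linarith)]
  have e3 : 2 / Real.pi * |s| ≤ ‖(1 : ℂ) - polar 1 s‖ := by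
    have h := Real.mul_abs_le_abs_sin (x := s / 2) (by rw [abs_div, abs_two]; linarith)
    have h' := Complex.norm_exp_I_mul_ofReal_sub_one s
    rw [norm_sub_rev, polar, Complex.ofReal_one, one_mul, mul_comm (s : ℂ), h', Real.norm_eq_abs, abs_mul,
      abs_two]
    rw [abs_div, abs_two] at h
    linarith
  have e4 : |s| ≤ Real.pi * ‖1 - polar r s‖ := by
    have : 2 / Real.pi * |s| ≤ 2 * ‖1 - polar r s‖ := by linarith
    rw [div_mul_eq_mul_div, div_le_iff₀ hpi] at this
    linarith
  linarith

lemma norm_poissonKernel (α : ℝ) {z : ℂ} (hz : ‖z‖ < 1) :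
    ‖poissonKernel α z‖ = (1 - ‖z‖ ^ 2) ^ (α + 1) / ‖1 - z‖ ^ (α + 2) := by
  have h1 : 0 < 1 - ‖z‖ ^ 2 := by linarith [sq_norm_lt_one hz]
  have h2 : ‖1 - conj z‖ = ‖1 - z‖ := by
    rw [← RCLike.norm_conj (1 - z)]; simp
  have h3 : ‖1 - z‖ ≠ 0 := norm_ne_zero_iff.2 (one_sub_ne_zero_of_norm_lt_one hz)
  have h4 : ‖1 - z‖ ^ (α + 2) = ‖1 - z‖ * ‖1 - z‖ ^ (α + 1) := by
    rw [show α + 2 = α + 1 + 1 by ring, Real.rpow_add_one h3, mul_comm]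
  rw [poissonKernel, norm_div, norm_mul, Complex.norm_cpow_real, Complex.norm_real,
    Real.norm_of_nonneg (by positivity), h2, h4]

lemma norm_poissonKernel_polar_le {α : ℝ} (hα : -1 < α) {r s : ℝ} (h0 : 0 ≤ r) (h1 : r < 1)
    (hs : |s| ≤ Real.pi) :
    ‖poissonKernel α (polar r s)‖ ≤ 2 ^ (α + 1) * (1 + Real.pi) ^ (α + 2) *
      ((1 - r)⁻¹ * (1 + |s| / (1 - r)) ^ (-(α + 2))) := by
  have hpi := Real.pi_pos
  have hε : 0 < 1 - r := by linarith
  have hα1 : 0 < α + 1 := by linarith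
  have hz : ‖polar r s‖ < 1 := by rwa [norm_polar h0]
  have hn : 0 < ‖1 - polar r s‖ := norm_pos_iff.2 (one_sub_ne_zero_of_norm_lt_one hz)
  rw [norm_poissonKernel α hz, norm_polar h0]
  have hle := one_sub_add_abs_le_mul_norm_one_sub_polar h0 h1.le hs
  have hsum : 0 < 1 - r + |s| := by positivity
  have e1 : (1 - r ^ 2) ^ (α + 1) ≤ 2 ^ (α + 1) * (1 - r) ^ (α + 1) := by
    rw [← Real.mul_rpow two_pos.le hε.le]
    exact Real.rpow_le_rpow (by nlinarith) (by nlinarith) hα1.le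
  have e2 : (‖1 - polar r s‖ ^ (α + 2))⁻¹ ≤ (1 + Real.pi) ^ (α + 2) * ((1 - r + |s|) ^ (α + 2))⁻¹ := by
    rw [← div_eq_mul_inv, inv_le_iff_one_le_mul₀ (by positivity), div_mul_eq_mul_div,
      one_le_div (by positivity), ← Real.mul_rpow (by positivity) hn.le]
    exact Real.rpow_le_rpow hsum.le hle (by linarith)
  have e3 : (1 - r)⁻¹ * (1 + |s| / (1 - r)) ^ (-(α + 2)) =
      (1 - r) ^ (α + 1) * ((1 - r + |s|) ^ (α + 2))⁻¹ := by
    rw [show 1 + |s| / (1 - r) = (1 - r + |s|) / (1 - r) by field_simp,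
      Real.rpow_neg (by positivity), Real.div_rpow hsum.le hε.le, inv_div,
      show α + 2 = α + 1 + 1 by ring, Real.rpow_add_one hε.ne']
    field_simp
  rw [e3, div_eq_mul_inv]
  calc _ ≤ (2 ^ (α + 1) * (1 - r) ^ (α + 1)) *
        ((1 + Real.pi) ^ (α + 2) * ((1 - r + |s|) ^ (α + 2))⁻¹) := by gcongr
    _ = _ := by ring

end KernelHarmonic
end

noncomputable section
namespace KernelHarmonic

/-! ### Radial limits at Lebesgue points -/

open MeasureTheory Set Filter Topology

/-- `t` is a Lebesgue point of `F`. -/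
def IsLebesguePoint (F : ℝ → ℂ) (t : ℝ) : Prop :=
  Tendsto (fun h => (∫⁻ s in Ioo (-h) h, ‖F (t + s) - F t‖ₑ) / ENNReal.ofReal h) (𝓝[>] 0) (𝓝 0)

lemma ae_isLebesguePoint {F : ℝ → ℂ} (hF : LocallyIntegrable F) : ∀ᵐ t, IsLebesguePoint F t := by
  filter_upwards [(IsUnifLocDoublingMeasure.vitaliFamily (volume : Measure ℝ)
    1).ae_tendsto_lintegral_enorm_sub_div hF] with t ht
  have h1 := ht.comp (IsUnifLocDoublingMeasure.tendsto_closedBall_filterAt (volume : Measure ℝ)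
    (K := 1) (x := t) (l := 𝓝[>] 0) (fun _ => t) (fun h : ℝ => h) tendsto_id (by
      filter_upwards [self_mem_nhdsWithin] with h hh
      rw [one_mul]
      exact Metric.mem_closedBall_self (le_of_lt hh)))
  have h2 := ENNReal.Tendsto.const_mul (a := 2) h1 (Or.inr (by simp))
  rw [mul_zero] at h2
  refine tendsto_of_tendsto_of_tendsto_of_le_of_le' tendsto_const_nhds h2
    (Eventually.of_forall fun _ => zero_le) ?_
  filter_upwards [self_mem_nhdsWithin] with h hh
  have hh : 0 < h := hh
  have e1 : ∫⁻ s in Ioo (-h) h, ‖F (t + s) - F t‖ₑ ≤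
      ∫⁻ y in Metric.closedBall t h, ‖F y - F t‖ₑ := by
    rw [← lintegral_indicator measurableSet_Ioo, ← lintegral_indicator measurableSet_closedBall,
      ← lintegral_add_left_eq_self ((Metric.closedBall t h).indicator fun y => ‖F y - F t‖ₑ) t]
    refine lintegral_mono fun s => ?_
    by_cases hs : s ∈ Ioo (-h) h
    · have hs' : t + s ∈ Metric.closedBall t h := by
        rw [Metric.mem_closedBall, Real.dist_eq, add_sub_cancel_left]
        exact abs_le.2 ⟨hs.1.le, hs.2.le⟩
      rw [indicator_of_mem hs, indicator_of_mem hs']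
    · rw [indicator_of_notMem hs]
      exact zero_le
  have e2 : volume (Metric.closedBall t h) = 2 * ENNReal.ofReal h := by
    rw [Real.volume_closedBall, ENNReal.ofReal_mul zero_le_two, ENNReal.ofReal_ofNat]
  simp only [Function.comp_apply]
  rw [e2]
  calc _ ≤ (∫⁻ y in Metric.closedBall t h, ‖F y - F t‖ₑ) / ENNReal.ofReal h :=
        ENNReal.div_le_div_right e1 _
    _ = _ := by
        rw [← mul_div_assoc, ENNReal.mul_div_mul_left _ _ (by simp) (by simp)]

lemma continuous_poissonKernel_mul_exp (α : ℝ) {z : ℂ} (hz : ‖z‖ < 1) :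
    Continuous fun φ : ℝ => poissonKernel α (z * Complex.exp (-((φ : ℂ) * Complex.I))) :=
  (contDiffOn_poissonKernel α).continuousOn.comp_continuous (by fun_prop) fun φ => by
    rwa [mem_disk, norm_mul_exp_neg]

/-- A pure exponential has a single Fourier coefficient. This yields both the normalisation of the
kernel and the boundary limit of the radial factors. -/
lemma poissonExtension_mode (α : ℝ) (m : ℤ) {r : ℝ} (h0 : 0 ≤ r) (h1 : r < 1) (t : ℝ) :
    poissonExtension α (fun φ => Complex.exp ((m : ℂ) * φ * Complex.I)) (polar r t) =
      circleMode α (extensionCoeff α fun φ => Complex.exp ((m : ℂ) * φ * Complex.I)) r m *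
        Complex.exp ((m : ℂ) * t * Complex.I) := by
  have h := (hasExpansion_poissonExtension α (F := fun φ => Complex.exp ((m : ℂ) * φ * Complex.I))
    (Continuous.intervalIntegrable (by fun_prop) _ _)).hasSum_circleMode h0 h1 t
  refine h.unique (hasSum_single m fun k hk => ?_)
  have : extensionCoeff α (fun φ => Complex.exp ((m : ℂ) * φ * Complex.I)) k = 0 := by
    rw [extensionCoeff, circleCoeff_exp, if_neg hk.symm]
    simp
  rw [circleMode, this]
  simp

lemma poissonExtension_one (α : ℝ) {r : ℝ} (h0 : 0 ≤ r) (h1 : r < 1) (t : ℝ) :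
    poissonExtension α (fun _ => 1) (polar r t) = 1 := by
  have h := poissonExtension_mode α 0 h0 h1 t
  simp only [Int.cast_zero, zero_mul, Complex.exp_zero] at h
  rw [h, circleMode, if_pos le_rfl]
  have := circleCoeff_exp 0 0
  simp only [Int.cast_zero, zero_mul, Complex.exp_zero] at this
  simp [extensionCoeff, this]

lemma polar_mul_exp_neg (r t φ : ℝ) :
    polar r t * Complex.exp (-((φ : ℂ) * Complex.I)) = polar r (t - φ) := by
  rw [polar, polar, mul_assoc, ← Complex.exp_add]
  congr 2
  push_cast
  ring

lemma poissonExtension_polar_sub (α : ℝ) {F : ℝ → ℂ} (hper : Function.Periodic F (2 * Real.pi))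
    (hint : IntervalIntegrable F volume 0 (2 * Real.pi)) {r : ℝ} (h0 : 0 ≤ r) (h1 : r < 1)
    (t : ℝ) : poissonExtension α F (polar r t) - F t = (1 / (2 * Real.pi) : ℂ) *
      ∫ s in (-Real.pi)..Real.pi, poissonKernel α (polar r (-s)) * (F (t + s) - F t) := by
  have hz : ‖polar r t‖ < 1 := by rwa [norm_polar h0]
  have hk := continuous_poissonKernel_mul_exp α hz
  have e1 : poissonExtension α F (polar r t) - F t = (1 / (2 * Real.pi) : ℂ) *
      ∫ φ in (0 : ℝ)..(2 * Real.pi), poissonKernel α (polar r (t - φ)) * (F φ - F t) := by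
    have h2 : F t = poissonExtension α (fun _ => 1) (polar r t) * F t := by
      rw [poissonExtension_one α h0 h1, one_mul]
    conv_lhs => rw [h2]
    rw [poissonExtension, poissonExtension, mul_assoc, ← mul_sub,
      ← intervalIntegral.integral_mul_const, ← intervalIntegral.integral_sub
        (hint.continuousOn_mul hk.continuousOn) (Continuous.intervalIntegrable (by fun_prop) _ _)]
    congr 1
    refine intervalIntegral.integral_congr fun φ _ => ?_
    simp only [polar_mul_exp_neg]
    ring
  have hp : Function.Periodic (fun φ => poissonKernel α (polar r (t - φ)) * (F φ - F t))
      (2 * Real.pi) := fun φ => by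
    simp only
    rw [hper φ, ← polar_add_two_pi r (t - (φ + 2 * Real.pi)),
      show t - (φ + 2 * Real.pi) + 2 * Real.pi = t - φ by ring]
  have e2 := hp.intervalIntegral_add_eq 0 (t - Real.pi)
  have e3 := intervalIntegral.integral_comp_add_left (a := -Real.pi) (b := Real.pi)
    (fun φ => poissonKernel α (polar r (t - φ)) * (F φ - F t)) t
  rw [e1]
  congr 1
  rw [zero_add, show t - Real.pi + 2 * Real.pi = t + Real.pi by ring, sub_eq_add_neg, ← e3] at e2
  rw [e2]
  refine intervalIntegral.integral_congr fun s _ => ?_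
  rw [show t - (t + s) = -s by ring]

/-- A Fatou type theorem: the radial limits of `poissonExtension α F` at Lebesgue points. -/
theorem tendsto_poissonExtension {α : ℝ} (hα : -1 < α) {F : ℝ → ℂ} (hF : Measurable F)
    (hper : Function.Periodic F (2 * Real.pi))
    (hint : IntervalIntegrable F volume 0 (2 * Real.pi)) {t : ℝ} (ht : IsLebesguePoint F t) :
    Tendsto (fun r => poissonExtension α F (polar r t)) (𝓝[<] 1) (𝓝 (F t)) := by
  have hpi := Real.pi_pos
  have hm : Measurable fun s => ‖F (t + s) - F t‖ₑ := by fun_prop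
  -- Restricting to one period makes the total mass finite and keeps `|s| ≤ π`, where the kernel
  -- bound holds.
  set G : ℝ → ℝ≥0∞ := (Ioc (-Real.pi) Real.pi).indicator fun s => ‖F (t + s) - F t‖ₑ with hG
  have hGm : Measurable G := hm.indicator measurableSet_Ioc
  have hGle : ∀ s, G s ≤ ‖F (t + s) - F t‖ₑ := fun s => indicator_le_self _ _ s
  have hint' : ∀ a b, IntervalIntegrable F volume a b := hper.intervalIntegrable₀ (by positivity) hint
  have hfin : ∫⁻ s, G s ≠ ⊤ := by
    have h1 : IntervalIntegrable (fun s => F (t + s) - F t) volume (-Real.pi) Real.pi := by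
      have := (hint' (t - Real.pi) (t + Real.pi)).comp_add_left t
      rw [sub_sub_cancel_left, add_sub_cancel_left] at this
      exact this.sub intervalIntegrable_const
    rw [intervalIntegrable_iff_integrableOn_Ioc_of_le (by linarith)] at h1
    rw [hG, lintegral_indicator measurableSet_Ioc]
    exact h1.hasFiniteIntegral.ne
  have hA : Tendsto (fun h => (∫⁻ s in Ioo (-h) h, G s) / ENNReal.ofReal h) (𝓝[>] 0) (𝓝 0) :=
    tendsto_of_tendsto_of_tendsto_of_le_of_le tendsto_const_nhds ht (fun _ => zero_le) fun h =>
      ENNReal.div_le_div_right (lintegral_mono hGle) _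
  have hε : Tendsto (fun r : ℝ => 1 - r) (𝓝[<] 1) (𝓝[>] 0) := by
    refine tendsto_nhdsWithin_iff.2 ⟨?_, ?_⟩
    · have : Tendsto (fun r : ℝ => 1 - r) (𝓝 1) (𝓝 (1 - 1)) := (by fun_prop : Continuous _).tendsto _
      rw [sub_self] at this
      exact this.mono_left nhdsWithin_le_nhds
    · filter_upwards [self_mem_nhdsWithin] with r hr
      exact sub_pos.2 (mem_Iio.1 hr)
  have hlim := (tendsto_lintegral_mul_rpow (by linarith : 0 < α + 1) hGm hfin hA).comp hε
  set k := ‖(1 / (2 * Real.pi) : ℂ)‖ₑ with hk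
  set C := ENNReal.ofReal (2 ^ (α + 1) * (1 + Real.pi) ^ (α + 2)) with hC
  have hlim2 := ENNReal.Tendsto.const_mul (a := k * C) hlim
    (Or.inr (ENNReal.mul_ne_top enorm_ne_top ENNReal.ofReal_ne_top))
  rw [mul_zero] at hlim2
  rw [tendsto_iff_edist_tendsto_0]
  refine tendsto_of_tendsto_of_tendsto_of_le_of_le' tendsto_const_nhds hlim2
    (Eventually.of_forall fun _ => zero_le) ?_
  filter_upwards [self_mem_nhdsWithin, mem_nhdsWithin_of_mem_nhds (lt_mem_nhds zero_lt_one)]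
    with r hr1 hr0
  have hr1 : r < 1 := hr1
  have hr : 0 < 1 - r := by linarith
  rw [edist_eq_enorm_sub, poissonExtension_polar_sub α hper hint hr0.le hr1, enorm_mul, mul_assoc,
    intervalIntegral.integral_of_le (by linarith)]
  refine mul_le_mul_right ((enorm_integral_le_lintegral_enorm _).trans ?_) _
  simp only [Function.comp_apply]
  rw [← lintegral_const_mul _ (by fun_prop), ← lintegral_indicator measurableSet_Ioc]
  refine lintegral_mono fun s => ?_
  by_cases hs : s ∈ Ioc (-Real.pi) Real.pi
  · rw [indicator_of_mem hs, hG, indicator_of_mem hs, enorm_mul, mul_comm ‖F (t + s) - F t‖ₑ,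
      ← mul_assoc]
    refine mul_le_mul_left ?_ _
    rw [hC, ← ENNReal.ofReal_mul (by positivity), ← ENNReal.ofReal_mul (by positivity), ← ofReal_norm]
    refine ENNReal.ofReal_le_ofReal ?_
    have := norm_poissonKernel_polar_le hα hr0.le hr1 (s := -s)
      (by rw [abs_neg]; exact abs_le.2 ⟨hs.1.le, hs.2⟩)
    rw [abs_neg] at this
    rwa [show α + 1 + 1 = α + 2 by ring]
  · rw [indicator_of_notMem hs]
    exact zero_le

end KernelHarmonic
end

noncomputable section
namespace KernelHarmonic

/-! ### The boundary function of a bounded function with an expansion -/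

open MeasureTheory Set Filter Topology

variable {α : ℝ} {c : ℤ → ℂ} {u : ℂ → ℂ}

/-- The extension of `e^{-i(n+1)φ}` is this product times the exponential, so the limit follows from
the Fatou theorem at one Lebesgue point, without evaluating a Beta integral. -/
lemma tendsto_kernelCoeff_mul_radialFactor (hα : -1 < α) (n : ℕ) :
    Tendsto (fun r : ℝ => (kernelCoeff α n : ℂ) * (((radialFactor α (n + 1) (r ^ 2) : ℝ) : ℂ) *
      r ^ (n + 1))) (𝓝[<] 1) (𝓝 1) := by
  set F : ℝ → ℂ := fun φ => Complex.exp (((-((n : ℤ) + 1) : ℤ) : ℂ) * φ * Complex.I) with hF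
  have hFc : Continuous F := by fun_prop
  have hper : Function.Periodic F (2 * Real.pi) := fun φ => by
    have := exp_periodic ((n : ℤ) + 1) φ
    simp only [hF]
    simp only [Int.cast_neg, neg_mul] at this ⊢
    exact this
  obtain ⟨t, ht⟩ := (ae_isLebesguePoint hFc.locallyIntegrable).exists
  have h := tendsto_poissonExtension hα hFc.measurable hper (hFc.intervalIntegrable _ _) ht
  have hne : F t ≠ 0 := Complex.exp_ne_zero _
  have h2 := h.mul_const (F t)⁻¹
  rw [mul_inv_cancel₀ hne] at h2
  refine h2.congr' ?_
  filter_upwards [self_mem_nhdsWithin, mem_nhdsWithin_of_mem_nhds (lt_mem_nhds zero_lt_one)]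
    with r hr1 hr0
  rw [hF, poissonExtension_mode α _ hr0.le (mem_Iio.1 hr1), circleMode_neg, extensionCoeff_neg,
    circleCoeff_exp, if_pos rfl, mul_assoc _ (Complex.exp _) _, mul_inv_cancel₀ hne]
  ring

lemma kernelCoeff_ne_zero (hα : -1 < α) (n : ℕ) : (kernelCoeff α n : ℂ) ≠ 0 := fun h => by
  have := tendsto_kernelCoeff_mul_radialFactor hα n
  simp only [h, zero_mul] at this
  exact zero_ne_one (tendsto_nhds_unique tendsto_const_nhds this)

/-- The limits of the Fourier coefficients on circles that exhaust the disk. -/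
def boundaryCoeff (α : ℝ) (c : ℤ → ℂ) (k : ℤ) : ℂ :=
  if 0 ≤ k then c k else c k / kernelCoeff α (k.natAbs - 1)

lemma tendsto_circleMode (hα : -1 < α) (c : ℤ → ℂ) (k : ℤ) :
    Tendsto (fun r => circleMode α c r k) (𝓝[<] 1) (𝓝 (boundaryCoeff α c k)) := by
  rcases lt_or_ge k 0 with h | h
  · obtain ⟨n, rfl⟩ : ∃ n : ℕ, k = -((n : ℤ) + 1) := ⟨k.natAbs - 1, by omega⟩
    have hn : (-((n : ℤ) + 1)).natAbs - 1 = n := by omega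
    rw [boundaryCoeff, if_neg h.not_ge, hn]
    have h2 := (tendsto_kernelCoeff_mul_radialFactor hα n).const_mul
      (c (-((n : ℤ) + 1)) / kernelCoeff α n)
    rw [mul_one] at h2
    refine h2.congr fun r => ?_
    have := kernelCoeff_ne_zero hα n
    rw [circleMode_neg]
    field_simp
  · obtain ⟨n, rfl⟩ := Int.eq_ofNat_of_zero_le h
    simp only [circleMode_natCast, boundaryCoeff, if_pos h]
    have h2 : Tendsto (fun r : ℝ => c n * (r : ℂ) ^ n) (𝓝 1) (𝓝 (c n * ((1 : ℝ) : ℂ) ^ n)) :=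
      (by fun_prop : Continuous fun r : ℝ => c n * (r : ℂ) ^ n).tendsto 1
    rw [Complex.ofReal_one, one_pow, mul_one] at h2
    exact h2.mono_left nhdsWithin_le_nhds

lemma continuous_comp_polar (hu : ContinuousOn u disk) {r : ℝ} (h0 : 0 ≤ r) (h1 : r < 1) :
    Continuous fun t => u (polar r t) :=
  hu.comp_continuous (by unfold polar; fun_prop) fun t => polar_mem_disk h0 h1 t

/-- Parseval on each circle bounds every finite partial sum by `1`; then `r → 1`. -/
lemma HasExpansion.summable_norm_boundaryCoeff_sq (hα : -1 < α) (h : HasExpansion α c u)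
    (hu : ContinuousOn u disk) (hb : ∀ z ∈ disk, ‖u z‖ ≤ 1) :
    Summable fun k => ‖boundaryCoeff α c k‖ ^ 2 := by
  refine summable_of_sum_le (c := 1) (fun k => by positivity) fun s => ?_
  have hlim : Tendsto (fun r => ∑ k ∈ s, ‖circleMode α c r k‖ ^ 2) (𝓝[<] 1)
      (𝓝 (∑ k ∈ s, ‖boundaryCoeff α c k‖ ^ 2)) :=
    tendsto_finsetSum _ fun k _ => (tendsto_circleMode hα c k).norm.pow 2
  refine le_of_tendsto hlim ?_
  filter_upwards [self_mem_nhdsWithin, mem_nhdsWithin_of_mem_nhds (lt_mem_nhds zero_lt_one)]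
    with r hr1 hr0
  have hr1 : r < 1 := hr1
  have hc := continuous_comp_polar hu hr0.le hr1
  have hle : ∀ t, ‖u (polar r t)‖ ≤ 1 := fun t => hb _ (polar_mem_disk hr0.le hr1 t)
  have hs := hasSum_norm_circleCoeff_sq (memLp_of_norm_le hc.measurable hle 2)
  simp only [h.circleCoeff_eq hr0.le hr1] at hs
  refine (sum_le_hasSum s (fun _ _ => by positivity) hs).trans ?_
  have hpi := Real.two_pi_pos
  have hi : ∫ t in (0 : ℝ)..(2 * Real.pi), ‖u (polar r t)‖ ^ 2 ≤
      ∫ t in (0 : ℝ)..(2 * Real.pi), (1 : ℝ) :=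
    intervalIntegral.integral_mono_on hpi.le ((hc.norm.pow 2).intervalIntegrable _ _)
      intervalIntegrable_const fun t _ => pow_le_one₀ (norm_nonneg _) (hle t)
  rw [intervalIntegral.integral_const, sub_zero, smul_eq_mul, mul_one] at hi
  rw [one_div, inv_mul_le_iff₀ hpi, mul_one]
  exact hi

/-- The Riesz–Fischer theorem for functions on the line of period `2π`. -/
lemma exists_circleCoeff_eq {d : ℤ → ℂ} (hd : Summable fun k => ‖d k‖ ^ 2) :
    ∃ F : ℝ → ℂ, Measurable F ∧ Function.Periodic F (2 * Real.pi) ∧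
      IntervalIntegrable F volume 0 (2 * Real.pi) ∧ ∀ k, circleCoeff F k = d k := by
  have hpi := Real.two_pi_pos
  have : Fact (0 < 2 * Real.pi) := ⟨hpi⟩
  have hmem : Memℓp d 2 := memℓp_gen (by simpa using hd)
  set g : Lp ℂ 2 (AddCircle.haarAddCircle (T := 2 * Real.pi)) :=
    fourierBasis.repr.symm ⟨d, hmem⟩ with hg
  have hgd : ∀ k, fourierCoeff g k = d k := fun k => by
    rw [← fourierBasis_repr, hg, LinearIsometryEquiv.apply_symm_apply]
  have hgi : Integrable g (volume : Measure (AddCircle (2 * Real.pi))) := by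
    rw [AddCircle.volume_eq_smul_haarAddCircle]
    exact ((Lp.memLp g).integrable one_le_two).smul_measure ENNReal.ofReal_ne_top
  refine ⟨fun t => g (t : AddCircle (2 * Real.pi)),
    (Lp.stronglyMeasurable g).measurable.comp AddCircle.measurable_mk', fun t => ?_, ?_, fun k => ?_⟩
  · simp only
    rw [AddCircle.coe_add_period]
  · rw [intervalIntegrable_iff_integrableOn_Ioc_of_le hpi.le]
    have := (AddCircle.measurePreserving_mk (2 * Real.pi) 0).integrable_comp_of_integrable hgi
    rwa [zero_add] at this
  · rw [← hgd, fourierCoeff_eq_intervalIntegral _ k 0, circleCoeff, zero_add, Complex.real_smul]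
    push_cast
    congr 1
    refine intervalIntegral.integral_congr fun t _ => ?_
    have : (Real.pi : ℂ) ≠ 0 := by exact_mod_cast Real.pi_ne_zero
    rw [fourier_coe_apply, smul_eq_mul]
    congr 2
    push_cast
    field_simp

lemma HasExpansion.eqOn {v : ℂ → ℂ} (h : HasExpansion α c u) (h' : HasExpansion α c v) :
    EqOn u v disk := fun z hz => by
  obtain ⟨a, b, ha, hb, hab⟩ := h.2 z hz
  obtain ⟨a', b', ha', hb', hab'⟩ := h'.2 z hz
  rw [hab, hab', ha.unique ha', hb.unique hb']

/-- A bounded function with an expansion is the extension of its boundary function. -/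
theorem HasExpansion.exists_boundary (hα : -1 < α) (h : HasExpansion α c u)
    (hu : ContinuousOn u disk) (hb : ∀ z ∈ disk, ‖u z‖ ≤ 1) :
    ∃ F : ℝ → ℂ, extensionCoeff α F = c ∧
      ∀ᵐ t, Tendsto (fun r => u (polar r t)) (𝓝[<] 1) (𝓝 (F t)) := by
  obtain ⟨F, hF, hper, hint, hcoeff⟩ :=
    exists_circleCoeff_eq (h.summable_norm_boundaryCoeff_sq hα hu hb)
  have hc : extensionCoeff α F = c := by
    funext k
    rw [extensionCoeff, hcoeff, boundaryCoeff]
    split_ifs with hk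
    · rfl
    · exact mul_div_cancel₀ _ (kernelCoeff_ne_zero hα _)
  have he := hasExpansion_poissonExtension α hint
  rw [hc] at he
  have heq := h.eqOn he
  have hloc : LocallyIntegrable F := by
    rw [locallyIntegrable_iff]
    intro K hK
    obtain ⟨R, hR⟩ := hK.isBounded.subset_closedBall 0
    have hi := hper.intervalIntegrable₀ Real.two_pi_pos.ne' hint (-|R| - 1) |R|
    rw [intervalIntegrable_iff_integrableOn_Ioc_of_le (by linarith [abs_nonneg R])] at hi
    refine hi.mono_set (hR.trans fun x hx => ?_)
    rw [mem_closedBall_zero_iff, Real.norm_eq_abs, abs_le] at hx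
    constructor <;> linarith [le_abs_self R, hx.1, hx.2]
  refine ⟨F, hc, ?_⟩
  filter_upwards [ae_isLebesguePoint hloc] with t ht
  refine (tendsto_poissonExtension hα hF hper hint ht).congr' ?_
  filter_upwards [self_mem_nhdsWithin, mem_nhdsWithin_of_mem_nhds (lt_mem_nhds zero_lt_one)]
    with r hr1 hr0
  exact (heq (polar_mem_disk hr0.le hr1 t)).symm

lemma circleCoeff_congr_ae {F G : ℝ → ℂ} (h : ∀ᵐ t, F t = G t) (n : ℤ) :
    circleCoeff F n = circleCoeff G n := by
  rw [circleCoeff, circleCoeff]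
  congr 1
  refine intervalIntegral.integral_congr_ae ?_
  filter_upwards [h] with t ht _
  rw [ht]

lemma circleCoeff_conj (F : ℝ → ℂ) (n : ℤ) :
    circleCoeff (fun t => conj (F t)) n = conj (circleCoeff F (-n)) := by
  rw [circleCoeff, circleCoeff, map_mul, intervalIntegral.integral_of_le Real.two_pi_pos.le,
    intervalIntegral.integral_of_le Real.two_pi_pos.le, ← integral_conj]
  congr 1
  · simp [map_ofNat]
  · congr 1
    funext t
    rw [map_mul, ← Complex.exp_conj]
    simp

/-- Heinz's inequality for univalent maps of the disk onto itself. -/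
theorem heinz_of_bijOn (hα : -1 < α) (h : HasExpansion α c u) (hu : ContinuousOn u disk)
    (hb : BijOn u disk disk) : 27 / (4 * Real.pi ^ 2) ≤ heinzSum α c := by
  obtain ⟨F, rfl, hF⟩ := h.exists_boundary hα hu fun z hz => (mem_disk.1 (hb.mapsTo hz)).le
  obtain ⟨t, ht⟩ := hF.exists
  obtain ⟨θ, hθ, hθF⟩ := exists_isMonotoneCircleLift_of_bijOn hu hb ⟨t, F t, ht⟩
  rw [heinzSum_extensionCoeff hα]
  have hheinz := heinz_fourier hθ
  rcases hθF with hθF | hθF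
  · have e : ∀ᵐ t, F t = unimodular θ t := hF.mono fun t ht => hθF t _ ht
    simpa only [circleCoeff_congr_ae e] using hheinz
  · have e : ∀ᵐ t, F t = conj (unimodular θ t) := hF.mono fun t ht => by
      rw [← hθF t _ ht, Complex.conj_conj]
    -- Conjugation interchanges the moduli of the coefficients `1` and `-1`, in which
    -- `heinz_fourier` is symmetric.
    simp only [circleCoeff_congr_ae e, circleCoeff_conj, RCLike.norm_conj, neg_neg, neg_zero]
    linarith

end KernelHarmonic
end

/-! ### Assembly of the theorem. -/

theorem theorem1p2 (α : ℝ) (hα : -1 < α) :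
    -- the inequality for univalent maps of the disk onto itself
    (∀ (u : ℂ → ℂ) (c : ℤ → ℂ),
      KernelHarmonic.IsKernelHarmonic α u →
      KernelHarmonic.HasExpansion α c u →
      Set.BijOn u KernelHarmonic.disk KernelHarmonic.disk →
      27 / (4 * Real.pi ^ 2) ≤ KernelHarmonic.heinzSum α c) ∧
    -- the inequality for Poisson type integrals of monotone boundary functions
    (∀ (θ : ℝ → ℝ) (c : ℤ → ℂ),
      KernelHarmonic.IsMonotoneCircleLift θ →
      KernelHarmonic.HasExpansion α c (KernelHarmonic.poissonIntegral α θ) →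
      27 / (4 * Real.pi ^ 2) ≤ KernelHarmonic.heinzSum α c) ∧
    -- equality for the three-valued step function, which is one of these
    (KernelHarmonic.IsMonotoneCircleLift KernelHarmonic.stepLift ∧
      KernelHarmonic.IsKernelHarmonic α
        (KernelHarmonic.poissonIntegral α KernelHarmonic.stepLift) ∧
      ∃ c : ℤ → ℂ,
        KernelHarmonic.HasExpansion α c
          (KernelHarmonic.poissonIntegral α KernelHarmonic.stepLift) ∧
        KernelHarmonic.heinzSum α c = 27 / (4 * Real.pi ^ 2)) := by
  open KernelHarmonic in
  have hm := measurable_unimodular isMonotoneCircleLift_stepLift.measurable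
  exact ⟨fun u c hu h hb => heinz_of_bijOn hα h hu.1.continuousOn hb,
    fun θ c hθ h => heinz_poissonIntegral hα hθ h, isMonotoneCircleLift_stepLift,
    isKernelHarmonic_poissonExtension α hm fun t => (norm_unimodular t).le,
    extensionCoeff α (unimodular stepLift),
    hasExpansion_poissonExtension α
      (intervalIntegrable_of_norm_le hm (fun t => (norm_unimodular t).le) _ _),
    heinzSum_stepLift hα⟩
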